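/- For a finite set $\mathcal A_N\subset[0,1]^3$ of $N$ points, let $$D_N(x)=\sharp\bigl(\mathcal A_N\cap[\vec 0,x)\bigr)-N\,\bigl|[\vec 0,x)\bigr|,\qquad x\in[0,1]^3,$$ where $[\vec 0,x)=\prod_{j=1}^3[0,x_j)$ and $|\cdot|$ is Lebesgue measure, and let $\|D_N\|_\infty$ be the norm of $D_N$ in $L^\infty([0,1]^3)$. There are absolute constants $\eta\in(0,\tfrac12)$ and $c>0$ such that for every integer $N\ge 1$ and every set $\mathcal A_N\subset[0,1]^3$ of $N$ points, $$\|D_N\|_\infty\ \ge\ c\,(\log N)^{1+\eta}.$$ -/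

import Mathlib

namespace Discrepancy

open MeasureTheory

/-- The half-open box `[0, x) = ∏ j, [0, x j)` in `ℝ^d`. -/
def box {d : ℕ} (x : Fin d → ℝ) : Set (Fin d → ℝ) :=
  Set.univ.pi fun j => Set.Ico 0 (x j)

/-- The discrepancy function of a finite point set `A` with `N = A.card` points:
`D_N(x) = #(A ∩ [0, x)) - N * |[0, x)|`, with `|·|` Lebesgue measure. -/
noncomputable def discrepancy {d : ℕ} (A : Finset (Fin d → ℝ)) (x : Fin d → ℝ) : ℝ :=
  ((↑A ∩ box x : Set (Fin d → ℝ)).ncard : ℝ) - (A.card : ℝ) * volume.real (box x)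

/-- The norm of a function in `L^∞([0,1]^d)`, i.e. its essential supremum over the unit cube
with respect to Lebesgue measure. -/
noncomputable def supNorm {d : ℕ} (f : (Fin d → ℝ) → ℝ) : ENNReal :=
  eLpNorm f ⊤ (volume.restrict (Set.Icc (0 : Fin d → ℝ) 1))

end Discrepancy

/-! The proof is by duality with a short Riesz product. Choose `n` with `2N ≤ 2^n ≤ 4N` and replace
the unit cube by a dyadic grid with `n + 1` binary digits in each coordinate (`Cube`). For `a + b +
c = n` let `f a b c` be minus the Haar sign on the dyadic boxes of shape `(a, b, c)` that contain no
point of `A`, and zero elsewhere. At least half of these boxes are empty, and there only the volume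
part of `D_N` is seen, so each of the roughly `n²/2` functions has correlation at least `N 2^(-n-7)`
with `D_N` (`le_sum_emptyBoxFun_mul`).

Cut the first index into `q` blocks, expand `∏ t, (1 + ρ ∑ f)` with the `t`-th sum over the `t`-th
block, and keep only the products whose factors differ pairwise in all three indices
(`distinctSum`); the first indices differ by construction. Such a product is odd under the flip of
its finest digit in every coordinate, so its pairing with `D_N` decays as its indices spread out,
and products of two or more factors are negligible against the single ones
(`HaarFamily.le_sum_mul_distinctSum`). Hence the average of `distinctSum * D_N` is at least a
constant times `n² ρ`, up to the mean of `D_N`.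

It remains to bound the L¹ norm of `distinctSum` by a constant
(`HaarFamily.sum_abs_distinctSum_le`). Distinctness is expressed by signed sums over two
permutations (`sum_injective_eq_sum_perm`). At a fixed point of the cube each resulting term is a
contraction of matrices, to which Cauchy–Schwarz applies (`contraction_sq_le`): indices moved by a
permutation cost a small factor, and those fixed by both leave a genuine Riesz product `∏ |1 +
...|`. The latter has bounded mean, because every block is a martingale with small square function
(`IsFlipMartingale.sum_riesz_le`). The small factor comes from estimates of coincidences, valid
outside a tiny set of points (`HaarFamily.control`), which follow from an exponential martingale
inequality.

The scales are `n + 1 = K ^ 2048`, `k = 1 / K`, `q ≈ K ^ 3`, `ρ = k ^ 2047`. Thus `n² ρ` is about `n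
K`, which gives `η = 1 / 2048`. -/

namespace Discrepancy

open Finset

/-! ### Exceptional sets and the union bound. -/

section Exceptional

variable {Ω : Type*} [Fintype Ω]

/-- `P` holds outside a set of at most `ε * |Ω|` points of the finite space `Ω`. -/
def HoldsOutside (ε : ℝ) (P : Ω → Prop) : Prop :=
  ∃ B : Finset Ω, (B.card : ℝ) ≤ ε * Fintype.card Ω ∧ ∀ ω, ω ∉ B → P ω

theorem HoldsOutside.mono {ε ε' : ℝ} {P P' : Ω → Prop} (h : HoldsOutside ε P) (hε : ε ≤ ε')
    (hP : ∀ ω, P ω → P' ω) : HoldsOutside ε' P' := by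
  obtain ⟨B, hB, h⟩ := h
  exact ⟨B, hB.trans (by gcongr), fun ω hω => hP ω (h ω hω)⟩

theorem HoldsOutside.and {ε ε' : ℝ} {P P' : Ω → Prop} (h : HoldsOutside ε P)
    (h' : HoldsOutside ε' P') : HoldsOutside (ε + ε') (fun ω => P ω ∧ P' ω) := by
  classical
  obtain ⟨B, hB, h⟩ := h
  obtain ⟨B', hB', h'⟩ := h'
  refine ⟨B ∪ B', ?_, fun ω hω => ?_⟩
  · have : ((B ∪ B').card : ℝ) ≤ B.card + B'.card := by exact_mod_cast card_union_le B B'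
    linarith
  · rw [notMem_union] at hω
    exact ⟨h ω hω.1, h' ω hω.2⟩

theorem HoldsOutside.forall {ι : Type*} (s : Finset ι) {ε : ℝ} {P : ι → Ω → Prop}
    (h : ∀ i ∈ s, HoldsOutside ε (P i)) :
    HoldsOutside (s.card * ε) (fun ω => ∀ i ∈ s, P i ω) := by
  classical
  induction s using Finset.induction_on with
  | empty => exact ⟨∅, by simp, by simp⟩
  | insert a s ha ih =>
    have h1 := (h a (mem_insert_self a s)).and (ih fun i hi => h i (mem_insert_of_mem hi))
    refine h1.mono ?_ ?_
    · rw [card_insert_of_notMem ha]; push_cast; linarith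
    · rintro ω ⟨h2, h3⟩ i hi
      rcases mem_insert.1 hi with rfl | hi
      · exact h2
      · exact h3 i hi

end Exceptional

/-! ### Exponential inequalities for martingales defined by flips. -/

section Martingale

set_option linter.unusedSectionVars false

variable {Ω : Type*} [Fintype Ω]

/-- A sequence of functions on a space with flips `φ c`, such that the `c`-th one is odd under
the `c`-th flip and invariant under the later ones. -/
structure IsFlipMartingale (φ : ℕ → Equiv.Perm Ω) (d : ℕ → Ω → ℝ) : Prop where
  odd : ∀ c ω, d c (φ c ω) = -d c ω
  inv : ∀ c c', c < c' → ∀ ω, d c (φ c' ω) = d c ω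

variable {φ : ℕ → Equiv.Perm Ω} {d : ℕ → Ω → ℝ}

theorem IsFlipMartingale.const_mul (h : IsFlipMartingale φ d) (θ : ℝ) :
    IsFlipMartingale φ (fun c ω => θ * d c ω) :=
  ⟨fun c ω => by rw [h.odd]; ring, fun c c' hc ω => by rw [h.inv c c' hc]⟩

theorem IsFlipMartingale.sum_mul_eq_zero (h : IsFlipMartingale φ d) {G : Ω → ℝ} {c : ℕ}
    (hG : ∀ ω, G (φ c ω) = G ω) : ∑ ω, G ω * d c ω = 0 := by
  have h1 : ∑ ω, G ω * d c ω = -∑ ω, G ω * d c ω := by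
    conv_lhs => rw [← Equiv.sum_comp (φ c)]
    rw [← sum_neg_distrib]
    refine sum_congr rfl fun ω _ => ?_
    rw [hG, h.odd]; ring
  linarith

/-- Averaging over the `k`-th flip turns the last factor into `cosh d * exp (-d² / 2) ≤ 1`. The
compensator uses the actual squares, which are themselves invariant under the flip, so no bound on
`d` is needed. -/
theorem IsFlipMartingale.sum_mul_exp_le (h : IsFlipMartingale φ d) {G : Ω → ℝ}
    (hG0 : ∀ ω, 0 ≤ G ω) {k₀ k : ℕ} (hk : k₀ ≤ k) (hG : ∀ c, k₀ ≤ c → ∀ ω, G (φ c ω) = G ω) :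
    ∑ ω, G ω * Real.exp (∑ c ∈ Ico k₀ k, (d c ω - d c ω ^ 2 / 2)) ≤ ∑ ω, G ω := by
  induction k, hk using Nat.le_induction with
  | base => simp
  | succ k hk ih =>
    refine le_trans ?_ ih
    set Z : Ω → ℝ := fun ω => G ω * Real.exp (∑ c ∈ Ico k₀ k, (d c ω - d c ω ^ 2 / 2)) with hZ
    have hZ0 : ∀ ω, 0 ≤ Z ω := fun ω => mul_nonneg (hG0 ω) (Real.exp_pos _).le
    have hZφ : ∀ ω, Z (φ k ω) = Z ω := by
      intro ω
      simp only [hZ, hG k hk]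
      congr 2
      refine sum_congr rfl fun c hc => ?_
      rw [h.inv c k (mem_Ico.1 hc).2]
    have e1 : ∀ ω, G ω * Real.exp (∑ c ∈ Ico k₀ (k + 1), (d c ω - d c ω ^ 2 / 2))
        = Z ω * Real.exp (d k ω - d k ω ^ 2 / 2) := by
      intro ω
      rw [sum_Ico_succ_top hk, Real.exp_add, ← mul_assoc]
    simp_rw [e1]
    have e2 : ∑ ω, Z ω * Real.exp (d k ω - d k ω ^ 2 / 2)
        = ∑ ω, Z ω * Real.exp (-d k ω - d k ω ^ 2 / 2) := by
      conv_lhs => rw [← Equiv.sum_comp (φ k)]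
      refine sum_congr rfl fun ω _ => ?_
      rw [hZφ, h.odd]; ring_nf
    have e3 : ∑ ω, Z ω * Real.exp (d k ω - d k ω ^ 2 / 2)
        = ∑ ω, Z ω * (Real.cosh (d k ω) * Real.exp (-(d k ω ^ 2 / 2))) := by
      have : ∑ ω, Z ω * Real.exp (d k ω - d k ω ^ 2 / 2)
          = (∑ ω, Z ω * Real.exp (d k ω - d k ω ^ 2 / 2)
            + ∑ ω, Z ω * Real.exp (-d k ω - d k ω ^ 2 / 2)) / 2 := by rw [← e2]; ring
      rw [this, ← sum_add_distrib, sum_div]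
      refine sum_congr rfl fun ω _ => ?_
      rw [Real.cosh_eq, sub_eq_add_neg, sub_eq_add_neg, Real.exp_add, Real.exp_add]; ring
    rw [e3]
    refine sum_le_sum fun ω _ => ?_
    have h4 : Real.cosh (d k ω) * Real.exp (-(d k ω ^ 2 / 2)) ≤ 1 := by
      rw [Real.exp_neg, ← div_eq_mul_inv, div_le_one (Real.exp_pos _)]
      exact Real.cosh_le_exp_half_sq _
    calc Z ω * _ ≤ Z ω * 1 := mul_le_mul_of_nonneg_left h4 (hZ0 ω)
      _ = Z ω := mul_one _

theorem IsFlipMartingale.sum_mul_exp_le_of_sq_le (h : IsFlipMartingale φ d) {G : Ω → ℝ}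
    (hG0 : ∀ ω, 0 ≤ G ω) {k₀ k : ℕ} (hk : k₀ ≤ k) (hG : ∀ c, k₀ ≤ c → ∀ ω, G (φ c ω) = G ω)
    {L : ℝ} (hL : ∀ ω, ∑ c ∈ Ico k₀ k, d c ω ^ 2 ≤ L) (θ : ℝ) :
    ∑ ω, G ω * Real.exp (θ * ∑ c ∈ Ico k₀ k, d c ω) ≤ Real.exp (θ ^ 2 * L / 2) * ∑ ω, G ω := by
  have h1 := (h.const_mul θ).sum_mul_exp_le hG0 hk hG
  refine le_trans ?_ (mul_le_mul_of_nonneg_left h1 (Real.exp_pos _).le)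
  rw [mul_sum]
  refine sum_le_sum fun ω _ => ?_
  rw [mul_left_comm, ← Real.exp_add]
  refine mul_le_mul_of_nonneg_left (Real.exp_le_exp.2 ?_) (hG0 ω)
  have h2 : ∑ c ∈ Ico k₀ k, (θ * d c ω - (θ * d c ω) ^ 2 / 2)
      = θ * ∑ c ∈ Ico k₀ k, d c ω - θ ^ 2 / 2 * ∑ c ∈ Ico k₀ k, d c ω ^ 2 := by
    rw [mul_sum, mul_sum, ← sum_sub_distrib]
    refine sum_congr rfl fun c _ => by ring
  rw [h2]
  nlinarith [hL ω, sq_nonneg θ]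

/-- Markov's inequality for the compensated exponential with `θ = l / √L`. The square function has
to be small only on the event considered. -/
theorem IsFlipMartingale.sum_le_outside (h : IsFlipMartingale φ d) {k₀ k : ℕ} (hk : k₀ ≤ k)
    {L l : ℝ} (hL : 0 < L) (hl : 0 ≤ l) :
    HoldsOutside (Real.exp (-(l ^ 2 / 2)))
      (fun ω => ∑ c ∈ Ico k₀ k, d c ω ^ 2 ≤ L → ∑ c ∈ Ico k₀ k, d c ω ≤ l * √L) := by
  classical
  refine ⟨univ.filter fun ω => ¬(∑ c ∈ Ico k₀ k, d c ω ^ 2 ≤ L →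
    ∑ c ∈ Ico k₀ k, d c ω ≤ l * √L), ?_, fun ω hω => by simpa using hω⟩
  set B := univ.filter fun ω => ¬(∑ c ∈ Ico k₀ k, d c ω ^ 2 ≤ L →
    ∑ c ∈ Ico k₀ k, d c ω ≤ l * √L) with hB
  have hs : 0 < √L := Real.sqrt_pos.2 hL
  set θ := l / √L with hθ
  have hθ0 : 0 ≤ θ := by positivity
  have hθL : θ * √L = l := by rw [hθ]; field_simp
  have hθ2 : θ ^ 2 * L = l ^ 2 := by
    rw [← hθL, mul_pow, Real.sq_sqrt hL.le]
  have h1 := (h.const_mul θ).sum_mul_exp_le (G := fun _ => 1) (by simp) hk (by simp)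
  simp only [one_mul, sum_const, card_univ, nsmul_eq_mul, mul_one] at h1
  have h2 : (B.card : ℝ) * Real.exp (l ^ 2 / 2) ≤ Fintype.card Ω := by
    refine le_trans ?_ h1
    rw [← nsmul_eq_mul, ← sum_const]
    refine le_trans (sum_le_sum fun ω hω => ?_)
      (sum_le_sum_of_subset_of_nonneg (subset_univ B) fun ω _ _ => (Real.exp_pos _).le)
    rw [hB, mem_filter] at hω
    have hω2 := hω.2
    push Not at hω2
    obtain ⟨h3, h4⟩ := hω2
    refine Real.exp_le_exp.2 ?_
    have h5 : ∑ c ∈ Ico k₀ k, (θ * d c ω - (θ * d c ω) ^ 2 / 2)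
        = θ * ∑ c ∈ Ico k₀ k, d c ω - θ ^ 2 / 2 * ∑ c ∈ Ico k₀ k, d c ω ^ 2 := by
      rw [mul_sum, mul_sum, ← sum_sub_distrib]
      refine sum_congr rfl fun c _ => by ring
    rw [h5]
    have h6 : θ * (l * √L) ≤ θ * ∑ c ∈ Ico k₀ k, d c ω := mul_le_mul_of_nonneg_left h4.le hθ0
    have h7 : θ ^ 2 / 2 * ∑ c ∈ Ico k₀ k, d c ω ^ 2 ≤ θ ^ 2 / 2 * L :=
      mul_le_mul_of_nonneg_left h3 (by positivity)
    have h8 : θ * (l * √L) = l ^ 2 := by rw [mul_left_comm, hθL]; ring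
    linarith
  rw [Real.exp_neg, mul_comm, ← div_eq_mul_inv, le_div_iff₀ (Real.exp_pos _)]
  exact h2

theorem IsFlipMartingale.abs_sum_le_outside (h : IsFlipMartingale φ d) {k₀ k : ℕ} (hk : k₀ ≤ k)
    {L l : ℝ} (hL : 0 < L) (hl : 0 ≤ l) :
    HoldsOutside (2 * Real.exp (-(l ^ 2 / 2)))
      (fun ω => ∑ c ∈ Ico k₀ k, d c ω ^ 2 ≤ L → |∑ c ∈ Ico k₀ k, d c ω| ≤ l * √L) := by
  have h1 := h.sum_le_outside hk hL hl
  have h2 := (h.const_mul (-1)).sum_le_outside hk hL hl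
  refine (h1.and h2).mono (by linarith) ?_
  rintro ω ⟨h3, h4⟩ h5
  simp only [neg_mul, one_mul, sum_neg_distrib, neg_sq] at h4
  exact abs_le.2 ⟨by linarith [h4 h5], h3 h5⟩

/-- The last term dominates twice the negative part of `1 + x`, since `exp u ≥ 1 + u` and `θ ≥ 1`.
-/
theorem abs_one_add_le {x θ : ℝ} (hθ : 1 ≤ θ) :
    |1 + x| ≤ 1 + x + 2 * (Real.exp (-θ) * Real.exp (-θ * x)) := by
  have hp : 0 < Real.exp (-θ) * Real.exp (-θ * x) := by positivity
  rcases le_or_gt 0 (1 + x) with h | h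
  · rw [abs_of_nonneg h]; linarith
  · rw [abs_of_neg h, ← Real.exp_add]
    have h1 := Real.add_one_le_exp (-θ + -θ * x)
    nlinarith

/-- The linear part has mean zero against `G`. With `θ = 1 / L` the negative part costs `exp (-1 /
L) * exp (1 / (2 L))`. -/
theorem IsFlipMartingale.sum_mul_abs_one_add_le (h : IsFlipMartingale φ d) {G : Ω → ℝ}
    (hG0 : ∀ ω, 0 ≤ G ω) {k₀ k : ℕ} (hk : k₀ ≤ k) (hG : ∀ c, k₀ ≤ c → ∀ ω, G (φ c ω) = G ω)
    {L : ℝ} (hL0 : 0 < L) (hL1 : L ≤ 1) (hL : ∀ ω, ∑ c ∈ Ico k₀ k, d c ω ^ 2 ≤ L) :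
    ∑ ω, G ω * |1 + ∑ c ∈ Ico k₀ k, d c ω|
      ≤ (1 + 2 * Real.exp (-(1 / (2 * L)))) * ∑ ω, G ω := by
  have hθ : 1 ≤ 1 / L := by rw [le_div_iff₀ hL0]; linarith
  have h1 := h.sum_mul_exp_le_of_sq_le hG0 hk hG hL (-(1 / L))
  have h2 : ∑ ω, G ω * ∑ c ∈ Ico k₀ k, d c ω = 0 := by
    simp_rw [mul_sum]
    rw [sum_comm]
    exact sum_eq_zero fun c hc => h.sum_mul_eq_zero (hG c (mem_Ico.1 hc).1)
  calc ∑ ω, G ω * |1 + ∑ c ∈ Ico k₀ k, d c ω|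
      ≤ ∑ ω, G ω * (1 + ∑ c ∈ Ico k₀ k, d c ω + 2 * (Real.exp (-(1 / L)) *
          Real.exp (-(1 / L) * ∑ c ∈ Ico k₀ k, d c ω))) :=
        sum_le_sum fun ω _ => mul_le_mul_of_nonneg_left (abs_one_add_le hθ) (hG0 ω)
    _ = ∑ ω, G ω + ∑ ω, G ω * ∑ c ∈ Ico k₀ k, d c ω + 2 * Real.exp (-(1 / L)) *
          ∑ ω, G ω * Real.exp (-(1 / L) * ∑ c ∈ Ico k₀ k, d c ω) := by
        rw [mul_sum, ← sum_add_distrib, ← sum_add_distrib]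
        exact sum_congr rfl fun ω _ => by ring
    _ ≤ ∑ ω, G ω + 0 + 2 * Real.exp (-(1 / L)) *
          (Real.exp ((-(1 / L)) ^ 2 * L / 2) * ∑ ω, G ω) := by
        rw [h2]
        gcongr
    _ = (1 + 2 * Real.exp (-(1 / (2 * L)))) * ∑ ω, G ω := by
        have h3 : Real.exp (-(1 / L)) * Real.exp ((-(1 / L)) ^ 2 * L / 2)
            = Real.exp (-(1 / (2 * L))) := by
          rw [← Real.exp_add]; congr 1; field_simp; ring
        rw [← h3]; ring

open Classical in
/-- The sequence `d` on `[k₀, ∞)`, stopped as soon as the sum of squares exceeds `L`. -/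
noncomputable def stopSeq (d : ℕ → Ω → ℝ) (k₀ : ℕ) (L : ℝ) (c : ℕ) (ω : Ω) : ℝ :=
  if ∑ j ∈ Ico k₀ (c + 1), d j ω ^ 2 ≤ L then d c ω else 0

theorem IsFlipMartingale.stopped (h : IsFlipMartingale φ d) (k₀ : ℕ) (L : ℝ) :
    IsFlipMartingale φ (stopSeq d k₀ L) := by
  constructor
  · intro c ω
    -- The stopping rule involves the current square, but squares do not see the sign change, so
    -- oddness survives.
    have h1 : ∑ j ∈ Ico k₀ (c + 1), d j (φ c ω) ^ 2 = ∑ j ∈ Ico k₀ (c + 1), d j ω ^ 2 := by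
      refine sum_congr rfl fun j hj => ?_
      rcases (Nat.lt_succ_iff.1 (mem_Ico.1 hj).2).eq_or_lt with rfl | hj
      · rw [h.odd]; ring
      · rw [h.inv j c hj]
    unfold stopSeq
    rw [h1, h.odd]
    split_ifs <;> simp
  · intro c c' hc ω
    have h1 : ∑ j ∈ Ico k₀ (c + 1), d j (φ c' ω) ^ 2 = ∑ j ∈ Ico k₀ (c + 1), d j ω ^ 2 := by
      refine sum_congr rfl fun j hj => ?_
      rw [h.inv j c' (by have := (mem_Ico.1 hj).2; omega)]
    unfold stopSeq
    rw [h1, h.inv c c' hc]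

theorem sum_stopped_sq_le {k₀ k : ℕ} (hk : k₀ ≤ k) {L : ℝ} (hL : 0 ≤ L) (ω : Ω) :
    ∑ c ∈ Ico k₀ k, stopSeq d k₀ L c ω ^ 2 ≤ L := by
  -- Both bounds are carried along: the first serves while the sequence runs, the second once it has
  -- stopped.
  suffices hs : ∑ c ∈ Ico k₀ k, stopSeq d k₀ L c ω ^ 2 ≤ ∑ c ∈ Ico k₀ k, d c ω ^ 2 ∧
      ∑ c ∈ Ico k₀ k, stopSeq d k₀ L c ω ^ 2 ≤ L from hs.2
  induction k, hk using Nat.le_induction with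
  | base => simpa using hL
  | succ k hk ih =>
    have h1 : stopSeq d k₀ L k ω ^ 2 ≤ d k ω ^ 2 := by
      unfold stopSeq; split_ifs <;> simp; positivity
    rw [sum_Ico_succ_top hk, sum_Ico_succ_top hk]
    refine ⟨add_le_add ih.1 h1, ?_⟩
    by_cases hc : ∑ j ∈ Ico k₀ (k + 1), d j ω ^ 2 ≤ L
    · rw [sum_Ico_succ_top hk] at hc
      linarith [ih.1]
    · have h2 : stopSeq d k₀ L k ω = 0 := by unfold stopSeq; rw [if_neg hc]
      rw [h2]; linarith [ih.2]

theorem stopped_eq {k₀ k : ℕ} {L : ℝ} {ω : Ω} (hL : ∑ c ∈ Ico k₀ k, d c ω ^ 2 ≤ L) {c : ℕ}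
    (hc : c < k) : stopSeq d k₀ L c ω = d c ω := by
  unfold stopSeq
  rw [if_pos]
  refine le_trans (sum_le_sum_of_subset_of_nonneg ?_ fun _ _ _ => sq_nonneg _) hL
  intro j hj
  rw [mem_Ico] at hj ⊢
  omega

end Martingale

/-! ### Deterministic inequalities for square matrices. -/

section Finite

theorem sum_sum_range_symm (g : ℕ → ℕ → ℝ) (hg : ∀ a b, g a b = g b a) (m : ℕ) :
    ∑ a ∈ range m, ∑ b ∈ range m, g a b
      = ∑ a ∈ range m, g a a + 2 * ∑ b ∈ range m, ∑ a ∈ range b, g a b := by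
  induction m with
  | zero => simp
  | succ m ih =>
    have h1 : ∑ a ∈ range m, g m a = ∑ a ∈ range m, g a m := sum_congr rfl fun a _ => hg m a
    simp only [sum_range_succ, sum_add_distrib, ih, h1]
    ring

theorem sq_sum_range_eq (z : ℕ → ℝ) (m : ℕ) :
    (∑ b ∈ range m, z b) ^ 2
      = ∑ b ∈ range m, z b ^ 2 + 2 * ∑ b ∈ range m, ∑ b' ∈ range b, z b' * z b := by
  rw [sq, sum_mul_sum, sum_sum_range_symm _ fun a b => mul_comm _ _]
  simp only [sq]

theorem abs_sum_range_le (z : ℕ → ℝ) (m : ℕ) {C : ℝ} (hz : ∀ b ∈ range m, |z b| ≤ C) :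
    |∑ b ∈ range m, z b| ≤ m * C := by
  refine (abs_sum_le_sum_abs _ _).trans ((sum_le_sum hz).trans ?_)
  simp

/-- The sum of the squares of the entries of `w wᵀ`. -/
def gramSq (m : ℕ) (w : ℕ → ℕ → ℝ) : ℝ :=
  ∑ a ∈ range m, ∑ a' ∈ range m, (∑ b ∈ range m, w a b * w a' b) ^ 2

/-- The off-diagonal part of the sum of the squares of the row sums. -/
def pairSum (m : ℕ) (w : ℕ → ℕ → ℝ) : ℝ :=
  ∑ a ∈ range m, ((∑ b ∈ range m, w a b) ^ 2 - ∑ b ∈ range m, w a b ^ 2)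

/-- The terms with `a = a'` or `b = b'` contribute at most `2 m³`. The rest is a sum over proper
rectangles, each listed by its ordered sides. -/
theorem gramSq_le {m : ℕ} {w : ℕ → ℕ → ℝ} (hw : ∀ a b, |w a b| ≤ 1) :
    gramSq m w ≤ 2 * (m : ℝ) ^ 3 + 4 * ∑ a' ∈ range m, ∑ a ∈ range a', ∑ b' ∈ range m,
      ∑ b ∈ range b', w a b * w a b' * w a' b * w a' b' := by
  have hz : ∀ a a' b, |w a b * w a' b| ≤ 1 := fun a a' b => by
    rw [abs_mul]; exact mul_le_one₀ (hw a b) (abs_nonneg _) (hw a' b)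
  unfold gramSq
  rw [sum_sum_range_symm _ fun a a' => by simp only [mul_comm]]
  have h1 : ∑ a ∈ range m, (∑ b ∈ range m, w a b * w a b) ^ 2 ≤ (m : ℝ) ^ 3 := by
    have : ∀ a ∈ range m, (∑ b ∈ range m, w a b * w a b) ^ 2 ≤ (m : ℝ) ^ 2 := fun a _ => by
      have h := abs_sum_range_le (fun b => w a b * w a b) m (C := 1) fun b _ => hz a a b
      rw [← sq_abs]
      gcongr; linarith
    refine (sum_le_sum this).trans ?_
    simp; ring_nf; rfl
  have h2 : ∀ a' ∈ range m, ∑ a ∈ range a', (∑ b ∈ range m, w a b * w a' b) ^ 2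
      ≤ ∑ a ∈ range a', (m + 2 * ∑ b' ∈ range m,
      ∑ b ∈ range b', w a b * w a b' * w a' b * w a' b') := fun a' _ => by
    refine sum_le_sum fun a _ => ?_
    rw [sq_sum_range_eq]
    have h3 : ∑ b ∈ range m, (w a b * w a' b) ^ 2 ≤ m := by
      have : ∀ b ∈ range m, (w a b * w a' b) ^ 2 ≤ (1 : ℝ) := fun b _ => by
        rw [sq_le_one_iff_abs_le_one]; exact hz a a' b
      refine (sum_le_sum this).trans ?_
      simp
    refine add_le_add h3 (le_of_eq ?_)
    congr 1
    refine sum_congr rfl fun b' _ => sum_congr rfl fun b _ => by ring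
  have h4 := sum_le_sum h2
  simp only [sum_add_distrib] at h4
  have h5 : ∑ a' ∈ range m, ∑ a ∈ range a', (m : ℝ) ≤ (m : ℝ) ^ 3 / 2 := by
    simp only [sum_const, card_range, nsmul_eq_mul]
    rw [← sum_mul]
    have : (∑ i ∈ range m, (i : ℝ)) * 2 ≤ (m : ℝ) ^ 2 := by
      have := Finset.sum_range_id_mul_two m
      have h6 : ((∑ i ∈ range m, i : ℕ) : ℝ) * 2 = ((m * (m - 1) : ℕ) : ℝ) := by
        exact_mod_cast this
      push_cast at h6
      rw [h6]
      have h7 : ((m - 1 : ℕ) : ℝ) ≤ m := by exact_mod_cast Nat.sub_le m 1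
      nlinarith [(Nat.cast_nonneg m : (0 : ℝ) ≤ m)]
    nlinarith [(Nat.cast_nonneg m : (0 : ℝ) ≤ m)]
  simp only [← mul_sum] at h4
  linarith

/-- The left side is the quadratic form of `w wᵀ` at `S`, bounded through the Hilbert–Schmidt norm.
-/
theorem sum_sq_mul_le_gramSq (m : ℕ) (w : ℕ → ℕ → ℝ) (S : ℕ → ℝ) :
    ∑ b ∈ range m, (∑ a ∈ range m, w a b * S a) ^ 2
      ≤ √(gramSq m w) * ∑ a ∈ range m, S a ^ 2 := by
  have h1 : ∑ b ∈ range m, (∑ a ∈ range m, w a b * S a) ^ 2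
      = ∑ p ∈ range m ×ˢ range m, (∑ b ∈ range m, w p.1 b * w p.2 b) * (S p.1 * S p.2) := by
    rw [sum_product]
    simp_rw [sq, sum_mul_sum, sum_mul]
    rw [sum_comm]
    refine sum_congr rfl fun a _ => ?_
    rw [sum_comm]
    refine sum_congr rfl fun a' _ => sum_congr rfl fun b _ => by ring
  rw [h1]
  refine (Real.sum_mul_le_sqrt_mul_sqrt _ _ _).trans (le_of_eq ?_)
  congr 1
  · rw [sum_product]; rfl
  · rw [sum_product]
    have : ∑ a ∈ range m, ∑ a' ∈ range m, (S a * S a') ^ 2 = (∑ a ∈ range m, S a ^ 2) ^ 2 := by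
      rw [sq, sum_mul_sum]
      refine sum_congr rfl fun a _ => sum_congr rfl fun b _ => by ring
    rw [this, Real.sqrt_sq (sum_nonneg fun _ _ => sq_nonneg _)]

theorem pairSum_eq (m : ℕ) (w : ℕ → ℕ → ℝ) :
    pairSum m w = 2 * ∑ b ∈ range m, ∑ a ∈ range m, w a b * ∑ b' ∈ range b, w a b' := by
  unfold pairSum
  rw [sum_comm, mul_sum]
  refine sum_congr rfl fun a _ => ?_
  rw [sq_sum_range_eq, add_sub_cancel_left]
  congr 1
  refine sum_congr rfl fun b _ => ?_
  rw [mul_sum]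
  exact sum_congr rfl fun b' _ => mul_comm _ _

/-- This controls the square function of the martingale in `pairSum_eq`. The partial row sums are
frozen at multiples of `L`: each of the at most `m / L + 1` frozen vectors falls under
`sum_sq_mul_le_gramSq`, and the remainders are sums over fewer than `L` columns, covered by `hlin`.
-/
theorem sum_sq_le_of_block {m : ℕ} {w : ℕ → ℕ → ℝ} (hw : ∀ a b, |w a b| ≤ 1) {l : ℝ}
    (hl : 0 ≤ l)
    (hlin : ∀ a < m, ∀ b₁ b₂, b₁ ≤ b₂ → b₂ ≤ m →
      |∑ b ∈ Ico b₁ b₂, w a b| ≤ l * √((b₂ - b₁ : ℕ) : ℝ))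
    {L : ℕ} (hL : 0 < L) :
    ∑ b ∈ range m, (∑ a ∈ range m, w a b * ∑ b' ∈ range b, w a b') ^ 2
      ≤ 2 * (m / L + 1) * (√(gramSq m w) * (m ^ 2 * l ^ 2)) + 2 * (m ^ 3 * l ^ 2 * L) := by
  set S : ℕ → ℕ → ℝ := fun u a => ∑ b' ∈ range (L * u), w a b' with hS
  have hm : (0 : ℝ) ≤ m := Nat.cast_nonneg m
  have h1 : ∀ b ∈ range m, (∑ a ∈ range m, w a b * ∑ b' ∈ range b, w a b') ^ 2
      ≤ 2 * (∑ a ∈ range m, w a b * S (b / L) a) ^ 2 + 2 * (m ^ 2 * l ^ 2 * L) := by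
    intro b hb
    have hb := mem_range.1 hb
    have hLb : L * (b / L) ≤ b := Nat.mul_div_le b L
    have e1 : ∑ a ∈ range m, w a b * ∑ b' ∈ range b, w a b'
        = ∑ a ∈ range m, w a b * S (b / L) a
          + ∑ a ∈ range m, w a b * ∑ b' ∈ Ico (L * (b / L)) b, w a b' := by
      rw [← sum_add_distrib]
      refine sum_congr rfl fun a _ => ?_
      rw [← mul_add, hS, sum_range_add_sum_Ico _ hLb]
    have e2 : |∑ a ∈ range m, w a b * ∑ b' ∈ Ico (L * (b / L)) b, w a b'|
        ≤ m * (l * √L) := by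
      refine abs_sum_range_le _ m fun a ha => ?_
      rw [abs_mul]
      calc |w a b| * |∑ b' ∈ Ico (L * (b / L)) b, w a b'|
          ≤ 1 * (l * √((b - L * (b / L) : ℕ) : ℝ)) := by
            gcongr
            · exact hw a b
            · exact hlin a (mem_range.1 ha) _ _ hLb hb.le
        _ ≤ l * √L := by
            rw [one_mul]
            gcongr
            have := Nat.mod_lt b hL
            have := Nat.div_add_mod b L
            omega
    have e3 : (∑ a ∈ range m, w a b * ∑ b' ∈ Ico (L * (b / L)) b, w a b') ^ 2
        ≤ m ^ 2 * l ^ 2 * L := by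
      rw [← sq_abs]
      calc _ ≤ (m * (l * √L)) ^ 2 := by gcongr
        _ = _ := by rw [mul_pow, mul_pow, Real.sq_sqrt (Nat.cast_nonneg L)]; ring
    rw [e1]
    nlinarith [sq_nonneg (∑ a ∈ range m, w a b * S (b / L) a
      - ∑ a ∈ range m, w a b * ∑ b' ∈ Ico (L * (b / L)) b, w a b')]
  have h2 : ∑ b ∈ range m, (∑ a ∈ range m, w a b * S (b / L) a) ^ 2
      ≤ ∑ u ∈ range (m / L + 1), ∑ b ∈ range m, (∑ a ∈ range m, w a b * S u a) ^ 2 := by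
    rw [sum_comm]
    refine sum_le_sum fun b hb => ?_
    refine single_le_sum (f := fun u => (∑ a ∈ range m, w a b * S u a) ^ 2)
      (fun _ _ => sq_nonneg _) ?_
    have := Nat.div_le_div_right (c := L) (mem_range.1 hb).le
    exact mem_range.2 (by omega)
  have h3 : ∀ u ∈ range (m / L + 1), ∑ b ∈ range m, (∑ a ∈ range m, w a b * S u a) ^ 2
      ≤ √(gramSq m w) * (m ^ 2 * l ^ 2) := by
    intro u hu
    refine (sum_sq_mul_le_gramSq m w (S u)).trans ?_
    gcongr
    have hu' : L * u ≤ m :=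
      (Nat.mul_le_mul_left L (by have := mem_range.1 hu; omega : u ≤ m / L)).trans
        (Nat.mul_div_le m L)
    have : ∀ a ∈ range m, S u a ^ 2 ≤ l ^ 2 * m := fun a ha => by
      have := hlin a (mem_range.1 ha) 0 (L * u) (Nat.zero_le _) hu'
      rw [Nat.sub_zero, ← range_eq_Ico] at this
      rw [← sq_abs]
      calc |S u a| ^ 2 ≤ (l * √((L * u : ℕ) : ℝ)) ^ 2 := by gcongr
        _ = l ^ 2 * ((L * u : ℕ) : ℝ) := by rw [mul_pow, Real.sq_sqrt (Nat.cast_nonneg _)]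
        _ ≤ l ^ 2 * m := by gcongr
    refine (sum_le_sum this).trans (le_of_eq ?_)
    simp; ring
  calc _ ≤ ∑ b ∈ range m, (2 * (∑ a ∈ range m, w a b * S (b / L) a) ^ 2
        + 2 * (m ^ 2 * l ^ 2 * L)) := sum_le_sum h1
    _ = 2 * ∑ b ∈ range m, (∑ a ∈ range m, w a b * S (b / L) a) ^ 2
        + 2 * (m ^ 3 * l ^ 2 * L) := by
        rw [sum_add_distrib, mul_sum]; simp; ring
    _ ≤ 2 * ∑ u ∈ range (m / L + 1), √(gramSq m w) * (m ^ 2 * l ^ 2)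
        + 2 * (m ^ 3 * l ^ 2 * L) := by
        gcongr
        exact h2.trans (sum_le_sum h3)
    _ ≤ _ := by
        rw [sum_const, card_range, nsmul_eq_mul, mul_assoc 2 ((m : ℝ) / L + 1)]
        gcongr
        push_cast
        gcongr
        exact Nat.cast_div_le

end Finite

/-! ### Coincidence estimates for a family indexed by `a + b + c = n`. -/

section Family

variable {Ω : Type*}

/-- A family of functions indexed by the triples `(a, b, c)` with `a + b + c = n`, each bounded
by one, odd under its own flip and invariant under the finer flips in every coordinate. -/
structure HaarFamily (n : ℕ) (φ₁ φ₂ φ₃ : ℕ → Equiv.Perm Ω) (f : ℕ → ℕ → ℕ → Ω → ℝ) : Prop where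
  supp : ∀ a b c, a + b + c ≠ n → ∀ ω, f a b c ω = 0
  bdd : ∀ a b c ω, |f a b c ω| ≤ 1
  odd₁ : ∀ a b c ω, f a b c (φ₁ a ω) = -f a b c ω
  odd₂ : ∀ a b c ω, f a b c (φ₂ b ω) = -f a b c ω
  odd₃ : ∀ a b c ω, f a b c (φ₃ c ω) = -f a b c ω
  inv₁ : ∀ a b c k, a < k → ∀ ω, f a b c (φ₁ k ω) = f a b c ω
  inv₂ : ∀ a b c k, b < k → ∀ ω, f a b c (φ₂ k ω) = f a b c ω
  inv₃ : ∀ a b c k, c < k → ∀ ω, f a b c (φ₃ k ω) = f a b c ω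

namespace HaarFamily

variable {n : ℕ} {φ₁ φ₂ φ₃ : ℕ → Equiv.Perm Ω} {f : ℕ → ℕ → ℕ → Ω → ℝ}

theorem rotate (h : HaarFamily n φ₁ φ₂ φ₃ f) :
    HaarFamily n φ₂ φ₃ φ₁ (fun a b c => f c a b) where
  supp a b c hn ω := h.supp c a b (by omega) ω
  bdd a b c ω := h.bdd c a b ω
  odd₁ a b c ω := h.odd₂ c a b ω
  odd₂ a b c ω := h.odd₃ c a b ω
  odd₃ a b c ω := h.odd₁ c a b ω
  inv₁ a b c k hk ω := h.inv₂ c a b k hk ω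
  inv₂ a b c k hk ω := h.inv₃ c a b k hk ω
  inv₃ a b c k hk ω := h.inv₁ c a b k hk ω

theorem swap (h : HaarFamily n φ₁ φ₂ φ₃ f) :
    HaarFamily n φ₂ φ₁ φ₃ (fun a b c => f b a c) where
  supp a b c hn ω := h.supp b a c (by omega) ω
  bdd a b c ω := h.bdd b a c ω
  odd₁ a b c ω := h.odd₂ b a c ω
  odd₂ a b c ω := h.odd₁ b a c ω
  odd₃ a b c ω := h.odd₃ b a c ω
  inv₁ a b c k hk ω := h.inv₂ b a c k hk ω
  inv₂ a b c k hk ω := h.inv₁ b a c k hk ω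
  inv₃ a b c k hk ω := h.inv₃ b a c k hk ω

theorem restrict (h : HaarFamily n φ₁ φ₂ φ₃ f) (p : ℕ → Prop) [DecidablePred p] :
    HaarFamily n φ₁ φ₂ φ₃ (fun a b c ω => if p a then f a b c ω else 0) where
  supp a b c hn ω := by rw [h.supp a b c hn ω, ite_self]
  bdd a b c ω := by
    split_ifs
    · exact h.bdd a b c ω
    · simp
  odd₁ a b c ω := by rw [h.odd₁]; split_ifs <;> simp
  odd₂ a b c ω := by rw [h.odd₂]; split_ifs <;> simp
  odd₃ a b c ω := by rw [h.odd₃]; split_ifs <;> simp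
  inv₁ a b c k hk ω := by rw [h.inv₁ a b c k hk]
  inv₂ a b c k hk ω := by rw [h.inv₂ a b c k hk]
  inv₃ a b c k hk ω := by rw [h.inv₃ a b c k hk]

theorem inv₃_of (h : HaarFamily n φ₁ φ₂ φ₃ f) {a b c k : ℕ} (hk : a + b + c = n → c < k) (ω : Ω) :
    f a b c (φ₃ k ω) = f a b c ω := by
  by_cases hn : a + b + c = n
  · exact h.inv₃ a b c k (hk hn) ω
  · rw [h.supp a b c hn, h.supp a b c hn]

theorem sum_third (h : HaarFamily n φ₁ φ₂ φ₃ f) (a b : ℕ) (ω : Ω) :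
    ∑ c ∈ range (n + 1), f a b c ω = f a b (n - a - b) ω := by
  refine sum_eq_single_of_mem _ (mem_range.2 (by omega)) fun c _ hc => ?_
  exact h.supp a b c (by omega) ω

theorem isFlipMartingale_row (h : HaarFamily n φ₁ φ₂ φ₃ f) (a : ℕ) :
    IsFlipMartingale φ₂ (fun b ω => f a b (n - a - b) ω) :=
  ⟨fun b ω => h.odd₂ a b _ ω, fun b b' hb ω => h.inv₂ a b _ b' hb ω⟩

/-- By `pairSum_eq` these differences add up to half of `pairSum`; the earlier columns `b' < b` are
coarser, hence unaffected by the flip of `b`. -/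
theorem isFlipMartingale_pair (h : HaarFamily n φ₁ φ₂ φ₃ f) (m : ℕ) :
    IsFlipMartingale φ₂ (fun b ω => ∑ a ∈ range m, f a b (n - a - b) ω *
      ∑ b' ∈ range b, f a b' (n - a - b') ω) := by
  constructor
  · intro b ω
    rw [← sum_neg_distrib]
    refine sum_congr rfl fun a _ => ?_
    rw [h.odd₂, neg_mul]
    congr 2
    exact sum_congr rfl fun b' hb' => h.inv₂ a b' _ b (mem_range.1 hb') ω
  · intro b k hk ω
    refine sum_congr rfl fun a _ => ?_
    rw [h.inv₂ a b _ k hk]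
    congr 1
    exact sum_congr rfl fun b' hb' =>
      h.inv₂ a b' _ k ((mem_range.1 hb').trans hk) ω

/-- The part of the sum over rectangles whose lower left corner has third coordinate `c`. -/
def corner (n : ℕ) (f : ℕ → ℕ → ℕ → Ω → ℝ) (c : ℕ) (ω : Ω) : ℝ :=
  ∑ a' ∈ range (n + 1), ∑ a ∈ range a', ∑ b' ∈ range (n + 1), ∑ b ∈ range b',
    f a b c ω * f a b' (n - a - b') ω * f a' b (n - a' - b) ω * f a' b' (n - a' - b') ω

/-- Among the four corners of a rectangle with `a < a'` and `b < b'`, the lower left one has the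
strictly largest third index. Its flip therefore changes the sign of exactly one factor. -/
theorem isFlipMartingale_corner (h : HaarFamily n φ₁ φ₂ φ₃ f) :
    IsFlipMartingale φ₃ (corner n f) := by
  have key : ∀ a a' b b' c k, a < a' → b < b' → c ≤ k → ∀ ω, a + b + c = n →
      f a b' (n - a - b') (φ₃ k ω) * f a' b (n - a' - b) (φ₃ k ω)
        * f a' b' (n - a' - b') (φ₃ k ω) =
      f a b' (n - a - b') ω * f a' b (n - a' - b) ω * f a' b' (n - a' - b') ω := by
    intro a a' b b' c k ha hb hc ω hn
    rw [h.inv₃_of (by omega), h.inv₃_of (by omega), h.inv₃_of (by omega)]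
  constructor
  · intro c ω
    unfold corner
    simp only [← sum_neg_distrib]
    refine sum_congr rfl fun a' _ => sum_congr rfl fun a ha => sum_congr rfl fun b' _ =>
      sum_congr rfl fun b hb => ?_
    by_cases hn : a + b + c = n
    · have := key a a' b b' c c (mem_range.1 ha) (mem_range.1 hb) le_rfl ω hn
      rw [h.odd₃, mul_assoc, mul_assoc, ← mul_assoc (f a b' _ _), this]; ring
    · rw [h.supp a b c hn, h.supp a b c hn]; ring
  · intro c k hk ω
    unfold corner
    refine sum_congr rfl fun a' _ => sum_congr rfl fun a ha => sum_congr rfl fun b' _ =>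
      sum_congr rfl fun b hb => ?_
    by_cases hn : a + b + c = n
    · have := key a a' b b' c k (mem_range.1 ha) (mem_range.1 hb) hk.le ω hn
      rw [h.inv₃ a b c k hk, mul_assoc, mul_assoc, ← mul_assoc (f a b' _ _), this]; ring
    · rw [h.supp a b c hn, h.supp a b c hn]; ring

/-- Only three indices are free, because `a` and `c` determine `b`. -/
theorem abs_corner_le (h : HaarFamily n φ₁ φ₂ φ₃ f) (c : ℕ) (ω : Ω) :
    |corner n f c ω| ≤ ((n + 1 : ℕ) : ℝ) ^ 3 := by
  unfold corner
  have h1 : ∀ a' a b', |∑ b ∈ range b', f a b c ω * f a b' (n - a - b') ω *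
      f a' b (n - a' - b) ω * f a' b' (n - a' - b') ω| ≤ 1 := by
    intro a' a b'
    by_cases hb : ∃ b ∈ range b', a + b + c = n
    · obtain ⟨b, hb, hn⟩ := hb
      rw [sum_eq_single_of_mem b hb fun b₁ _ hb₁ => by
        rw [h.supp a b₁ c (by omega)]; ring]
      rw [abs_mul, abs_mul, abs_mul]
      refine mul_le_one₀ (mul_le_one₀ (mul_le_one₀ (h.bdd _ _ _ _) (abs_nonneg _)
        (h.bdd _ _ _ _)) (abs_nonneg _) (h.bdd _ _ _ _)) (abs_nonneg _) (h.bdd _ _ _ _)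
    · push Not at hb
      rw [sum_eq_zero fun b hb' => by rw [h.supp a b c (hb b hb')]; ring]
      simp
  have hm : (0 : ℝ) ≤ ((n + 1 : ℕ) : ℝ) := Nat.cast_nonneg _
  calc _ ≤ ((n + 1 : ℕ) : ℝ) * (((n + 1 : ℕ) : ℝ) * (((n + 1 : ℕ) : ℝ) * 1)) := by
        refine abs_sum_range_le _ _ fun a' ha' => ?_
        refine (abs_sum_range_le _ _ fun a _ => abs_sum_range_le _ _ fun b' _ =>
          h1 a' a b').trans ?_
        gcongr
        exact (mem_range.1 ha').le
    _ = _ := by ring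

variable [Fintype Ω]

theorem linear_outside (h : HaarFamily n φ₁ φ₂ φ₃ f) {l : ℝ} (hl : 0 ≤ l) (a b₁ b₂ : ℕ) :
    HoldsOutside (2 * Real.exp (-(l ^ 2 / 2))) (fun ω => b₁ ≤ b₂ →
      |∑ b ∈ Ico b₁ b₂, f a b (n - a - b) ω| ≤ l * √((b₂ - b₁ : ℕ) : ℝ)) := by
  rcases lt_or_ge b₁ b₂ with hb | hb
  · have hpos : (0 : ℝ) < ((b₂ - b₁ : ℕ) : ℝ) := by exact_mod_cast Nat.sub_pos_of_lt hb
    refine ((h.isFlipMartingale_row a).abs_sum_le_outside hb.le hpos hl).mono le_rfl ?_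
    intro ω hω _
    refine hω ?_
    have : ∀ b ∈ Ico b₁ b₂, f a b (n - a - b) ω ^ 2 ≤ 1 := fun b _ => by
      rw [sq_le_one_iff_abs_le_one]; exact h.bdd _ _ _ _
    refine (sum_le_sum this).trans ?_
    simp
  · refine ⟨∅, by simp; positivity, fun ω _ hb' => ?_⟩
    obtain rfl : b₁ = b₂ := le_antisymm hb' hb
    simp

theorem gramSq_outside (h : HaarFamily n φ₁ φ₂ φ₃ f) {l : ℝ} (hl : 0 ≤ l) :
    HoldsOutside (2 * Real.exp (-(l ^ 2 / 2))) (fun ω =>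
      gramSq (n + 1) (fun a b => f a b (n - a - b) ω) ≤ 2 * ((n + 1 : ℕ) : ℝ) ^ 3
        + 4 * (l * √(((n + 1 : ℕ) : ℝ) ^ 7))) := by
  have hpos : (0 : ℝ) < ((n + 1 : ℕ) : ℝ) ^ 7 := by positivity
  refine (h.isFlipMartingale_corner.abs_sum_le_outside (Nat.zero_le (n + 1)) hpos hl).mono
    le_rfl ?_
  intro ω hω
  rw [← range_eq_Ico] at hω
  have h1 : ∑ c ∈ range (n + 1), corner n f c ω ^ 2 ≤ ((n + 1 : ℕ) : ℝ) ^ 7 := by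
    have : ∀ c ∈ range (n + 1), corner n f c ω ^ 2 ≤ ((n + 1 : ℕ) : ℝ) ^ 6 := fun c _ => by
      rw [← sq_abs]
      calc _ ≤ (((n + 1 : ℕ) : ℝ) ^ 3) ^ 2 := by gcongr; exact h.abs_corner_le c ω
        _ = _ := by ring
    refine (sum_le_sum this).trans (le_of_eq ?_)
    simp; ring
  refine (gramSq_le fun a b => h.bdd _ _ _ _).trans ?_
  have h2 : ∑ c ∈ range (n + 1), corner n f c ω
      = ∑ a' ∈ range (n + 1), ∑ a ∈ range a', ∑ b' ∈ range (n + 1), ∑ b ∈ range b',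
        f a b (n - a - b) ω * f a b' (n - a - b') ω * f a' b (n - a' - b) ω
          * f a' b' (n - a' - b') ω := by
    unfold corner
    rw [sum_comm]; refine sum_congr rfl fun a' _ => ?_
    rw [sum_comm]; refine sum_congr rfl fun a _ => ?_
    rw [sum_comm]; refine sum_congr rfl fun b' _ => ?_
    rw [sum_comm]; refine sum_congr rfl fun b _ => ?_
    simp_rw [← sum_mul]
    rw [h.sum_third]
  rw [← h2]
  have := (abs_le.1 (hω h1)).2
  linarith

/-- Every deviation is taken at level `l = K ^ 3`. The gain lies in the last two bounds: `K ^ 7171`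
against the trivial `K ^ 8192` for `gramSq`, and `K ^ 3975` against the order `K ^ 4102` that the
row bounds alone would give for `pairSum`. -/
theorem control (h : HaarFamily n φ₁ φ₂ φ₃ f) {K : ℝ} (hK : 1 ≤ K)
    (hm : ((n + 1 : ℕ) : ℝ) = K ^ 2048) :
    HoldsOutside (12 * K ^ 6144 * Real.exp (-(K ^ 6 / 2))) (fun ω =>
      (∀ a < n + 1, |∑ b ∈ range (n + 1), f a b (n - a - b) ω| ≤ K ^ 1027) ∧
      gramSq (n + 1) (fun a b => f a b (n - a - b) ω) ≤ 6 * K ^ 7171 ∧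
      |pairSum (n + 1) (fun a b => f a b (n - a - b) ω)| ≤ 8 * K ^ 3975) := by
  have hK0 : 0 < K := by linarith
  have hl : (0 : ℝ) ≤ K ^ 3 := by positivity
  have h1 := HoldsOutside.forall (range (n + 1) ×ˢ range (n + 2) ×ˢ range (n + 2))
    (fun i _ => h.linear_outside hl i.1 i.2.1 i.2.2)
  have h2 := h.gramSq_outside hl
  have hLd : (0 : ℝ) < 16 * K ^ 7944 := by positivity
  have h3 := (h.isFlipMartingale_pair (n + 1)).abs_sum_le_outside (Nat.zero_le (n + 1)) hLd hl
  refine ((h1.and h2).and h3).mono ?_ ?_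
  · rw [card_product, card_product, card_range, card_range]
    have e : (K ^ 3) ^ 2 = K ^ 6 := by ring
    rw [e]
    have h4 : ((n + 2 : ℕ) : ℝ) ≤ 2 * K ^ 2048 := by
      rw [← hm]; push_cast; linarith [(Nat.cast_nonneg n : (0 : ℝ) ≤ n)]
    have h5 : (((n + 1) * ((n + 2) * (n + 2)) : ℕ) : ℝ) ≤ 4 * K ^ 6144 := by
      rw [Nat.cast_mul, Nat.cast_mul, hm]
      calc K ^ 2048 * (((n + 2 : ℕ) : ℝ) * ((n + 2 : ℕ) : ℝ))
          ≤ K ^ 2048 * ((2 * K ^ 2048) * (2 * K ^ 2048)) := by gcongr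
        _ = 4 * K ^ 6144 := by ring
    have h6 : 1 ≤ K ^ 6144 := one_le_pow₀ hK
    have h7 := Real.exp_pos (-(K ^ 6 / 2))
    nlinarith [mul_le_mul_of_nonneg_right h5 h7.le, mul_le_mul_of_nonneg_right h6 h7.le]
  · rintro ω ⟨⟨h4, h5⟩, h6⟩
    have hlin : ∀ a < n + 1, ∀ b₁ b₂, b₁ ≤ b₂ → b₂ ≤ n + 1 →
        |∑ b ∈ Ico b₁ b₂, f a b (n - a - b) ω| ≤ K ^ 3 * √((b₂ - b₁ : ℕ) : ℝ) := by
      intro a ha b₁ b₂ hb hb₂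
      refine h4 (a, b₁, b₂) ?_ hb
      simp only [mem_product, mem_range]
      omega
    have hpow : ∀ i j : ℕ, i ≤ j → K ^ i ≤ K ^ j := fun i j hij => pow_le_pow_right₀ hK hij
    have hsq : √(((n + 1 : ℕ) : ℝ) ^ 7) = K ^ 7168 := by
      rw [hm, show (K ^ 2048) ^ 7 = (K ^ 7168) ^ 2 by ring, Real.sqrt_sq (by positivity)]
    have hQ : gramSq (n + 1) (fun a b => f a b (n - a - b) ω) ≤ 6 * K ^ 7171 := by
      refine h5.trans ?_
      rw [hsq, hm]
      have e1 : (K ^ 2048) ^ 3 ≤ K ^ 7171 := by rw [← pow_mul]; exact hpow _ _ (by norm_num)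
      have e2 : K ^ 3 * K ^ 7168 = K ^ 7171 := by rw [← pow_add]
      rw [e2]; linarith
    refine ⟨fun a ha => ?_, hQ, ?_⟩
    · have := hlin a ha 0 (n + 1) (Nat.zero_le _) le_rfl
      rw [Nat.sub_zero, ← range_eq_Ico, hm, show K ^ 2048 = (K ^ 1024) ^ 2 by ring,
        Real.sqrt_sq (by positivity)] at this
      calc _ ≤ _ := this
        _ = _ := by rw [← pow_add]
    · rw [pairSum_eq, abs_mul, abs_two]
      rw [← range_eq_Ico] at h6
      -- The block length `K ^ 1792` nearly balances the two terms of `sum_sq_le_of_block`, of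
      -- orders `K ^ 7944` and `K ^ 7942`.
      have hL0 : 0 < ⌈K ^ 1792⌉₊ := Nat.ceil_pos.2 (by positivity)
      have hL1 : K ^ 1792 ≤ (⌈K ^ 1792⌉₊ : ℝ) := Nat.le_ceil _
      have hL2 : (⌈K ^ 1792⌉₊ : ℝ) ≤ 2 * K ^ 1792 := by
        have := (Nat.ceil_lt_add_one (show 0 ≤ K ^ 1792 by positivity)).le
        have h7 : 1 ≤ K ^ 1792 := one_le_pow₀ hK
        linarith
      have hb := sum_sq_le_of_block (m := n + 1) (w := fun a b => f a b (n - a - b) ω)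
        (fun a b => h.bdd _ _ _ _) hl hlin hL0
      have hQ' : √(gramSq (n + 1) (fun a b => f a b (n - a - b) ω)) ≤ 3 * K ^ 3586 := by
        rw [Real.sqrt_le_left (by positivity)]
        refine hQ.trans ?_
        have e1 : (3 * K ^ 3586) ^ 2 = 9 * K ^ 7172 := by ring
        have e2 := hpow 7171 7172 (by norm_num)
        rw [e1]
        have : 0 < K ^ 7171 := by positivity
        linarith
      have hdiv : ((n + 1 : ℕ) : ℝ) / (⌈K ^ 1792⌉₊ : ℝ) + 1 ≤ 2 * K ^ 256 := by
        have e1 : ((n + 1 : ℕ) : ℝ) / (⌈K ^ 1792⌉₊ : ℝ) ≤ K ^ 256 := by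
          rw [div_le_iff₀ (by positivity), hm]
          calc K ^ 2048 = K ^ 256 * K ^ 1792 := by rw [← pow_add]
            _ ≤ _ := by gcongr
        have e2 : 1 ≤ K ^ 256 := one_le_pow₀ hK
        linarith
      have h7 : ∑ b ∈ range (n + 1), (∑ a ∈ range (n + 1), f a b (n - a - b) ω *
          ∑ b' ∈ range b, f a b' (n - a - b') ω) ^ 2 ≤ 16 * K ^ 7944 := by
        refine hb.trans ?_
        rw [hm] at hdiv ⊢
        calc _ ≤ 2 * (2 * K ^ 256) * ((3 * K ^ 3586) * ((K ^ 2048) ^ 2 * (K ^ 3) ^ 2))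
              + 2 * ((K ^ 2048) ^ 3 * (K ^ 3) ^ 2 * (2 * K ^ 1792)) := by gcongr
          _ = 12 * K ^ 7944 + 4 * K ^ 7942 := by ring
          _ ≤ 16 * K ^ 7944 := by
            have := hpow 7942 7944 (by norm_num)
            linarith
      have h8 := h6 h7
      rw [show 16 * K ^ 7944 = (4 * K ^ 3972) ^ 2 by ring, Real.sqrt_sq (by positivity)] at h8
      calc _ ≤ 2 * (K ^ 3 * (4 * K ^ 3972)) := by gcongr
        _ = 8 * K ^ 3975 := by ring

end HaarFamily

end Family

/-! ### Injectivity as a signed sum over permutations. -/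

section InclusionExclusion

variable {T : Type*} [Fintype T] [DecidableEq T] {X : Type*} [DecidableEq X]

/-- If `a` takes the same value at `s` and `t`, multiplication by their transposition reverses signs
on the stabiliser of `a`; if `a` is injective, the stabiliser is trivial. -/
theorem sum_sign_eq_ite_injective (a : T → X) [Decidable (Function.Injective a)] :
    ∑ σ : Equiv.Perm T, (if a ∘ σ = a then ((Equiv.Perm.sign σ : ℤ) : ℝ) else 0)
      = if Function.Injective a then 1 else 0 := by
  split_ifs with ha
  · rw [sum_eq_single_of_mem 1 (mem_univ _)]
    · simp
    · intro σ _ hσ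
      rw [if_neg]
      intro h
      exact hσ (Equiv.ext fun t => ha (congrFun h t))
  · obtain ⟨s, t, hst, hne⟩ : ∃ s t, a s = a t ∧ s ≠ t := by
      simpa [Function.Injective] using ha
    have hsw : a ∘ Equiv.swap s t = a := by
      funext u
      simp only [Function.comp_apply, Equiv.swap_apply_def]
      split_ifs with h1 h2
      · rw [h1, hst]
      · rw [h2, hst]
      · rfl
    set F : Equiv.Perm T → ℝ := fun σ =>
      if a ∘ σ = a then ((Equiv.Perm.sign σ : ℤ) : ℝ) else 0 with hF
    have h1 : ∀ σ, F (Equiv.swap s t * σ) = -F σ := by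
      intro σ
      have e : a ∘ (Equiv.swap s t * σ : Equiv.Perm T) = a ∘ σ := by
        rw [Equiv.Perm.coe_mul, ← Function.comp_assoc, hsw]
      simp only [hF, e, Equiv.Perm.sign_mul, Equiv.Perm.sign_swap hne]
      split_ifs <;> simp
    have h2 : ∑ σ, F σ = -∑ σ, F σ := by
      conv_lhs => rw [← Equiv.sum_comp (Equiv.mulLeft (Equiv.swap s t))]
      rw [← sum_neg_distrib]
      exact sum_congr rfl fun σ _ => h1 σ
    linarith

end InclusionExclusion

/-! ### Cauchy–Schwarz for contractions of matrices. -/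

section Contraction

set_option linter.unusedSectionVars false

variable {T J J' X Y : Type*} [Fintype T] [DecidableEq T] [Fintype J] [DecidableEq J]
  [Fintype J'] [DecidableEq J'] [Fintype X] [Fintype Y]

/-- The contraction of the matrices `N t`, whose rows are indexed by the class of `t` under `p`
and whose columns by the class of `t` under `s`. -/
def contraction (p : T → J) (s : T → J') (N : T → X → Y → ℝ) : ℝ :=
  ∑ α : J → X, ∑ β : J' → Y, ∏ t, N t (α (p t)) (β (s t))

/-- The factor of `t` in the square of a block, the columns in `U` being already summed. -/
def partialGram (s : T → J') (N : T → X → Y → ℝ) (U : Finset J') (β : J' → Y) (t : T)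
    (x x' : X) : ℝ :=
  if s t ∈ U then ∑ y, N t x y * N t x' y else N t x (β (s t)) * N t x' (β (s t))

/-- The square of the block `j`, the columns in `U` being already summed. -/
def blockGram (p : T → J) (s : T → J') (N : T → X → Y → ℝ) (U : Finset J') (j : J)
    (β : J' → Y) : ℝ :=
  ∑ x, ∑ x', ∏ t with p t = j, partialGram s N U β t x x'

variable {p : T → J} {s : T → J'} {N : T → X → Y → ℝ}

/-- By `hinj`, `t₀` is the only member of its block in this column, so the sum over `y` concerns one
factor. -/
theorem blockGram_insert_of_mem (hinj : ∀ t t', p t = p t' → s t = s t' → t = t')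
    {U : Finset J'} {t₀ : T} (hU : s t₀ ∉ U) (β : J' → Y) :
    blockGram p s N (insert (s t₀) U) (p t₀) β
      = ∑ y, blockGram p s N U (p t₀) (Function.update β (s t₀) y) := by
  unfold blockGram
  rw [sum_comm' (t' := univ) (s' := fun _ => univ) (by simp)]
  conv_rhs => rw [sum_comm]
  rw [sum_comm]
  refine sum_congr rfl fun x _ => ?_
  rw [sum_comm]
  refine sum_congr rfl fun x' _ => ?_
  have hmem : t₀ ∈ univ.filter fun t => p t = p t₀ := by simp
  rw [← mul_prod_erase _ _ hmem]
  simp_rw [← mul_prod_erase _ _ hmem]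
  have h1 : ∀ y, ∏ t ∈ (univ.filter fun t => p t = p t₀).erase t₀,
      partialGram s N U (Function.update β (s t₀) y) t x x'
      = ∏ t ∈ (univ.filter fun t => p t = p t₀).erase t₀,
        partialGram s N (insert (s t₀) U) β t x x' := by
    intro y
    refine prod_congr rfl fun t ht => ?_
    rw [mem_erase, mem_filter] at ht
    have hs : s t ≠ s t₀ := fun h => ht.1 (hinj _ _ ht.2.2 h)
    unfold partialGram
    simp [hs]
  simp_rw [h1]
  rw [← sum_mul]
  congr 1
  simp [partialGram, hU]

theorem blockGram_insert_of_forall_ne {U : Finset J'} {i : J'} {j : J}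
    (hj : ∀ t, p t = j → s t ≠ i) (β : J' → Y) (y : Y) :
    blockGram p s N U j (Function.update β i y) = blockGram p s N (insert i U) j β := by
  unfold blockGram
  refine sum_congr rfl fun x _ => sum_congr rfl fun x' _ => prod_congr rfl fun t ht => ?_
  have := hj t (mem_filter.1 ht).2
  unfold partialGram
  simp [this]

theorem blockGram_empty (j : J) (β : J' → Y) :
    blockGram p s N ∅ j β = (∑ x, ∏ t with p t = j, N t x (β (s t))) ^ 2 := by
  unfold blockGram partialGram
  rw [sq, sum_mul_sum]
  simp [prod_mul_distrib]

theorem blockGram_nonneg (hinj : ∀ t t', p t = p t' → s t = s t' → t = t') (U : Finset J')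
    (j : J) (β : J' → Y) : 0 ≤ blockGram p s N U j β := by
  induction U using Finset.induction_on generalizing β with
  | empty => rw [blockGram_empty]; positivity
  | insert i U hi ih =>
    by_cases h : ∃ t, p t = j ∧ s t = i
    · obtain ⟨t, rfl, rfl⟩ := h
      rw [blockGram_insert_of_mem hinj hi]
      exact sum_nonneg fun y _ => ih _
    · push Not at h
      rw [← blockGram_insert_of_forall_ne h β (β i)]
      exact ih _

/-- Exchanging `y` with `β i` is an involution of the pairs `(β, y)`. -/
theorem sum_sum_update (F : (J' → Y) → ℝ) (i : J') :
    ∑ β : J' → Y, ∑ y, F (Function.update β i y) = Fintype.card Y * ∑ β, F β := by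
  have h1 : ∑ q : (J' → Y) × Y, F (Function.update q.1 i q.2) = ∑ q : (J' → Y) × Y, F q.1 := by
    have hinv : Function.Involutive
        (fun q : (J' → Y) × Y => (Function.update q.1 i q.2, q.1 i)) := by
      rintro ⟨β, y⟩
      simp
    exact Fintype.sum_equiv hinv.toPerm _ _ fun q => rfl
  rw [Fintype.sum_prod_type, Fintype.sum_prod_type] at h1
  rw [h1, mul_sum]
  simp

theorem sum_prod_sqrt_le {h : J → Y → ℝ} {v : J → ℝ} (hv : ∀ j y, h j y ≤ v j) {j₁ j₂ : J}
    (hne : j₁ ≠ j₂) (h0 : ∀ j y, 0 ≤ h j y) (h₁ : ∑ y, h j₁ y = v j₁) (h₂ : ∑ y, h j₂ y = v j₂) :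
    ∑ y, ∏ j, √(h j y) ≤ ∏ j, √(v j) := by
  have hmem : j₂ ∈ univ.erase j₁ := mem_erase.2 ⟨hne.symm, mem_univ _⟩
  rw [← mul_prod_erase _ _ (mem_univ j₁), ← mul_prod_erase _ _ hmem]
  simp_rw [← mul_prod_erase univ _ (mem_univ j₁), ← mul_prod_erase (univ.erase j₁) _ hmem]
  calc _ ≤ ∑ y, √(h j₁ y) * √(h j₂ y) * ∏ j ∈ (univ.erase j₁).erase j₂, √(v j) := by
        refine sum_le_sum fun y _ => ?_
        rw [← mul_assoc]
        refine mul_le_mul_of_nonneg_left ?_ (by positivity)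
        exact prod_le_prod (fun _ _ => Real.sqrt_nonneg _)
          fun j _ => Real.sqrt_le_sqrt (hv j y)
    _ ≤ √(v j₁) * √(v j₂) * ∏ j ∈ (univ.erase j₁).erase j₂, √(v j) := by
        rw [← sum_mul]
        refine mul_le_mul_of_nonneg_right ?_ (prod_nonneg fun _ _ => Real.sqrt_nonneg _)
        rw [← h₁, ← h₂]
        exact Real.sum_sqrt_mul_sqrt_le univ (h0 j₁) (h0 j₂)
    _ = _ := by ring

/-- For fixed `β` the sum over `α` splits into blocks, each being up to sign the root of its square.
The columns are then summed one by one. A column shared by two elements meets two different blocks,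
and Cauchy–Schwarz moves the sum inside both; a column with a single element is supported at `y₀`.
In the other blocks the inner sum is taken for free, since all its terms are nonnegative. -/
theorem contraction_sq_le (hinj : ∀ t t', p t = p t' → s t = s t' → t = t')
    (hs : ∀ i, (∃ t₁ t₂, t₁ ≠ t₂ ∧ s t₁ = i ∧ s t₂ = i) ∨
      ∃ t, s t = i ∧ ∃ y₀, ∀ x y, y ≠ y₀ → N t x y = 0) [Nonempty Y] :
    contraction p s N ^ 2
      ≤ ∏ j, ∑ x, ∑ x', ∏ t with p t = j, ∑ y, N t x y * N t x' y := by
  have hY : (0 : ℝ) < Fintype.card Y := by exact_mod_cast Fintype.card_pos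
  have hG := fun U j (β : J' → Y) => blockGram_nonneg (N := N) hinj U j β
  -- A column already summed remains as an idle coordinate of `β`, which accounts for the power of
  -- `|Y|`.
  have claim : ∀ U : Finset J', |contraction p s N| * (Fintype.card Y : ℝ) ^ U.card
      ≤ ∑ β : J' → Y, ∏ j, √(blockGram p s N U j β) := by
    intro U
    induction U using Finset.induction_on with
    | empty =>
      unfold contraction
      rw [card_empty, pow_zero, mul_one, sum_comm]
      refine (abs_sum_le_sum_abs _ _).trans (sum_le_sum fun β _ => ?_)
      refine le_of_eq ?_
      simp_rw [blockGram_empty, Real.sqrt_sq_eq_abs]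
      rw [← abs_prod, prod_univ_sum]
      congr 1
      rw [Fintype.piFinset_univ]
      refine sum_congr rfl fun α _ => ?_
      rw [← prod_fiberwise univ p]
      refine prod_congr rfl fun j _ => prod_congr rfl fun t ht => ?_
      rw [(mem_filter.1 ht).2]
    | insert i U hi ih =>
      rw [card_insert_of_notMem hi, pow_succ, ← mul_assoc]
      refine (mul_le_mul_of_nonneg_right ih hY.le).trans ?_
      rw [mul_comm, ← sum_sum_update _ i]
      refine sum_le_sum fun β _ => ?_
      have hv : ∀ j y, blockGram p s N U j (Function.update β i y)
          ≤ blockGram p s N (insert i U) j β := by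
        intro j y
        by_cases h : ∃ t, p t = j ∧ s t = i
        · obtain ⟨t, rfl, rfl⟩ := h
          rw [blockGram_insert_of_mem hinj hi]
          exact single_le_sum (f := fun y => blockGram p s N U (p t)
            (Function.update β (s t) y)) (fun y _ => hG _ _ _) (mem_univ y)
        · push Not at h
          exact (blockGram_insert_of_forall_ne h β y).le
      rcases hs i with ⟨t₁, t₂, hne, h₁, h₂⟩ | ⟨t, ht, y₀, hy₀⟩
      · refine sum_prod_sqrt_le hv (j₁ := p t₁) (j₂ := p t₂)
          (fun h => hne (hinj _ _ h (h₁.trans h₂.symm))) (fun j y => hG _ _ _) ?_ ?_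
        · subst h₁
          exact (blockGram_insert_of_mem hinj hi β).symm
        · subst h₂
          exact (blockGram_insert_of_mem hinj hi β).symm
      · rw [sum_eq_single_of_mem y₀ (mem_univ _)]
        · exact prod_le_prod (fun _ _ => Real.sqrt_nonneg _) fun j _ => Real.sqrt_le_sqrt (hv j y₀)
        · intro y _ hy
          refine prod_eq_zero (mem_univ (p t)) ?_
          have : blockGram p s N U (p t) (Function.update β i y) = 0 := by
            unfold blockGram
            refine sum_eq_zero fun x _ => sum_eq_zero fun x' _ =>
              prod_eq_zero (i := t) (by simp) ?_
            unfold partialGram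
            rw [if_neg (by rw [ht]; exact hi), ht, Function.update_self, hy₀ x y hy, zero_mul]
          rw [this, Real.sqrt_zero]
  have h1 := claim univ
  have h2 : ∀ (j : J) (β : J' → Y), blockGram p s N univ j β
      = ∑ x, ∑ x', ∏ t with p t = j, ∑ y, N t x y * N t x' y := by
    intro j β
    simp [blockGram, partialGram]
  simp_rw [h2] at h1
  rw [sum_const, card_univ, card_univ, Fintype.card_fun, nsmul_eq_mul, mul_comm] at h1
  push_cast at h1
  have h3 := le_of_mul_le_mul_left h1 (pow_pos hY _)
  have h4 : ∀ j : J, 0 ≤ ∑ x, ∑ x', ∏ t with p t = j, ∑ y, N t x y * N t x' y := by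
    intro j
    obtain ⟨y⟩ := ‹Nonempty Y›
    rw [← h2 j fun _ => y]
    exact hG _ _ _
  rw [← sq_abs]
  calc _ ≤ (∏ j, √(∑ x, ∑ x', ∏ t with p t = j, ∑ y, N t x y * N t x' y)) ^ 2 := by gcongr
    _ = _ := by
      rw [← prod_pow]
      exact prod_congr rfl fun j _ => Real.sq_sqrt (h4 j)

end Contraction

/-! ### Contractions along the orbits of two permutations. -/

section Orbits

set_option linter.unusedSectionVars false

variable {T : Type*} [Fintype T] [DecidableEq T] {X Y : Type*} [Fintype X] [Fintype Y]
  [DecidableEq X] [DecidableEq Y]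

theorem comp_zpow_eq {T X : Type*} {a : T → X} {σ : Equiv.Perm T} (h : a ∘ σ = a) (i : ℤ)
    (t : T) : a ((σ ^ i) t) = a t := by
  have h1 : ∀ t, a (σ t) = a t := fun t => congrFun h t
  induction i using Int.induction_on generalizing t with
  | zero => simp
  | succ i ih => rw [zpow_add_one, Equiv.Perm.mul_apply, ih, h1]
  | pred i ih =>
    rw [zpow_sub_one, Equiv.Perm.mul_apply, ih, ← h1 (σ⁻¹ t), show σ (σ⁻¹ t) = t from σ.apply_symm_apply t]

/-- The set of orbits of a permutation. -/
abbrev Orbits (σ : Equiv.Perm T) : Type _ := Quotient (Equiv.Perm.SameCycle.setoid σ)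

/-- The orbit of a point under a permutation. -/
abbrev orbitMk (σ : Equiv.Perm T) (t : T) : Orbits σ := Quotient.mk _ t

noncomputable instance (σ : Equiv.Perm T) : Fintype (Orbits σ) := Fintype.ofFinite _

noncomputable instance (σ : Equiv.Perm T) : DecidableEq (Orbits σ) := Classical.decEq _

theorem orbitMk_eq_iff {σ : Equiv.Perm T} {t t' : T} :
    orbitMk σ t = orbitMk σ t' ↔ σ.SameCycle t t' := Quotient.eq

theorem eq_of_orbitMk_eq_of_fixed {σ : Equiv.Perm T} {t t' : T} (h : orbitMk σ t = orbitMk σ t')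
    (ht : σ t = t) : t' = t := by
  obtain ⟨i, hi⟩ := orbitMk_eq_iff.1 h
  rw [← hi]
  exact (Function.IsFixedPt.perm_zpow ht i)

theorem sum_invariant_eq (σ : Equiv.Perm T) (F : (T → X) → ℝ) :
    ∑ a : T → X, (if a ∘ σ = a then F a else 0)
      = ∑ α : Orbits σ → X, F (fun t => α (orbitMk σ t)) := by
  rw [← sum_filter]
  symm
  refine sum_bij (fun α _ t => α (orbitMk σ t)) ?_ ?_ ?_ ?_
  · intro α _
    rw [mem_filter]
    refine ⟨mem_univ _, funext fun t => ?_⟩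
    simp only [Function.comp_apply]
    congr 1
    exact orbitMk_eq_iff.2 (Equiv.Perm.sameCycle_apply_left.2 (Equiv.Perm.SameCycle.refl σ t))
  · intro α _ α' _ h
    funext j
    induction j using Quotient.inductionOn with
    | h t => exact congrFun h t
  · intro a ha
    have ha := (mem_filter.1 ha).2
    refine ⟨fun j => Quotient.lift a ?_ j, mem_univ _, rfl⟩
    rintro t t' ⟨i, hi⟩
    rw [← hi, comp_zpow_eq ha]
  · intro α _
    rfl

/-- The part of the inclusion-exclusion expansion that belongs to a pair of permutations. -/
noncomputable def permTerm (N : T → X → Y → ℝ) (σ τ : Equiv.Perm T) : ℝ :=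
  contraction (orbitMk σ) (orbitMk τ) N

theorem sum_injective_eq_sum_perm (N : T → X → Y → ℝ)
    [DecidablePred fun a : T → X => Function.Injective a]
    [DecidablePred fun a : T → Y => Function.Injective a] :
    ∑ a : T → X, ∑ b : T → Y, (if Function.Injective a then 1 else 0) *
      (if Function.Injective b then 1 else 0) * ∏ t, N t (a t) (b t)
      = ∑ σ : Equiv.Perm T, ∑ τ : Equiv.Perm T, ((Equiv.Perm.sign σ : ℤ) : ℝ) *
        ((Equiv.Perm.sign τ : ℤ) : ℝ) * permTerm N σ τ := by
  have h1 : ∀ σ τ : Equiv.Perm T, permTerm N σ τ = ∑ a : T → X, ∑ b : T → Y,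
      (if a ∘ σ = a then 1 else 0) * (if b ∘ τ = b then 1 else 0) * ∏ t, N t (a t) (b t) := by
    intro σ τ
    unfold permTerm contraction
    rw [← sum_invariant_eq σ fun a => ∑ β : Orbits τ → Y, ∏ t, N t (a t) (β (orbitMk τ t))]
    refine sum_congr rfl fun a _ => ?_
    rw [← sum_invariant_eq τ fun b => ∏ t, N t (a t) (b t)]
    split_ifs with h
    · exact sum_congr rfl fun b _ => by split_ifs <;> simp
    · simp
  have h2 : ∀ (a : T → X) (b : T → Y), (if Function.Injective a then (1 : ℝ) else 0) *
      (if Function.Injective b then 1 else 0) * ∏ t, N t (a t) (b t)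
      = ∑ σ : Equiv.Perm T, ∑ τ : Equiv.Perm T, ((Equiv.Perm.sign σ : ℤ) : ℝ) *
        ((Equiv.Perm.sign τ : ℤ) : ℝ) * ((if a ∘ σ = a then 1 else 0) *
        (if b ∘ τ = b then 1 else 0) * ∏ t, N t (a t) (b t)) := by
    intro a b
    rw [← sum_sign_eq_ite_injective a, ← sum_sign_eq_ite_injective b, sum_mul_sum, sum_mul]
    refine sum_congr rfl fun σ _ => ?_
    rw [sum_mul]
    refine sum_congr rfl fun τ _ => ?_
    split_ifs <;> simp
  simp_rw [h1, h2, mul_sum]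
  calc _ = ∑ a : T → X, ∑ σ : Equiv.Perm T, ∑ τ : Equiv.Perm T, ∑ b : T → Y, _ := by
        refine sum_congr rfl fun a _ => ?_
        rw [sum_comm]
        refine sum_congr rfl fun σ _ => ?_
        rw [sum_comm]
    _ = _ := by
        rw [sum_comm]
        refine sum_congr rfl fun σ _ => ?_
        rw [sum_comm]

/-- The factor of `t` in the square of a block: a Gram matrix if the column of `t` is shared,
a product of row sums otherwise. -/
def gramFactor (N : T → X → Y → ℝ) (shared : T → Prop) [DecidablePred shared] (t : T)
    (x x' : X) : ℝ :=
  if shared t then ∑ y, N t x y * N t x' y else (∑ y, N t x y) * ∑ y, N t x' y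

/-- Two matrices with disjoint supports are evaluated at the same row and column. -/
theorem permTerm_eq_zero {N : T → X → Y → ℝ}
    (hN : ∀ t t', t ≠ t' → ∀ x y, N t x y * N t' x y = 0) {σ τ : Equiv.Perm T} {t t' : T}
    (hne : t ≠ t') (hσ : orbitMk σ t = orbitMk σ t') (hτ : orbitMk τ t = orbitMk τ t') :
    permTerm N σ τ = 0 := by
  unfold permTerm contraction
  refine sum_eq_zero fun α _ => sum_eq_zero fun β _ => ?_
  have h := hN t t' hne (α (orbitMk σ t)) (β (orbitMk τ t))
  rcases mul_eq_zero.1 h with h | h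
  · exact prod_eq_zero (mem_univ t) h
  · exact prod_eq_zero (mem_univ t') (by rw [← hσ, ← hτ]; exact h)

/-- A fixed point of `τ` is alone in its column, which can be summed in advance and its row sums
stored at `y₀`. This produces the second alternative of `contraction_sq_le`. -/
theorem contraction_eq_of_single {J : Type*} [Fintype J] [DecidableEq J] (p : T → J) (τ : Equiv.Perm T)
    (N : T → X → Y → ℝ) (y₀ : Y) :
    contraction p (orbitMk τ) N = contraction p (orbitMk τ) (fun t x y =>
      if τ t = t then (if y = y₀ then ∑ y, N t x y else 0) else N t x y) := by
  unfold contraction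
  refine sum_congr rfl fun α _ => ?_
  have h1 : ∀ M : T → X → Y → ℝ, ∑ β : Orbits τ → Y, ∏ t, M t (α (p t)) (β (orbitMk τ t))
      = ∏ i : Orbits τ, ∑ y, ∏ t with orbitMk τ t = i, M t (α (p t)) y := by
    intro M
    rw [prod_univ_sum, Fintype.piFinset_univ]
    refine sum_congr rfl fun β _ => ?_
    rw [← prod_fiberwise univ (orbitMk τ)]
    refine prod_congr rfl fun j _ => prod_congr rfl fun t ht => ?_
    rw [(mem_filter.1 ht).2]
  refine (h1 N).trans (Eq.trans ?_ (h1 fun t x y =>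
    if τ t = t then (if y = y₀ then ∑ y, N t x y else 0) else N t x y).symm)
  refine prod_congr rfl fun i _ => ?_
  obtain ⟨t, rfl⟩ := Quotient.exists_rep i
  by_cases ht : τ t = t
  · have h2 : (univ.filter fun t' => orbitMk τ t' = orbitMk τ t) = {t} := by
      ext t'
      simp only [mem_filter, mem_univ, true_and, mem_singleton]
      exact ⟨fun h => eq_of_orbitMk_eq_of_fixed h.symm ht, fun h => by rw [h]⟩
    change ∑ y, ∏ t' with orbitMk τ t' = orbitMk τ t, _
      = ∑ y, ∏ t' with orbitMk τ t' = orbitMk τ t, _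
    rw [h2]
    simp [ht]
  · refine sum_congr rfl fun y _ => prod_congr rfl fun t' ht' => ?_
    rw [if_neg]
    intro h
    have h3 := eq_of_orbitMk_eq_of_fixed (mem_filter.1 ht').2 h
    exact ht (h3 ▸ h)

/-- Entrywise products of Gram matrices are positive semidefinite; the weights `u` absorb one factor
at a time in the induction. -/
theorem sum_prod_gram_nonneg (M : T → X → Y → ℝ) (B : Finset T) (u : X → ℝ) :
    0 ≤ ∑ x, ∑ x', u x * u x' * ∏ t ∈ B, ∑ y, M t x y * M t x' y := by
  induction B using Finset.induction_on generalizing u with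
  | empty =>
    simp only [prod_empty, mul_one]
    rw [← sum_mul_sum]
    exact mul_self_nonneg _
  | insert t B ht ih =>
    have h1 : ∑ x, ∑ x', u x * u x' * ∏ t ∈ insert t B, ∑ y, M t x y * M t x' y
        = ∑ y, ∑ x, ∑ x', (u x * M t x y) * (u x' * M t x' y) *
          ∏ t ∈ B, ∑ y, M t x y * M t x' y := by
      rw [sum_comm]
      refine Eq.symm (Eq.trans (sum_congr rfl fun y _ => sum_comm) ?_)
      rw [sum_comm]
      refine sum_congr rfl fun x' _ => ?_
      rw [sum_comm]
      refine sum_congr rfl fun x _ => ?_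
      rw [prod_insert ht, sum_mul, mul_sum]
      exact sum_congr rfl fun y _ => by ring
    rw [h1]
    exact sum_nonneg fun y _ => ih _

theorem gramFactor_eq_gram (N : T → X → Y → ℝ) (shared : T → Prop) [DecidablePred shared]
    (y₀ : Y) (t : T) (x x' : X) : gramFactor N shared t x x' = ∑ y,
      (if shared t then N t x y else (if y = y₀ then ∑ y, N t x y else 0)) *
      (if shared t then N t x' y else (if y = y₀ then ∑ y, N t x' y else 0)) := by
  unfold gramFactor
  by_cases ht : shared t <;> simp [ht]

theorem sum_prod_gramFactor_nonneg [Nonempty Y] (N : T → X → Y → ℝ) (shared : T → Prop)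
    [DecidablePred shared] (B : Finset T) :
    0 ≤ ∑ x, ∑ x', ∏ t ∈ B, gramFactor N shared t x x' := by
  obtain ⟨y₀⟩ := ‹Nonempty Y›
  simp_rw [gramFactor_eq_gram N shared y₀]
  simpa using sum_prod_gram_nonneg (fun t x y => if shared t then N t x y else
    (if y = y₀ then ∑ y, N t x y else 0)) B (fun _ => 1)

theorem permTerm_sq_le [Nonempty Y] {N : T → X → Y → ℝ}
    (hN : ∀ t t', t ≠ t' → ∀ x y, N t x y * N t' x y = 0) (σ τ : Equiv.Perm T) :
    permTerm N σ τ ^ 2 ≤ ∏ j : Orbits σ, ∑ x, ∑ x', ∏ t with orbitMk σ t = j,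
      gramFactor N (fun t => τ t ≠ t) t x x' := by
  obtain ⟨y₀⟩ := ‹Nonempty Y›
  have : Nonempty Y := ⟨y₀⟩
  by_cases hinj : ∀ t t', orbitMk σ t = orbitMk σ t' → orbitMk τ t = orbitMk τ t' → t = t'
  · unfold permTerm
    rw [contraction_eq_of_single _ τ N y₀]
    simp_rw [gramFactor_eq_gram N _ y₀, ite_not]
    refine contraction_sq_le hinj fun i => ?_
    obtain ⟨t, rfl⟩ := Quotient.exists_rep i
    by_cases ht : τ t = t
    · exact Or.inr ⟨t, rfl, y₀, fun x y hy => by simp [ht, hy]⟩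
    · refine Or.inl ⟨t, τ t, fun h => ht h.symm, rfl, ?_⟩
      exact orbitMk_eq_iff.2
        (Equiv.Perm.sameCycle_apply_left.2 (Equiv.Perm.SameCycle.refl τ t))
  · push Not at hinj
    obtain ⟨t, t', h1, h2, h3⟩ := hinj
    rw [permTerm_eq_zero hN h3 h1 h2, sq, zero_mul]
    exact prod_nonneg fun j _ => sum_prod_gramFactor_nonneg N _ _

/-- A bound for the squares of the blocks of at least two elements, for the squared column norms,
and nothing for the total sums. -/
structure BlockBound (N : T → X → Y → ℝ) (g h : ℝ) : Prop where
  block : ∀ (shared : T → Prop) [DecidablePred shared] (B : Finset T), 2 ≤ B.card →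
    ∑ x, ∑ x', ∏ t ∈ B, gramFactor N shared t x x' ≤ (g ^ 2) ^ B.card
  single : ∀ t, ∑ x, ∑ x', ∑ y, N t x y * N t x' y ≤ h ^ 2

/-- The orbits of `σ` are the blocks: a nontrivial orbit contributes `g` for each element, while a
fixed point contributes a column norm or a total sum according to whether `τ` moves it. -/
theorem BlockBound.abs_permTerm_le [Nonempty Y] {N : T → X → Y → ℝ} {g h : ℝ} (hg : 0 ≤ g)
    (hh : 0 ≤ h) (hb : BlockBound N g h)
    (hN : ∀ t t', t ≠ t' → ∀ x y, N t x y * N t' x y = 0) (σ τ : Equiv.Perm T) :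
    |permTerm N σ τ| ≤ ∏ t, (if σ t ≠ t then g else if τ t ≠ t then h else
      |∑ x, ∑ y, N t x y|) := by
  refine abs_le_of_sq_le_sq ?_ (prod_nonneg fun t _ => by split_ifs <;> positivity)
  refine (permTerm_sq_le hN σ τ).trans ?_
  rw [← prod_pow, ← prod_fiberwise univ (orbitMk σ)]
  refine prod_le_prod (fun j _ => sum_prod_gramFactor_nonneg N _ _) fun j _ => ?_
  obtain ⟨t, rfl⟩ := Quotient.exists_rep j
  change ∑ x, ∑ x', ∏ t' with orbitMk σ t' = orbitMk σ t, _
      ≤ ∏ t' with orbitMk σ t' = orbitMk σ t, _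
  by_cases ht : σ t = t
  · have h2 : (univ.filter fun t' => orbitMk σ t' = orbitMk σ t) = {t} := by
      ext t'
      simp only [mem_filter, mem_univ, true_and, mem_singleton]
      exact ⟨fun h => eq_of_orbitMk_eq_of_fixed h.symm ht, fun h => by rw [h]⟩
    rw [h2]
    simp only [prod_singleton, ne_eq, ht, not_true_eq_false, if_false]
    by_cases ht' : τ t = t
    · simp only [gramFactor, ht', not_true_eq_false, if_false, sq_abs]
      rw [← sum_mul_sum, sq]
    · simp only [gramFactor, ht', not_false_eq_true, if_true]
      exact hb.single t
  · refine (hb.block _ _ ?_).trans (le_of_eq ?_)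
    · have h1 : ({t, σ t} : Finset T) ⊆ univ.filter fun t' => orbitMk σ t' = orbitMk σ t := by
        intro t' ht'
        rw [mem_insert, mem_singleton] at ht'
        rw [mem_filter]
        refine ⟨mem_univ _, ?_⟩
        rcases ht' with rfl | rfl
        · rfl
        · exact orbitMk_eq_iff.2
            (Equiv.Perm.sameCycle_apply_left.2 (Equiv.Perm.SameCycle.refl σ t))
      have h2 := card_le_card h1
      rwa [card_pair (fun h => ht h.symm)] at h2
    · rw [← prod_const]
      refine prod_congr rfl fun t' ht' => ?_
      rw [if_pos]
      intro h
      have h3 := eq_of_orbitMk_eq_of_fixed (mem_filter.1 ht').2 h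
      exact ht (h3 ▸ h)

theorem contraction_swap {J J' : Type*} [Fintype J] [DecidableEq J] [Fintype J'] [DecidableEq J']
    (p : T → J) (s : T → J') (N : T → X → Y → ℝ) :
    contraction p s N = contraction s p (fun t y x => N t x y) := by
  unfold contraction
  rw [sum_comm]

/-- The row and column estimates are multiplied. An index moved by both permutations receives `g² ≤
y⁴`, and one moved by a single permutation receives `g h ≤ y⁴ ≤ y²`. The large `h` is thus always
paired with a small `g`. -/
theorem abs_permTerm_le_of_blockBound [Nonempty X] [Nonempty Y] {N : T → X → Y → ℝ} {g h y : ℝ}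
    (hg : 0 ≤ g) (hgh : g ≤ h) (hy0 : 0 ≤ y) (hy1 : y ≤ 1) (hy : g * h ≤ y ^ 4)
    (hrow : BlockBound N g h) (hcol : BlockBound (fun t y x => N t x y) g h)
    (hN : ∀ t t', t ≠ t' → ∀ x y, N t x y * N t' x y = 0) (σ τ : Equiv.Perm T) :
    |permTerm N σ τ| ≤ y ^ σ.support.card * y ^ τ.support.card *
      ∏ t with σ t = t ∧ τ t = t, |∑ x, ∑ y, N t x y| := by
  have hh : 0 ≤ h := hg.trans hgh
  have h1 := hrow.abs_permTerm_le hg hh hN σ τ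
  have h2 := hcol.abs_permTerm_le hg hh (fun t t' ht x y => hN t t' ht y x) τ σ
  have e : permTerm (fun t y x => N t x y) τ σ = permTerm N σ τ :=
    (contraction_swap _ _ _).symm
  rw [e] at h2
  refine abs_le_of_sq_le_sq ?_ (by positivity)
  rw [← sq_abs, sq]
  refine (mul_le_mul h1 h2 (abs_nonneg _) (prod_nonneg fun t _ => by split_ifs <;> positivity)).trans
    ?_
  have e1 : ∀ ρ : Equiv.Perm T, y ^ ρ.support.card = ∏ t, (if ρ t ≠ t then y else 1) := by
    intro ρ
    rw [prod_ite, prod_const, prod_const_one, mul_one]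
    rfl
  rw [e1, e1, prod_filter, ← prod_mul_distrib, ← prod_mul_distrib, ← prod_mul_distrib, ← prod_pow]
  refine prod_le_prod (fun t _ => by split_ifs <;> positivity) fun t _ => ?_
  have hy2 : y ^ 4 ≤ y ^ 2 := pow_le_pow_of_le_one hy0 hy1 (by norm_num)
  have hgg : g * g ≤ g * h := mul_le_mul_of_nonneg_left hgh hg
  by_cases h3 : σ t = t <;> by_cases h4 : τ t = t
  · simp only [h3, h4, ne_eq, not_true_eq_false, if_false, and_self, if_true, mul_one, one_mul]
    rw [sum_comm (f := fun x y => N t y x), sq]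
  · simp only [h3, h4, ne_eq, not_true_eq_false, not_false_eq_true, if_false, and_false, if_true,
      mul_one, one_mul]
    nlinarith
  · simp only [h3, h4, ne_eq, not_true_eq_false, not_false_eq_true, if_false, false_and, if_true,
      mul_one]
    nlinarith
  · simp only [h3, h4, ne_eq, not_false_eq_true, if_false, if_true, mul_one, and_self]
    nlinarith

/-- At most `|T| ^ |S|` permutations have support `S`; the binomial theorem sums over `S`. -/
theorem sum_pow_card_support_le {y : ℝ} (hy : 0 ≤ y) :
    ∑ σ : Equiv.Perm T, y ^ σ.support.card ≤ (1 + Fintype.card T * y) ^ Fintype.card T := by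
  rw [← sum_fiberwise univ (fun σ : Equiv.Perm T => σ.support)]
  have h1 : ∀ S : Finset T, ((univ.filter fun σ : Equiv.Perm T => σ.support = S).card : ℝ)
      ≤ (Fintype.card T : ℝ) ^ S.card := by
    intro S
    have h2 : (univ.filter fun σ : Equiv.Perm T => σ.support = S).card
        ≤ Fintype.card (S → T) := by
      rw [← card_univ]
      refine card_le_card_of_injOn (fun σ t => σ t) (fun _ _ => mem_coe.2 (mem_univ _)) ?_
      intro σ hσ τ hτ h
      have hσ := (mem_filter.1 (mem_coe.1 hσ)).2
      have hτ := (mem_filter.1 (mem_coe.1 hτ)).2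
      ext t
      by_cases ht : t ∈ S
      · exact congrFun h ⟨t, ht⟩
      · rw [Equiv.Perm.notMem_support.1 (hσ ▸ ht), Equiv.Perm.notMem_support.1 (hτ ▸ ht)]
    rw [Fintype.card_fun, Fintype.card_coe] at h2
    exact_mod_cast h2
  calc _ = ∑ S : Finset T, ((univ.filter fun σ : Equiv.Perm T => σ.support = S).card : ℝ)
        * y ^ S.card := by
        refine sum_congr rfl fun S _ => ?_
        rw [← nsmul_eq_mul, ← sum_const]
        refine sum_congr rfl fun σ hσ => ?_
        rw [(mem_filter.1 hσ).2]
    _ ≤ ∑ S : Finset T, (Fintype.card T * y) ^ S.card := by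
        refine sum_le_sum fun S _ => ?_
        rw [mul_pow]
        exact mul_le_mul_of_nonneg_right (h1 S) (by positivity)
    _ = _ := by
        have := Finset.sum_pow_mul_eq_add_pow (Fintype.card T * y) 1 (univ : Finset T)
        simp only [one_pow, mul_one, powerset_univ, card_univ] at this
        rw [this, add_comm]

end Orbits

/-! ### The strongly distinct part of a product of sums. -/

section Extended

set_option linter.unusedSectionVars false

variable {T : Type*} [Fintype T] [DecidableEq T] {I : Type*} [Fintype I] [DecidableEq I]

/-- The matrix `M t`, extended by one entry `1` at an own row and column of `t`. -/
def extend (M : T → I → I → ℝ) (t : T) : I ⊕ T → I ⊕ T → ℝ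
  | .inl a, .inl b => M t a b
  | .inr u, .inr v => if u = t ∧ v = t then 1 else 0
  | _, _ => 0

theorem extend_swap (M : T → I → I → ℝ) :
    (fun t y x => extend M t x y) = extend (fun t b a => M t a b) := by
  funext t x y
  rcases x with a | u <;> rcases y with b | v <;> simp [extend, and_comm]

theorem extend_mul_eq_zero {M : T → I → I → ℝ}
    (hM : ∀ t t', t ≠ t' → ∀ a b, M t a b * M t' a b = 0) (t t' : T) (h : t ≠ t')
    (x y : I ⊕ T) : extend M t x y * extend M t' x y = 0 := by
  rcases x with a | u <;> rcases y with b | v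
  · exact hM t t' h a b
  · simp [extend]
  · simp [extend]
  · simp only [extend]
    split_ifs with h1 h2
    · exact absurd (h1.1.symm.trans h2.1) h
    all_goals simp

theorem sum_extend (M : T → I → I → ℝ) (t : T) :
    ∑ x, ∑ y, extend M t x y = 1 + ∑ a, ∑ b, M t a b := by
  simp only [Fintype.sum_sum_type, extend, sum_const_zero, add_zero, zero_add]
  rw [add_comm]
  congr 1
  rw [sum_eq_single_of_mem t (mem_univ _) fun u _ hu => by simp [hu]]
  simp

theorem gramFactor_extend_inl (M : T → I → I → ℝ) (shared : T → Prop) [DecidablePred shared]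
    (t : T) (a a' : I) :
    gramFactor (extend M) shared t (.inl a) (.inl a') = gramFactor M shared t a a' := by
  simp [gramFactor, extend]

theorem gramFactor_extend_inr_left (M : T → I → I → ℝ) (shared : T → Prop) [DecidablePred shared]
    {t u : T} (h : u ≠ t) (x : I ⊕ T) : gramFactor (extend M) shared t (.inr u) x = 0 := by
  simp [gramFactor, extend, h]

theorem gramFactor_extend_inr_right (M : T → I → I → ℝ) (shared : T → Prop)
    [DecidablePred shared] {t u : T} (h : u ≠ t) (x : I ⊕ T) :
    gramFactor (extend M) shared t x (.inr u) = 0 := by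
  simp [gramFactor, extend, h]

/-- An own row is nonzero for one matrix only, so it drops out of any block with two elements. -/
theorem sum_prod_gramFactor_extend (M : T → I → I → ℝ) (shared : T → Prop)
    [DecidablePred shared] {B : Finset T} (hB : 2 ≤ B.card) :
    ∑ x, ∑ x', ∏ t ∈ B, gramFactor (extend M) shared t x x'
      = ∑ a, ∑ a', ∏ t ∈ B, gramFactor M shared t a a' := by
  have hex : ∀ u : T, ∃ t ∈ B, u ≠ t := by
    intro u
    obtain ⟨t, ht, hne⟩ := Finset.exists_mem_ne (by omega : 1 < B.card) u
    exact ⟨t, ht, hne.symm⟩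
  have h1 : ∀ u x, ∏ t ∈ B, gramFactor (extend M) shared t (.inr u) x = 0 := by
    intro u x
    obtain ⟨t, ht, hne⟩ := hex u
    exact prod_eq_zero ht (gramFactor_extend_inr_left M shared hne x)
  have h2 : ∀ u x, ∏ t ∈ B, gramFactor (extend M) shared t x (.inr u) = 0 := by
    intro u x
    obtain ⟨t, ht, hne⟩ := hex u
    exact prod_eq_zero ht (gramFactor_extend_inr_right M shared hne x)
  simp only [Fintype.sum_sum_type, h1, h2, sum_const_zero, add_zero, gramFactor_extend_inl]

/-- The estimates on rows and on pairs of rows from which the block estimates follow. -/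
structure RowBound (M : T → I → I → ℝ) (κ Λ g : ℝ) : Prop where
  row : ∀ t a, |∑ b, M t a b| ≤ κ
  col : ∀ t b, |∑ a, M t a b| ≤ κ
  entry : ∀ t a a', |∑ b, M t a b * M t a' b| ≤ κ ^ 2
  gram : ∀ t, ∑ a, ∑ a', (∑ b, M t a b * M t a' b) ^ 2 ≤ Λ ^ 2
  pair : ∀ t t', t ≠ t' → |∑ a, (∑ b, M t a b) * ∑ b, M t' a b| ≤ g ^ 2

theorem sum_sum_mul_le {A A' : I → I → ℝ} {Λ Λ' : ℝ} (hΛ : 0 ≤ Λ) (hΛ' : 0 ≤ Λ')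
    (hA : ∑ a, ∑ a', A a a' ^ 2 ≤ Λ ^ 2) (hA' : ∑ a, ∑ a', A' a a' ^ 2 ≤ Λ' ^ 2) :
    ∑ a, ∑ a', A a a' * A' a a' ≤ Λ * Λ' := by
  have h1 := Real.sum_mul_le_sqrt_mul_sqrt (univ : Finset (I × I)) (fun p => A p.1 p.2)
    (fun p => A' p.1 p.2)
  simp only [Fintype.sum_prod_type] at h1
  refine h1.trans (mul_le_mul ?_ ?_ (Real.sqrt_nonneg _) hΛ)
  · exact (Real.sqrt_le_left hΛ).2 hA
  · exact (Real.sqrt_le_left hΛ').2 hA'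

/-- Blocks of three or more elements are small by the row bounds alone. For two elements
Hilbert–Schmidt norms are used, except when neither column is shared: then the double sum is the
square of a correlation of row sums, and `pair` is indispensable. -/
theorem RowBound.blockBound {M : T → I → I → ℝ} {κ Λ g h : ℝ} (hM : RowBound M κ Λ g)
    (hκ : 0 ≤ κ) (hΛ : 0 ≤ Λ) (hκg : κ ≤ g) (hg3 : (Fintype.card I : ℝ) ^ 2 * κ ^ 6 ≤ g ^ 6)
    (hg2 : Λ * (Fintype.card I * κ ^ 2) ≤ g ^ 4) (hg2' : Λ ^ 2 ≤ g ^ 4)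
    (hh : Fintype.card I * κ ^ 2 + 1 ≤ h ^ 2) : BlockBound (extend M) g h := by
  have hg0 : 0 ≤ g := hκ.trans hκg
  constructor
  · intro shared _ B hB
    rw [sum_prod_gramFactor_extend M shared hB]
    have hfac : ∀ t a a', |gramFactor M shared t a a'| ≤ κ ^ 2 := by
      intro t a a'
      unfold gramFactor
      split_ifs
      · exact hM.entry t a a'
      · rw [abs_mul, sq]
        exact mul_le_mul (hM.row t a) (hM.row t a') (abs_nonneg _) hκ
    rcases hB.eq_or_lt with hB2 | hB3
    · obtain ⟨t, t', hne, rfl⟩ := card_eq_two.1 hB2.symm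
      rw [← hB2]
      simp only [prod_pair hne]
      rw [← pow_mul]
      have hR : ∀ t, ∑ a, ∑ a', ((∑ b, M t a b) * ∑ b, M t a' b) ^ 2
          ≤ (Fintype.card I * κ ^ 2) ^ 2 := by
        intro t
        have h1 : ∀ a a', ((∑ b, M t a b) * ∑ b, M t a' b) ^ 2 ≤ (κ ^ 2) ^ 2 := by
          intro a a'
          rw [← sq_abs, abs_mul, sq κ]
          gcongr
          · exact hM.row t a
          · exact hM.row t a'
        refine (sum_le_sum fun a _ => sum_le_sum fun a' _ => h1 a a').trans (le_of_eq ?_)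
        simp; ring
      have hc : 0 ≤ (Fintype.card I : ℝ) * κ ^ 2 := by positivity
      unfold gramFactor
      split_ifs
      · refine (sum_sum_mul_le hΛ hΛ (hM.gram t) (hM.gram t')).trans ?_
        rw [← sq]; exact hg2'
      · exact (sum_sum_mul_le hΛ hc (hM.gram t) (hR t')).trans hg2
      · refine (sum_sum_mul_le hc hΛ (hR t) (hM.gram t')).trans ?_
        rw [mul_comm]; exact hg2
      · have h1 : ∑ a, ∑ a', (∑ b, M t a b) * (∑ b, M t a' b) *
            ((∑ b, M t' a b) * ∑ b, M t' a' b)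
            = (∑ a, (∑ b, M t a b) * ∑ b, M t' a b) ^ 2 := by
          rw [sq, sum_mul_sum]
          refine sum_congr rfl fun a _ => sum_congr rfl fun a' _ => by ring
        rw [h1, ← sq_abs]
        calc _ ≤ (g ^ 2) ^ 2 := by gcongr; exact hM.pair t t' hne
          _ = _ := by ring
    · have h1 : ∀ a a', ∏ t ∈ B, gramFactor M shared t a a' ≤ (κ ^ 2) ^ B.card := by
        intro a a'
        refine (le_abs_self _).trans ?_
        rw [abs_prod, ← prod_const]
        exact prod_le_prod (fun _ _ => abs_nonneg _) fun t _ => hfac t a a'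
      refine (sum_le_sum fun a _ => sum_le_sum fun a' _ => h1 a a').trans ?_
      simp only [sum_const, card_univ, nsmul_eq_mul]
      obtain ⟨k, hk⟩ := Nat.exists_eq_add_of_le (by omega : 3 ≤ B.card)
      rw [hk]
      calc (Fintype.card I : ℝ) * (Fintype.card I * (κ ^ 2) ^ (3 + k))
          = (Fintype.card I : ℝ) ^ 2 * κ ^ 6 * (κ ^ 2) ^ k := by ring
        _ ≤ g ^ 6 * (g ^ 2) ^ k := by gcongr
        _ = _ := by ring
  · intro t
    have h1 : ∑ x, ∑ x', ∑ y, extend M t x y * extend M t x' y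
        = ∑ y, (∑ x, extend M t x y) ^ 2 := by
      simp_rw [sq, sum_mul_sum]
      rw [sum_comm]
      refine Eq.symm (Eq.trans (sum_congr rfl fun y _ => sum_comm) ?_)
      rw [sum_comm]
      refine sum_congr rfl fun x _ => ?_
      rw [sum_comm]
    rw [h1, Fintype.sum_sum_type]
    refine le_trans (add_le_add ?_ ?_) hh
    · have h2 : ∀ b : I, (∑ x, extend M t x (.inl b)) ^ 2 ≤ κ ^ 2 := by
        intro b
        simp only [Fintype.sum_sum_type, extend, sum_const_zero, add_zero]
        rw [← sq_abs]
        gcongr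
        exact hM.col t b
      refine (sum_le_sum fun b _ => h2 b).trans (le_of_eq ?_)
      simp
    · simp only [Fintype.sum_sum_type, extend, sum_const_zero, zero_add]
      rw [sum_eq_single_of_mem t (mem_univ _) fun u _ hu => by simp [hu]]
      simp

/-- The strongly distinct part of `∏ t, (1 + ∑ a b, M t a b)`: the sum over all choices of at
most one entry of each matrix, no two of the chosen ones in the same row or column. -/
noncomputable def distinctSum (M : T → I → I → ℝ) : ℝ :=
  open Classical in
  ∑ x : T → I ⊕ T, ∑ y : T → I ⊕ T, (if Function.Injective x then 1 else 0) *
    (if Function.Injective y then 1 else 0) * ∏ t, extend M t (x t) (y t)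

theorem abs_distinctSum_le [Nonempty T] {M : T → I → I → ℝ} {κ Λ g h y : ℝ}
    (hM : RowBound M κ Λ g) (hM' : RowBound (fun t b a => M t a b) κ Λ g)
    (hdisj : ∀ t t', t ≠ t' → ∀ a b, M t a b * M t' a b = 0)
    (hκ : 0 ≤ κ) (hΛ : 0 ≤ Λ) (hκg : κ ≤ g) (hg3 : (Fintype.card I : ℝ) ^ 2 * κ ^ 6 ≤ g ^ 6)
    (hg2 : Λ * (Fintype.card I * κ ^ 2) ≤ g ^ 4) (hg2' : Λ ^ 2 ≤ g ^ 4)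
    (hh : Fintype.card I * κ ^ 2 + 1 ≤ h ^ 2) (hgh : g ≤ h) (hy0 : 0 ≤ y) (hy1 : y ≤ 1)
    (hy : g * h ≤ y ^ 4) :
    |distinctSum M| ≤ ∑ σ : Equiv.Perm T, ∑ τ : Equiv.Perm T,
      y ^ σ.support.card * y ^ τ.support.card *
        ∏ t with σ t = t ∧ τ t = t, |1 + ∑ a, ∑ b, M t a b| := by
  classical
  unfold distinctSum
  have e := sum_injective_eq_sum_perm (extend M)
  rw [e]
  refine (abs_sum_le_sum_abs _ _).trans (sum_le_sum fun σ _ => ?_)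
  refine (abs_sum_le_sum_abs _ _).trans (sum_le_sum fun τ _ => ?_)
  have hs : ∀ ρ : Equiv.Perm T, |((Equiv.Perm.sign ρ : ℤ) : ℝ)| = 1 := by
    intro ρ
    rcases Int.units_eq_one_or (Equiv.Perm.sign ρ) with h | h <;> rw [h] <;> simp
  rw [abs_mul, abs_mul, hs, hs, one_mul, one_mul]
  have : Nonempty (I ⊕ T) := inferInstance
  have h1 := abs_permTerm_le_of_blockBound (hκ.trans hκg) hgh hy0 hy1 hy
    (hM.blockBound hκ hΛ hκg hg3 hg2 hg2' hh)
    (by rw [extend_swap]; exact hM'.blockBound hκ hΛ hκg hg3 hg2 hg2' hh)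
    (extend_mul_eq_zero hdisj) σ τ
  simpa only [sum_extend] using h1

/-- A crude bound, dropping both injectivity conditions, for the exceptional points. -/
theorem abs_distinctSum_le_prod (M : T → I → I → ℝ) :
    |distinctSum M| ≤ ∏ t, (1 + ∑ a, ∑ b, |M t a b|) := by
  classical
  have h1 : ∏ t, (1 + ∑ a, ∑ b, |M t a b|)
      = ∑ x : T → I ⊕ T, ∑ y : T → I ⊕ T, ∏ t, |extend M t (x t) (y t)| := by
    have h2 : ∀ t, 1 + ∑ a, ∑ b, |M t a b| = ∑ x, ∑ y, |extend M t x y| := by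
      intro t
      rw [← sum_extend (fun t a b => |M t a b|)]
      refine sum_congr rfl fun x _ => sum_congr rfl fun y _ => ?_
      rcases x with a | u <;> rcases y with b | v <;> simp [extend]
      split_ifs <;> simp
    simp_rw [h2]
    rw [prod_univ_sum, Fintype.piFinset_univ]
    refine sum_congr rfl fun x _ => ?_
    rw [prod_univ_sum, Fintype.piFinset_univ]
  rw [h1]
  unfold distinctSum
  refine (abs_sum_le_sum_abs _ _).trans (sum_le_sum fun x _ => ?_)
  refine (abs_sum_le_sum_abs _ _).trans (sum_le_sum fun y _ => ?_)
  rw [abs_mul, abs_prod]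
  refine mul_le_of_le_one_left (prod_nonneg fun _ _ => abs_nonneg _) ?_
  split_ifs <;> simp

/-- The row of a chosen entry, or the own row of `t` if nothing is chosen. -/
def rowKey (t : T) : Option (I × I) → I ⊕ T
  | none => .inr t
  | some p => .inl p.1

/-- The column of a chosen entry, or the own column of `t` if nothing is chosen. -/
def colKey (t : T) : Option (I × I) → I ⊕ T
  | none => .inr t
  | some p => .inl p.2

/-- The factor of a choice: the chosen entry, or `1` if nothing is chosen. -/
def choiceWeight (M : T → I → I → ℝ) (t : T) : Option (I × I) → ℝ
  | none => 1
  | some p => M t p.1 p.2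

/-- No two of the chosen entries are in the same row or column. -/
def StronglyDistinct (g : T → Option (I × I)) : Prop :=
  Function.Injective (fun t => rowKey t (g t)) ∧ Function.Injective (fun t => colKey t (g t))

theorem extend_eq_sum (M : T → I → I → ℝ) (t : T) (x y : I ⊕ T) :
    extend M t x y = ∑ o : Option (I × I),
      if rowKey t o = x ∧ colKey t o = y then choiceWeight M t o else 0 := by
  rw [Fintype.sum_option, Fintype.sum_prod_type]
  rcases x with a | u <;> rcases y with b | v
  · simp [extend, rowKey, colKey, choiceWeight, ite_and]
  · simp [extend, rowKey, colKey]
  · simp [extend, rowKey, colKey]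
  · simp only [extend, rowKey, colKey, choiceWeight]
    simp [eq_comm]

/-- The pairing with the discrepancy works with this form, the L¹ bound with the matrix form. -/
theorem distinctSum_eq_sum_choice (M : T → I → I → ℝ) :
    distinctSum M = open Classical in ∑ g : T → Option (I × I),
      if StronglyDistinct g then ∏ t, choiceWeight M t (g t) else 0 := by
  classical
  have h1 : ∀ x y : T → I ⊕ T, ∏ t, extend M t (x t) (y t) = ∑ g : T → Option (I × I),
      if x = (fun t => rowKey t (g t)) ∧ y = (fun t => colKey t (g t)) then
        ∏ t, choiceWeight M t (g t) else 0 := by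
    intro x y
    simp_rw [extend_eq_sum]
    rw [prod_univ_sum, Fintype.piFinset_univ]
    refine sum_congr rfl fun g _ => ?_
    rw [prod_ite_zero]
    have h2 : (x = (fun t => rowKey t (g t)) ∧ y = (fun t => colKey t (g t))) ↔
        ∀ t ∈ univ, rowKey t (g t) = x t ∧ colKey t (g t) = y t := by
      simp only [mem_univ, forall_true_left, funext_iff, forall_and]
      simp only [eq_comm]
    by_cases h3 : ∀ t ∈ univ, rowKey t (g t) = x t ∧ colKey t (g t) = y t
    · rw [if_pos h3, if_pos (h2.2 h3)]
    · rw [if_neg h3, if_neg (mt h2.1 h3)]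
  unfold distinctSum
  simp_rw [h1, mul_sum]
  rw [sum_congr rfl fun x _ => sum_comm, sum_comm]
  refine sum_congr rfl fun g _ => ?_
  rw [sum_eq_single_of_mem (fun t => rowKey t (g t)) (mem_univ _)
    (fun x _ hx => by simp [hx]),
    sum_eq_single_of_mem (fun t => colKey t (g t)) (mem_univ _) (fun y _ hy => by simp [hy])]
  simp only [and_self, if_true, StronglyDistinct]
  split_ifs <;> simp_all

end Extended

/-! ### The mean of a Riesz product of martingale blocks. -/

section Riesz

variable {Ω : Type*} [Fintype Ω] {φ : ℕ → Equiv.Perm Ω} {d : ℕ → Ω → ℝ}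

/-- The last block is averaged first: the product of the earlier ones is a nonnegative weight
invariant under its flips. Stopping makes the square function bounded everywhere, as this argument
requires. -/
theorem IsFlipMartingale.sum_riesz_le (h : IsFlipMartingale φ d) (l : ℕ) {L : ℝ} (hL0 : 0 < L)
    (hL1 : L ≤ 1) (P : ℕ → Prop) [DecidablePred P] (k : ℕ) :
    ∑ ω, ∏ t ∈ range k, (if P t then
      |1 + ∑ c ∈ Ico (t * l) ((t + 1) * l), stopSeq d (t * l) L c ω| else 1)
      ≤ (1 + 2 * Real.exp (-(1 / (2 * L)))) ^ k * Fintype.card Ω := by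
  induction k with
  | zero => simp
  | succ k ih =>
    have hone : 1 ≤ 1 + 2 * Real.exp (-(1 / (2 * L))) := by
      linarith [Real.exp_pos (-(1 / (2 * L)))]
    set G : Ω → ℝ := fun ω => ∏ t ∈ range k, (if P t then
      |1 + ∑ c ∈ Ico (t * l) ((t + 1) * l), stopSeq d (t * l) L c ω| else 1) with hG
    have hG0 : ∀ ω, 0 ≤ G ω := fun ω => prod_nonneg fun t _ => by split_ifs <;> positivity
    have hGinv : ∀ c, k * l ≤ c → ∀ ω, G (φ c ω) = G ω := by
      intro c hc ω
      refine prod_congr rfl fun t ht => ?_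
      have h1 : ∑ c' ∈ Ico (t * l) ((t + 1) * l), stopSeq d (t * l) L c' (φ c ω)
          = ∑ c' ∈ Ico (t * l) ((t + 1) * l), stopSeq d (t * l) L c' ω := by
        refine sum_congr rfl fun c' hc' => ?_
        refine (h.stopped (t * l) L).inv c' c ?_ ω
        have h2 : (t + 1) * l ≤ k * l := Nat.mul_le_mul_right l (mem_range.1 ht)
        exact ((mem_Ico.1 hc').2.trans_le h2).trans_le hc
      rw [h1]
    have hkl : k * l ≤ (k + 1) * l := Nat.mul_le_mul_right l (Nat.le_succ k)
    have h2 : ∑ ω, G ω * (if P k then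
        |1 + ∑ c ∈ Ico (k * l) ((k + 1) * l), stopSeq d (k * l) L c ω| else 1)
        ≤ (1 + 2 * Real.exp (-(1 / (2 * L)))) * ∑ ω, G ω := by
      split_ifs
      · exact (h.stopped (k * l) L).sum_mul_abs_one_add_le hG0 hkl hGinv hL0 hL1
          (fun ω => sum_stopped_sq_le hkl hL0.le ω)
      · simp only [mul_one]
        exact le_mul_of_one_le_left (sum_nonneg fun ω _ => hG0 ω) hone
    simp_rw [prod_range_succ]
    refine h2.trans ?_
    rw [pow_succ', mul_assoc]
    exact mul_le_mul_of_nonneg_left ih (by linarith)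

end Riesz

/-! ### Block matrices of a family and their exceptional set. -/

section MainEstimate

variable {Ω : Type*} {n : ℕ} {φ₁ φ₂ φ₃ : ℕ → Equiv.Perm Ω} {f : ℕ → ℕ → ℕ → Ω → ℝ}

/-- The part of the family with first index in the `t`-th block of length `l`, as a matrix
indexed by the two other indices, multiplied by `ρ`. -/
def blockMatrix (n : ℕ) (f : ℕ → ℕ → ℕ → Ω → ℝ) (l : ℕ) (ρ : ℝ) {q : ℕ} (ω : Ω) (t : Fin q)
    (a b : Fin (n + 1)) : ℝ :=
  ρ * if (n - a - b) / l = t then f (n - a - b) a b ω else 0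

theorem blockMatrix_mul_eq_zero (f : ℕ → ℕ → ℕ → Ω → ℝ) (l : ℕ) (ρ : ℝ) {q : ℕ} (ω : Ω)
    (t t' : Fin q) (h : t ≠ t') (a b : Fin (n + 1)) :
    blockMatrix n f l ρ ω t a b * blockMatrix n f l ρ ω t' a b = 0 := by
  unfold blockMatrix
  by_cases h1 : (n - a - b) / l = (t : ℕ)
  · have : ¬ (n - a - b) / l = (t' : ℕ) := fun h2 => h (Fin.ext (h1.symm.trans h2))
    rw [if_neg this]; ring
  · rw [if_neg h1]; ring

theorem abs_blockMatrix_le (h : HaarFamily n φ₁ φ₂ φ₃ f) (l : ℕ) {ρ : ℝ} (hρ : 0 ≤ ρ) {q : ℕ}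
    (ω : Ω) (t : Fin q) (a b : Fin (n + 1)) : |blockMatrix n f l ρ ω t a b| ≤ ρ := by
  unfold blockMatrix
  rw [abs_mul, abs_of_nonneg hρ]
  refine mul_le_of_le_one_right hρ ?_
  split_ifs
  · exact h.bdd _ _ _ _
  · simp

/-- Grouping the entries by first index exhibits the total sum as a block of the martingale
`HaarFamily.isFlipMartingale_first`. -/
theorem HaarFamily.sum_blockMatrix (h : HaarFamily n φ₁ φ₂ φ₃ f) {l : ℕ} (hl : 0 < l) (ρ : ℝ)
    {q : ℕ} (ω : Ω) (t : Fin q) :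
    ∑ a, ∑ b, blockMatrix n f l ρ ω t a b
      = ∑ c ∈ Ico (t * l) ((t + 1) * l), ρ * ∑ a ∈ range (n + 1), f c a (n - c - a) ω := by
  have hr := h.restrict (fun c => c / l = t)
  have h1 : ∀ a b, (if (n - a - b) / l = (t : ℕ) then f (n - a - b) a b ω else 0)
      = ∑ c ∈ range (n + 1), if c / l = (t : ℕ) then f c a b ω else 0 :=
    fun a b => (hr.rotate.sum_third a b ω).symm
  have h2 : ∀ c a, ∑ b ∈ range (n + 1), (if c / l = (t : ℕ) then f c a b ω else 0)
      = if c / l = (t : ℕ) then f c a (n - c - a) ω else 0 := fun c a => hr.sum_third c a ω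
  unfold blockMatrix
  simp_rw [← mul_sum]
  congr 1
  rw [Fin.sum_univ_eq_sum_range (fun a => ∑ b : Fin (n + 1),
    if (n - a - b) / l = (t : ℕ) then f (n - a - b) a b ω else 0)]
  have h3 : ∀ a, ∑ b : Fin (n + 1), (if (n - a - b) / l = (t : ℕ) then f (n - a - b) a b ω else 0)
      = ∑ c ∈ range (n + 1), if c / l = (t : ℕ) then f c a (n - c - a) ω else 0 := by
    intro a
    rw [Fin.sum_univ_eq_sum_range (fun b : ℕ =>
      if (n - a - b) / l = (t : ℕ) then f (n - a - b) a b ω else 0)]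
    simp_rw [h1]
    rw [sum_comm]
    simp_rw [h2]
  simp_rw [h3]
  rw [sum_comm]
  have h4 : ∀ c, c / l = (t : ℕ) ↔ c ∈ Ico (t * l) ((t + 1) * l) := by
    intro c
    rw [mem_Ico, Nat.div_eq_iff hl, Nat.succ_mul]
    omega
  have h5 : ∀ c, ∑ a ∈ range (n + 1), (if c / l = (t : ℕ) then f c a (n - c - a) ω else 0)
      = if c ∈ Ico (t * l) ((t + 1) * l) then ∑ a ∈ range (n + 1), f c a (n - c - a) ω else 0 := by
    intro c
    simp only [h4]
    split_ifs <;> simp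
  simp_rw [h5]
  rw [← sum_filter]
  refine sum_subset (fun c hc => (mem_filter.1 hc).2) fun c hc hc' => ?_
  -- The interval of a block may run beyond `n`, where the family vanishes.
  refine sum_eq_zero fun a _ => h.supp _ _ _ ?_ ω
  have : ¬ c < n + 1 := fun h6 => hc' (mem_filter.2 ⟨mem_range.2 h6, hc⟩)
  omega

theorem HaarFamily.isFlipMartingale_first (h : HaarFamily n φ₁ φ₂ φ₃ f) (ρ : ℝ) :
    IsFlipMartingale φ₁ (fun c ω => ρ * ∑ a ∈ range (n + 1), f c a (n - c - a) ω) := by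
  constructor
  · intro c ω
    simp only [h.odd₁, sum_neg_distrib, mul_neg]
  · intro c c' hc ω
    simp only [h.inv₁ _ _ _ _ hc]

/-- The estimates for one family in the three orders of the indices that are needed. -/
def Controlled (n : ℕ) (K : ℝ) (f : ℕ → ℕ → ℕ → Ω → ℝ) (ω : Ω) : Prop :=
  (∀ a < n + 1, |∑ b ∈ range (n + 1), f a b (n - a - b) ω| ≤ K ^ 1027) ∧
    gramSq (n + 1) (fun a b => f a b (n - a - b) ω) ≤ 6 * K ^ 7171 ∧
    |pairSum (n + 1) (fun a b => f a b (n - a - b) ω)| ≤ 8 * K ^ 3975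

/-- The part of the family with first index in the blocks `t` and `t'`. -/
def blockPart (f : ℕ → ℕ → ℕ → Ω → ℝ) (l t t' : ℕ) (a b c : ℕ) (ω : Ω) : ℝ :=
  if a / l = t ∨ a / l = t' then f a b c ω else 0

/-- The original order serves the square function in the first index; the other two serve the rows
and the columns of the block matrices. Unions of two blocks are included for the sake of
polarisation. -/
theorem HaarFamily.controlled_outside [Fintype Ω] (h : HaarFamily n φ₁ φ₂ φ₃ f) {K : ℝ}
    (hK : 1 ≤ K) (hm : ((n + 1 : ℕ) : ℝ) = K ^ 2048) (l q : ℕ) :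
    HoldsOutside (q ^ 2 * (36 * K ^ 6144 * Real.exp (-(K ^ 6 / 2)))) (fun ω =>
      ∀ t t' : Fin q, Controlled n K (blockPart f l t t') ω ∧
        Controlled n K (fun a b c => blockPart f l t t' c a b) ω ∧
        Controlled n K (fun a b c => blockPart f l t t' c b a) ω) := by
  have h1 : ∀ i ∈ (univ : Finset (Fin q × Fin q)),
      HoldsOutside (36 * K ^ 6144 * Real.exp (-(K ^ 6 / 2))) (fun ω =>
      Controlled n K (blockPart f l i.1 i.2) ω ∧
        Controlled n K (fun a b c => blockPart f l i.1 i.2 c a b) ω ∧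
        Controlled n K (fun a b c => blockPart f l i.1 i.2 c b a) ω) := by
    intro i _
    have hr : HaarFamily n φ₁ φ₂ φ₃ (blockPart f l i.1 i.2) :=
      h.restrict (fun c => c / l = i.1 ∨ c / l = i.2)
    refine ((hr.control hK hm).and ((hr.rotate.control hK hm).and
      (hr.rotate.swap.control hK hm))).mono (le_of_eq (by ring)) fun ω hω => hω
  refine (HoldsOutside.forall univ h1).mono (le_of_eq ?_) fun ω hω t t' => hω (t, t') (mem_univ _)
  rw [card_univ, Fintype.card_prod, Fintype.card_fin]
  push_cast; ring

end MainEstimate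

/-! ### Numerical row bounds after scaling by `k ^ 2047`. -/

section RowBounds

theorem pow_mul_pow_eq {K k : ℝ} (hKk : K * k = 1) {i j r : ℕ} (h : j = i + r) :
    K ^ i * k ^ j = k ^ r := by
  rw [h, pow_add, ← mul_assoc, ← mul_pow, hKk, one_pow, one_mul]

theorem pairSum_add {m : ℕ} {w w' : ℕ → ℕ → ℝ} (h : ∀ a b, w a b * w' a b = 0) :
    pairSum m (fun a b => w a b + w' a b) = pairSum m w + pairSum m w' +
      2 * ∑ a ∈ range m, (∑ b ∈ range m, w a b) * ∑ b ∈ range m, w' a b := by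
  unfold pairSum
  rw [mul_sum, ← sum_add_distrib, ← sum_add_distrib]
  refine sum_congr rfl fun a _ => ?_
  have h1 : ∑ b ∈ range m, (w a b + w' a b) ^ 2
      = ∑ b ∈ range m, w a b ^ 2 + ∑ b ∈ range m, w' a b ^ 2 := by
    rw [← sum_add_distrib]
    refine sum_congr rfl fun b _ => ?_
    linear_combination 2 * h a b
  rw [h1, sum_add_distrib]
  ring

/-- With `ρ = k ^ 2047` one has `ρ K ^ 1027 = k ^ 1020`, `6 ρ⁴ K ^ 7171 ≤ k ^ 1016` and `12 ρ² K ^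
3975 ≤ k ^ 118`; one spare factor `k` absorbs the constants. -/
theorem rowBound_of_estimates {m q : ℕ} {K k : ℝ} (hK : 12 ≤ K) (hKk : K * k = 1)
    (hm : (m : ℝ) = K ^ 2048) {w : Fin q → ℕ → ℕ → ℝ} (hw : ∀ t a b, |w t a b| ≤ 1)
    (hdisj : ∀ t t', t ≠ t' → ∀ a b, w t a b * w t' a b = 0)
    (hrow : ∀ t, ∀ a < m, |∑ b ∈ range m, w t a b| ≤ K ^ 1027)
    (hcol : ∀ t, ∀ b < m, |∑ a ∈ range m, w t a b| ≤ K ^ 1027)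
    (hgram : ∀ t, gramSq m (w t) ≤ 6 * K ^ 7171)
    (hpair : ∀ t, |pairSum m (w t)| ≤ 8 * K ^ 3975)
    (hpair' : ∀ t t', t ≠ t' → |pairSum m (fun a b => w t a b + w t' a b)| ≤ 8 * K ^ 3975) :
    RowBound (fun t (a b : Fin m) => k ^ 2047 * w t a b) (k ^ 1020) (k ^ 508) (k ^ 59) := by
  have hK0 : 0 < K := by linarith
  have hk0 : 0 < k := by
    by_contra h
    nlinarith
  have hk1 : 12 * k ≤ 1 := by nlinarith
  have hk1' : k ≤ 1 := by linarith
  have hρ : (0 : ℝ) ≤ k ^ 2047 := by positivity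
  constructor
  · intro t a
    rw [← mul_sum, Fin.sum_univ_eq_sum_range (fun b => w t a b), abs_mul, abs_of_nonneg hρ]
    calc k ^ 2047 * |∑ b ∈ range m, w t a b| ≤ k ^ 2047 * K ^ 1027 := by
          gcongr; exact hrow t a a.2
      _ = _ := by rw [mul_comm, pow_mul_pow_eq hKk (r := 1020) (by norm_num)]
  · intro t b
    rw [← mul_sum, Fin.sum_univ_eq_sum_range (fun a => w t a b), abs_mul, abs_of_nonneg hρ]
    calc k ^ 2047 * |∑ a ∈ range m, w t a b| ≤ k ^ 2047 * K ^ 1027 := by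
          gcongr; exact hcol t b b.2
      _ = _ := by rw [mul_comm, pow_mul_pow_eq hKk (r := 1020) (by norm_num)]
  · intro t a a'
    have h1 : ∀ b ∈ range m, |k ^ 2047 * w t a b * (k ^ 2047 * w t a' b)| ≤ k ^ 4094 := by
      intro b _
      rw [show k ^ 2047 * w t a b * (k ^ 2047 * w t a' b) = k ^ 4094 * (w t a b * w t a' b) by ring,
        abs_mul, abs_of_nonneg (by positivity), abs_mul]
      exact mul_le_of_le_one_right (by positivity)
        (mul_le_one₀ (hw t a b) (abs_nonneg _) (hw t a' b))
    rw [Fin.sum_univ_eq_sum_range (fun b => k ^ 2047 * w t a b * (k ^ 2047 * w t a' b))]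
    refine (abs_sum_range_le _ m h1).trans ?_
    rw [hm, pow_mul_pow_eq hKk (r := 2046) (by norm_num), ← pow_mul]
    exact pow_le_pow_of_le_one hk0.le hk1' (by norm_num)
  · intro t
    have h1 : ∑ a : Fin m, ∑ a' : Fin m,
        (∑ b : Fin m, k ^ 2047 * w t a b * (k ^ 2047 * w t a' b)) ^ 2
        = (k ^ 2047) ^ 4 * gramSq m (w t) := by
      unfold gramSq
      rw [mul_sum, ← Fin.sum_univ_eq_sum_range (fun a => (k ^ 2047) ^ 4 * ∑ a' ∈ range m,
        (∑ b ∈ range m, w t a b * w t a' b) ^ 2)]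
      refine sum_congr rfl fun a _ => ?_
      rw [mul_sum, ← Fin.sum_univ_eq_sum_range (fun a' => (k ^ 2047) ^ 4 *
        (∑ b ∈ range m, w t a b * w t a' b) ^ 2)]
      refine sum_congr rfl fun a' _ => ?_
      rw [← Fin.sum_univ_eq_sum_range (fun b => w t a b * w t a' b)]
      have : ∑ b : Fin m, k ^ 2047 * w t a b * (k ^ 2047 * w t a' b)
          = (k ^ 2047) ^ 2 * ∑ b : Fin m, w t a b * w t a' b := by
        rw [mul_sum]
        exact sum_congr rfl fun b _ => by ring
      rw [this]; ring
    rw [h1]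
    calc (k ^ 2047) ^ 4 * gramSq m (w t) ≤ (k ^ 2047) ^ 4 * (6 * K ^ 7171) := by
          gcongr; exact hgram t
      _ = 6 * (K ^ 7171 * k ^ 8188) := by ring
      _ = 6 * k ^ 1017 := by rw [pow_mul_pow_eq hKk (r := 1017) (by norm_num)]
      _ = 6 * k * k ^ 1016 := by ring
      _ ≤ 1 * k ^ 1016 := by gcongr; linarith
      _ = _ := by ring
  · intro t t' ht
    have h1 : ∑ a : Fin m, (∑ b : Fin m, k ^ 2047 * w t a b) * ∑ b : Fin m, k ^ 2047 * w t' a b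
        = k ^ 4094 * ∑ a ∈ range m, (∑ b ∈ range m, w t a b) * ∑ b ∈ range m, w t' a b := by
      rw [mul_sum, ← Fin.sum_univ_eq_sum_range (fun a => k ^ 4094 *
        ((∑ b ∈ range m, w t a b) * ∑ b ∈ range m, w t' a b))]
      refine sum_congr rfl fun a _ => ?_
      rw [← mul_sum, ← mul_sum, Fin.sum_univ_eq_sum_range (fun b => w t a b),
        Fin.sum_univ_eq_sum_range (fun b => w t' a b)]
      ring
    rw [h1, abs_mul, abs_of_nonneg (by positivity)]
    -- Polarisation: the correlation of two blocks is half of `pairSum` of their sum minus those of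
    -- the two blocks, whence the constant `12 = 3 * 8 / 2`.
    have h2 := pairSum_add (m := m) (hdisj t t' ht)
    have h3 := abs_le.1 (hpair t)
    have h4 := abs_le.1 (hpair t')
    have h5 := abs_le.1 (hpair' t t' ht)
    have h6 : |∑ a ∈ range m, (∑ b ∈ range m, w t a b) * ∑ b ∈ range m, w t' a b|
        ≤ 12 * K ^ 3975 := abs_le.2 ⟨by linarith, by linarith⟩
    calc _ ≤ k ^ 4094 * (12 * K ^ 3975) := by gcongr
      _ = 12 * (K ^ 3975 * k ^ 4094) := by ring
      _ = 12 * k ^ 119 := by rw [pow_mul_pow_eq hKk (r := 119) (by norm_num)]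
      _ = 12 * k * k ^ 118 := by ring
      _ ≤ 1 * k ^ 118 := by gcongr
      _ = _ := by ring

end RowBounds

/-! ### The L¹ bound for the strongly distinct part. -/

section MainEstimate

variable {Ω : Type*} {n : ℕ} {φ₁ φ₂ φ₃ : ℕ → Equiv.Perm Ω} {f : ℕ → ℕ → ℕ → Ω → ℝ}

theorem HaarFamily.rowBound_blockMatrix (h : HaarFamily n φ₁ φ₂ φ₃ f) {K k : ℝ} (hK : 12 ≤ K)
    (hKk : K * k = 1) (hm : ((n + 1 : ℕ) : ℝ) = K ^ 2048) {l q : ℕ} {ω : Ω}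
    (hω : ∀ t t' : Fin q, Controlled n K (blockPart f l t t') ω ∧
        Controlled n K (fun a b c => blockPart f l t t' c a b) ω ∧
        Controlled n K (fun a b c => blockPart f l t t' c b a) ω) :
    RowBound (blockMatrix n f l (k ^ 2047) (q := q) ω) (k ^ 1020) (k ^ 508) (k ^ 59) ∧
    RowBound (fun t b a => blockMatrix n f l (k ^ 2047) (q := q) ω t a b)
      (k ^ 1020) (k ^ 508) (k ^ 59) := by
  set w : Fin q → ℕ → ℕ → ℝ := fun t a b =>
    if (n - a - b) / l = t then f (n - a - b) a b ω else 0 with hw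
  have hw1 : ∀ t a b, |w t a b| ≤ 1 := by
    intro t a b
    simp only [hw]
    split_ifs
    · exact h.bdd _ _ _ _
    · simp
  have hdisj : ∀ t t', t ≠ t' → ∀ a b, w t a b * w t' a b = 0 := by
    intro t t' ht a b
    simp only [hw]
    split_ifs with h1 h2
    · exact absurd (Fin.ext (h1.symm.trans h2)) ht
    all_goals simp
  have hs : ∀ t a b, w t a b = blockPart f l t t (n - a - b) a b ω := by
    intro t a b
    simp [hw, blockPart]
  have hadd : ∀ t t', t ≠ t' → ∀ a b,
      w t a b + w t' a b = blockPart f l t t' (n - a - b) a b ω := by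
    intro t t' ht a b
    simp only [hw, blockPart]
    by_cases h1 : (n - a - b) / l = (t : ℕ)
    · simp [h1]
      intro h3
      exact absurd (Fin.ext h3) ht
    · simp [h1]
  have hcomm : ∀ a b, n - a - b = n - b - a := fun a b => by omega
  have hs' : ∀ t a b, w t b a = blockPart f l t t (n - a - b) b a ω := by
    intro t a b
    rw [hs, hcomm]
  have hadd' : ∀ t t', t ≠ t' → ∀ a b,
      w t b a + w t' b a = blockPart f l t t' (n - a - b) b a ω := by
    intro t t' ht a b
    rw [hadd t t' ht, hcomm]
  have hrow : ∀ t, ∀ a < n + 1, |∑ b ∈ range (n + 1), w t a b| ≤ K ^ 1027 := by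
    intro t a ha
    simp only [hs]
    exact (hω t t).2.1.1 a ha
  have hcol : ∀ t, ∀ b < n + 1, |∑ a ∈ range (n + 1), w t a b| ≤ K ^ 1027 := by
    intro t b hb
    simp only [hs']
    exact (hω t t).2.2.1 b hb
  constructor
  · refine rowBound_of_estimates hK hKk hm hw1 hdisj hrow hcol ?_ ?_ ?_
    · intro t
      have := (hω t t).2.1.2.1
      simp only [← hs] at this
      exact this
    · intro t
      have := (hω t t).2.1.2.2
      simp only [← hs] at this
      exact this
    · intro t t' ht
      have := (hω t t').2.1.2.2
      simp only [← hadd t t' ht] at this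
      exact this
  · refine rowBound_of_estimates (w := fun t b a => w t a b) hK hKk hm (fun t b a => hw1 t a b)
      (fun t t' ht b a => hdisj t t' ht a b) hcol hrow ?_ ?_ ?_
    · intro t
      have := (hω t t).2.2.2.1
      simp only [← hs'] at this
      exact this
    · intro t
      have := (hω t t).2.2.2.2
      simp only [← hs'] at this
      exact this
    · intro t t' ht
      have := (hω t t').2.2.2.2
      simp only [← hadd' t t' ht] at this
      exact this

/-- The sum of squared row sums is `pairSum` plus a diagonal of size at most `l (n + 1) ≤ 2 K ^
4093`, which governs the bound. -/
theorem HaarFamily.sum_sq_first_le (h : HaarFamily n φ₁ φ₂ φ₃ f) {K k : ℝ} (hK : 12 ≤ K)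
    (hKk : K * k = 1) (hm : ((n + 1 : ℕ) : ℝ) = K ^ 2048) {l : ℕ} (hl0 : 0 < l)
    (hl : (l : ℝ) ≤ 2 * K ^ 2045) {t : ℕ} {ω : Ω} (hω : Controlled n K (blockPart f l t t) ω) :
    ∑ c ∈ Ico (t * l) ((t + 1) * l), (k ^ 2047 * ∑ a ∈ range (n + 1), f c a (n - c - a) ω) ^ 2
      ≤ 10 * k := by
  have hK0 : 0 < K := by linarith
  have hk0 : 0 < k := by
    by_contra h
    nlinarith
  have h4 : ∀ c, c ∈ Ico (t * l) ((t + 1) * l) ↔ c / l = t := by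
    intro c
    rw [mem_Ico, Nat.div_eq_iff hl0, Nat.succ_mul]
    omega
  have hw : ∀ c a, blockPart f l t t c a (n - c - a) ω
      = if c ∈ Ico (t * l) ((t + 1) * l) then f c a (n - c - a) ω else 0 := by
    intro c a
    simp [blockPart, h4]
  have h1 : ∑ c ∈ Ico (t * l) ((t + 1) * l), (∑ a ∈ range (n + 1), f c a (n - c - a) ω) ^ 2
      ≤ ∑ c ∈ range (n + 1), (∑ a ∈ range (n + 1), blockPart f l t t c a (n - c - a) ω) ^ 2 := by
    have e : ∀ c, (∑ a ∈ range (n + 1), blockPart f l t t c a (n - c - a) ω) ^ 2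
        = if c ∈ Ico (t * l) ((t + 1) * l) then (∑ a ∈ range (n + 1), f c a (n - c - a) ω) ^ 2
          else 0 := by
      intro c
      simp only [hw]
      split_ifs <;> simp
    simp_rw [e]
    rw [← sum_filter]
    refine le_of_eq (Eq.symm (sum_subset (fun c hc => (mem_filter.1 hc).2) fun c hc hc' => ?_))
    have : ¬ c < n + 1 := fun h6 => hc' (mem_filter.2 ⟨mem_range.2 h6, hc⟩)
    rw [sum_eq_zero fun a _ => h.supp _ _ _ (by omega) ω]
    ring
  have h2 : ∑ c ∈ range (n + 1), ∑ a ∈ range (n + 1), blockPart f l t t c a (n - c - a) ω ^ 2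
      ≤ l * ((n + 1 : ℕ) : ℝ) := by
    have e : ∀ c, ∑ a ∈ range (n + 1), blockPart f l t t c a (n - c - a) ω ^ 2
        ≤ if c ∈ Ico (t * l) ((t + 1) * l) then ((n + 1 : ℕ) : ℝ) else 0 := by
      intro c
      simp only [hw]
      split_ifs
      · have : ∀ a ∈ range (n + 1), f c a (n - c - a) ω ^ 2 ≤ 1 := fun a _ => by
          rw [sq_le_one_iff_abs_le_one]; exact h.bdd _ _ _ _
        refine (sum_le_sum this).trans ?_
        simp
      · simp
    refine (sum_le_sum fun c _ => e c).trans ?_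
    rw [← sum_filter, sum_const, nsmul_eq_mul]
    gcongr
    refine (card_le_card (fun c hc => (mem_filter.1 hc).2)).trans ?_
    rw [Nat.card_Ico, Nat.succ_mul]
    omega
  have h3 := (abs_le.1 hω.2.2).2
  unfold pairSum at h3
  rw [sum_sub_distrib] at h3
  simp_rw [mul_pow]
  rw [← mul_sum]
  have h5 : ∑ c ∈ Ico (t * l) ((t + 1) * l), (∑ a ∈ range (n + 1), f c a (n - c - a) ω) ^ 2
      ≤ 10 * K ^ 4093 := by
    have e1 : (l : ℝ) * ((n + 1 : ℕ) : ℝ) ≤ 2 * K ^ 4093 := by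
      rw [hm]
      calc (l : ℝ) * K ^ 2048 ≤ 2 * K ^ 2045 * K ^ 2048 := by gcongr
        _ = _ := by ring
    have e2 : K ^ 3975 ≤ K ^ 4093 := pow_le_pow_right₀ (by linarith) (by norm_num)
    linarith
  calc _ ≤ (k ^ 2047) ^ 2 * (10 * K ^ 4093) := by gcongr
    _ = 10 * (K ^ 4093 * k ^ 4094) := by ring
    _ = 10 * k := by rw [pow_mul_pow_eq hKk (r := 1) (by norm_num), pow_one]

/-- On `G` the stopping never acts. The stopped product is nonnegative, so the sum can be extended
from `G` to the whole space. -/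
theorem HaarFamily.sum_prod_abs_le [Fintype Ω] (h : HaarFamily n φ₁ φ₂ φ₃ f) {K k : ℝ}
    (hK : 12 ≤ K) (hKk : K * k = 1) (hm : ((n + 1 : ℕ) : ℝ) = K ^ 2048) {l q : ℕ} (hl0 : 0 < l)
    (hl : (l : ℝ) ≤ 2 * K ^ 2045) {G : Finset Ω}
    (hG : ∀ ω ∈ G, ∀ t : Fin q, Controlled n K (blockPart f l t t) ω)
    (P : Fin q → Prop) [DecidablePred P] :
    ∑ ω ∈ G, ∏ t with P t, |1 + ∑ a, ∑ b, blockMatrix n f l (k ^ 2047) ω t a b|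
      ≤ (1 + 2 * Real.exp (-(K / 20))) ^ q * Fintype.card Ω := by
  classical
  have hk0 : 0 < k := by
    by_contra h
    nlinarith
  have hk1 : 12 * k ≤ 1 := by nlinarith
  have hsq := fun (t : Fin q) ω (hω : ω ∈ G) =>
    h.sum_sq_first_le hK hKk hm hl0 hl (hG ω hω t)
  generalize k ^ 2047 = ρ at hsq ⊢
  set d : ℕ → Ω → ℝ := fun c ω => ρ * ∑ a ∈ range (n + 1), f c a (n - c - a) ω with hd
  have hmart : IsFlipMartingale φ₁ d := h.isFlipMartingale_first _
  set P' : ℕ → Prop := fun t => ∃ ht : t < q, P ⟨t, ht⟩ with hP'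
  have h1 := hmart.sum_riesz_le l (L := 10 * k) (by positivity) (by linarith) P' q
  have e : 1 / (2 * (10 * k)) = K / 20 := by
    rw [div_eq_div_iff (by positivity) (by norm_num)]
    linear_combination -20 * hKk
  rw [e] at h1
  refine le_trans ?_ h1
  refine le_trans ?_ (sum_le_sum_of_subset_of_nonneg (subset_univ G) fun ω _ _ =>
    prod_nonneg fun t _ => by split_ifs <;> positivity)
  refine sum_le_sum fun ω hω => le_of_eq ?_
  rw [← Fin.prod_univ_eq_prod_range (fun t => if P' t then
      |1 + ∑ c ∈ Ico (t * l) ((t + 1) * l), stopSeq d (t * l) (10 * k) c ω| else 1), prod_filter]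
  refine prod_congr rfl fun t _ => ?_
  have hPt : P' t ↔ P t := ⟨fun ⟨_, h⟩ => h, fun h => ⟨t.2, h⟩⟩
  simp only [hPt]
  rw [h.sum_blockMatrix hl0]
  congr 3
  refine sum_congr rfl fun c hc => ?_
  exact (stopped_eq (d := d) (hsq t ω hω) (mem_Ico.1 hc).2).symm

theorem one_add_pow_le_three {x : ℝ} {q : ℕ} (hx0 : 0 ≤ x) (hx : q * x ≤ 1) : (1 + x) ^ q ≤ 3 := by
  calc (1 + x) ^ q ≤ Real.exp x ^ q := by
        gcongr
        linarith [Real.add_one_le_exp x]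
    _ = Real.exp (q * x) := by rw [← Real.exp_nat_mul]
    _ ≤ Real.exp 1 := Real.exp_le_exp.2 hx
    _ ≤ 3 := by linarith [Real.exp_one_lt_d9]

theorem HaarFamily.sum_abs_distinctSum_good_le [Fintype Ω] (h : HaarFamily n φ₁ φ₂ φ₃ f)
    {K k : ℝ} (hK : 10 ^ 5 ≤ K) (hKk : K * k = 1) (hm : ((n + 1 : ℕ) : ℝ) = K ^ 2048) {l q : ℕ}
    (hl0 : 0 < l) (hl : (l : ℝ) ≤ 2 * K ^ 2045) (hq0 : 0 < q) (hq : (q : ℝ) ≤ 2 * K ^ 3)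
    {G : Finset Ω}
    (hG : ∀ ω ∈ G, ∀ t t' : Fin q, Controlled n K (blockPart f l t t') ω ∧
        Controlled n K (fun a b c => blockPart f l t t' c a b) ω ∧
        Controlled n K (fun a b c => blockPart f l t t' c b a) ω) :
    ∑ ω ∈ G, |distinctSum (blockMatrix n f l (k ^ 2047) (q := q) ω)| ≤ 27 * Fintype.card Ω := by
  have hK0 : 0 < K := by linarith
  have hK12 : 12 ≤ K := by linarith
  have hk0 : 0 < k := by
    by_contra h
    nlinarith
  have hk1 : 10 ^ 5 * k ≤ 1 := by nlinarith
  have hk1' : k ≤ 1 := by linarith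
  have : Nonempty (Fin q) := ⟨⟨0, hq0⟩⟩
  have hcard : (Fintype.card (Fin (n + 1)) : ℝ) = K ^ 2048 := by rw [Fintype.card_fin, hm]
  have hpow : ∀ {i j : ℕ}, i ≤ j → k ^ j ≤ k ^ i := fun hij =>
    pow_le_pow_of_le_one hk0.le hk1' hij
  have h1 : ∀ ω ∈ G, |distinctSum (blockMatrix n f l (k ^ 2047) (q := q) ω)|
      ≤ ∑ σ : Equiv.Perm (Fin q), ∑ τ : Equiv.Perm (Fin q),
      (k ^ 13) ^ σ.support.card * (k ^ 13) ^ τ.support.card *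
        ∏ t with σ t = t ∧ τ t = t, |1 + ∑ a, ∑ b, blockMatrix n f l (k ^ 2047) ω t a b| := by
    intro ω hω
    obtain ⟨hr, hc⟩ := h.rowBound_blockMatrix hK12 hKk hm (hG ω hω)
    -- The parameters are `κ = k ^ 1020`, `Λ = k ^ 508`, `g = k ^ 59`, `h = K ^ 5`, `y = k ^ 13`,
    -- with `g h = k ^ 54 ≤ y ^ 4`.
    refine abs_distinctSum_le hr hc (blockMatrix_mul_eq_zero f l _ ω) (h := K ^ 5)
      (by positivity) (by positivity) (hpow (by norm_num)) ?_ ?_ ?_ ?_ ?_ (by positivity)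
      (pow_le_one₀ hk0.le hk1') ?_
    · rw [hcard]
      calc (K ^ 2048) ^ 2 * (k ^ 1020) ^ 6 = K ^ 4096 * k ^ 6120 := by ring
        _ = k ^ 2024 := pow_mul_pow_eq hKk (by norm_num)
        _ ≤ k ^ 354 := hpow (by norm_num)
        _ = _ := by ring
    · rw [hcard]
      calc k ^ 508 * (K ^ 2048 * (k ^ 1020) ^ 2) = K ^ 2048 * k ^ 2548 := by ring
        _ = k ^ 500 := pow_mul_pow_eq hKk (by norm_num)
        _ ≤ k ^ 236 := hpow (by norm_num)
        _ = _ := by ring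
    · rw [← pow_mul, ← pow_mul]
      exact hpow (by norm_num)
    · rw [hcard]
      have e : K ^ 2048 * (k ^ 1020) ^ 2 = K ^ 8 := by
        calc K ^ 2048 * (k ^ 1020) ^ 2 = K ^ 8 * (K * k) ^ 2040 := by ring
          _ = _ := by rw [hKk]; ring
      rw [e, ← pow_mul]
      have e2 : K ^ (5 * 2) = K ^ 8 * K ^ 2 := by ring
      have e3 : 1 ≤ K ^ 8 := one_le_pow₀ (by linarith)
      have e4 : 2 ≤ K ^ 2 := by nlinarith
      rw [e2]
      nlinarith
    · exact (pow_le_one₀ hk0.le hk1').trans (one_le_pow₀ (by linarith))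
    · calc k ^ 59 * K ^ 5 = K ^ 5 * k ^ 59 := by ring
        _ = k ^ 54 := pow_mul_pow_eq hKk (by norm_num)
        _ ≤ k ^ 52 := hpow (by norm_num)
        _ = _ := by ring
  refine (sum_le_sum h1).trans ?_
  rw [sum_comm]
  have hR : (1 + 2 * Real.exp (-(K / 20))) ^ q ≤ 3 := by
    refine one_add_pow_le_three (by positivity) ?_
    -- The fifth term of the exponential series already exceeds `4 K ^ 3 ≥ 2 q`.
    have h2 := Real.pow_div_factorial_le_exp (K / 20) (by positivity) 5
    have h3 : 4 * K ^ 3 ≤ Real.exp (K / 20) := by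
      refine le_trans ?_ h2
      rw [show ((Nat.factorial 5 : ℕ) : ℝ) = 120 by norm_num [Nat.factorial]]
      have : 384000000 * 4 ≤ K ^ 2 := by nlinarith
      have h4 : 0 < K ^ 3 := by positivity
      rw [le_div_iff₀ (by norm_num), div_pow]
      rw [le_div_iff₀ (by norm_num)]
      nlinarith
    rw [Real.exp_neg]
    have hE := Real.exp_pos (K / 20)
    rw [← mul_assoc, ← div_eq_mul_inv, div_le_one hE]
    linarith
  have hS : ∑ σ : Equiv.Perm (Fin q), (k ^ 13) ^ σ.support.card ≤ 3 := by
    refine (sum_pow_card_support_le (by positivity)).trans ?_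
    rw [Fintype.card_fin]
    refine one_add_pow_le_three (by positivity) ?_
    calc (q : ℝ) * (q * k ^ 13) ≤ 2 * K ^ 3 * (2 * K ^ 3 * k ^ 13) := by gcongr
      _ = 4 * (K ^ 6 * k ^ 13) := by ring
      _ = 4 * k ^ 7 := by rw [pow_mul_pow_eq hKk (r := 7) (by norm_num)]
      _ = 4 * k * k ^ 6 := by ring
      _ ≤ 1 * 1 := by
        gcongr
        · linarith
        · exact pow_le_one₀ hk0.le hk1'
      _ = 1 := one_mul 1
  have hS0 : 0 ≤ ∑ σ : Equiv.Perm (Fin q), (k ^ 13) ^ σ.support.card :=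
    sum_nonneg fun _ _ => by positivity
  calc _ = ∑ σ : Equiv.Perm (Fin q), ∑ τ : Equiv.Perm (Fin q),
        (k ^ 13) ^ σ.support.card * (k ^ 13) ^ τ.support.card * ∑ ω ∈ G,
        ∏ t with σ t = t ∧ τ t = t, |1 + ∑ a, ∑ b, blockMatrix n f l (k ^ 2047) ω t a b| := by
        refine sum_congr rfl fun σ _ => ?_
        rw [sum_comm]
        refine sum_congr rfl fun τ _ => ?_
        rw [mul_sum]
    _ ≤ ∑ σ : Equiv.Perm (Fin q), ∑ τ : Equiv.Perm (Fin q),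
        (k ^ 13) ^ σ.support.card * (k ^ 13) ^ τ.support.card * (3 * Fintype.card Ω) := by
        refine sum_le_sum fun σ _ => sum_le_sum fun τ _ => ?_
        refine mul_le_mul_of_nonneg_left ?_ (by positivity)
        refine (h.sum_prod_abs_le hK12 hKk hm hl0 hl (fun ω hω t => (hG ω hω t t).1) _).trans ?_
        gcongr
    _ = (∑ σ : Equiv.Perm (Fin q), (k ^ 13) ^ σ.support.card) *
        (∑ σ : Equiv.Perm (Fin q), (k ^ 13) ^ σ.support.card) * (3 * Fintype.card Ω) := by
        rw [sum_mul_sum, sum_mul]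
        exact sum_congr rfl fun σ _ => by rw [sum_mul]
    _ ≤ 3 * 3 * (3 * Fintype.card Ω) := by gcongr
    _ = _ := by ring

/-- On the exceptional set the crude bound `exp (4100 K ^ 4)` is beaten by the measure, of order
`exp (-K ^ 6 / 2)` up to powers of `K`. -/
theorem HaarFamily.sum_abs_distinctSum_le [Fintype Ω] (h : HaarFamily n φ₁ φ₂ φ₃ f)
    {K k : ℝ} (hK : 10 ^ 5 ≤ K) (hKk : K * k = 1) (hm : ((n + 1 : ℕ) : ℝ) = K ^ 2048) {l q : ℕ}
    (hl0 : 0 < l) (hl : (l : ℝ) ≤ 2 * K ^ 2045) (hq0 : 0 < q) (hq : (q : ℝ) ≤ 2 * K ^ 3) :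
    ∑ ω, |distinctSum (blockMatrix n f l (k ^ 2047) (q := q) ω)| ≤ 28 * Fintype.card Ω := by
  classical
  have hK0 : 0 < K := by linarith
  have hk0 : 0 < k := by
    by_contra h
    nlinarith
  obtain ⟨B, hB, hout⟩ := h.controlled_outside (by linarith) hm l q
  rw [← sum_add_sum_compl B]
  have h1 := h.sum_abs_distinctSum_good_le hK hKk hm hl0 hl hq0 hq (G := Bᶜ)
    (fun ω hω => hout ω (by simpa using hω))
  have h2 : ∀ ω ∈ B, |distinctSum (blockMatrix n f l (k ^ 2047) (q := q) ω)|
      ≤ Real.exp (4100 * K ^ 4) := by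
    intro ω _
    refine (abs_distinctSum_le_prod _).trans ?_
    have h3 : ∀ t : Fin q, 1 + ∑ a, ∑ b, |blockMatrix n f l (k ^ 2047) ω t a b|
        ≤ Real.exp (2050 * K) := by
      intro t
      -- `K ^ 2049` is `(n + 1)² ρ`.
      have h4 : ∑ a, ∑ b, |blockMatrix n f l (k ^ 2047) ω t a b| ≤ K ^ 2049 := by
        refine (sum_le_sum fun a _ => sum_le_sum fun b _ =>
          abs_blockMatrix_le h l (by positivity) ω t a b).trans (le_of_eq ?_)
        simp only [sum_const, card_univ, Fintype.card_fin, nsmul_eq_mul, hm]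
        calc K ^ 2048 * (K ^ 2048 * k ^ 2047) = K ^ 2049 * (K * k) ^ 2047 := by ring
          _ = _ := by rw [hKk]; ring
      have h5 : 1 + K ^ 2049 ≤ K ^ 2050 := by
        have e1 : K ^ 2050 = K * K ^ 2049 := by ring
        have e2 : 1 ≤ K ^ 2049 := one_le_pow₀ (by linarith)
        rw [e1]; nlinarith
      have h6 : K ^ 2050 ≤ Real.exp (2050 * K) := by
        calc K ^ 2050 ≤ Real.exp K ^ 2050 := by
              gcongr
              linarith [Real.add_one_le_exp K]
          _ = _ := by rw [← Real.exp_nat_mul]; norm_num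
      linarith
    calc _ ≤ ∏ _t : Fin q, Real.exp (2050 * K) :=
          prod_le_prod (fun t _ => add_nonneg zero_le_one (sum_nonneg fun _ _ =>
            sum_nonneg fun _ _ => abs_nonneg _)) fun t _ => h3 t
      _ = Real.exp (q * (2050 * K)) := by
          rw [prod_const, card_univ, Fintype.card_fin, ← Real.exp_nat_mul]
      _ ≤ _ := by
          refine Real.exp_le_exp.2 ?_
          calc (q : ℝ) * (2050 * K) ≤ 2 * K ^ 3 * (2050 * K) := by gcongr
            _ = _ := by ring
  have h3 : ∑ ω ∈ B, |distinctSum (blockMatrix n f l (k ^ 2047) (q := q) ω)|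
      ≤ Fintype.card Ω := by
    refine (sum_le_sum h2).trans ?_
    rw [sum_const, nsmul_eq_mul]
    have h4 : (q : ℝ) ^ 2 * (36 * K ^ 6144 * Real.exp (-(K ^ 6 / 2))) * Real.exp (4100 * K ^ 4)
        ≤ 1 := by
      have e1 : (q : ℝ) ^ 2 * (36 * K ^ 6144) ≤ Real.exp (6151 * K) := by
        calc (q : ℝ) ^ 2 * (36 * K ^ 6144) ≤ (2 * K ^ 3) ^ 2 * (36 * K ^ 6144) := by gcongr
          _ = 144 * K ^ 6150 := by ring
          _ ≤ K * K ^ 6150 := by gcongr; linarith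
          _ = K ^ 6151 := by ring
          _ ≤ Real.exp K ^ 6151 := by
              gcongr
              linarith [Real.add_one_le_exp K]
          _ = _ := by rw [← Real.exp_nat_mul]; norm_num
      calc _ = ((q : ℝ) ^ 2 * (36 * K ^ 6144)) * (Real.exp (-(K ^ 6 / 2))
            * Real.exp (4100 * K ^ 4)) := by ring
        _ ≤ Real.exp (6151 * K) * (Real.exp (-(K ^ 6 / 2)) * Real.exp (4100 * K ^ 4)) := by
            gcongr
        _ = Real.exp (6151 * K + (-(K ^ 6 / 2) + 4100 * K ^ 4)) := by
            rw [← Real.exp_add, ← Real.exp_add]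
        _ ≤ Real.exp 0 := by
            refine Real.exp_le_exp.2 ?_
            have h5 : K ≤ K ^ 4 := le_self_pow₀ (by linarith) (by norm_num)
            have h6 : 0 < K ^ 4 := by positivity
            have h7 : K ^ 6 = K ^ 2 * K ^ 4 := by ring
            have h8 : 10 ^ 10 ≤ K ^ 2 := by nlinarith
            rw [h7]
            nlinarith
        _ = 1 := Real.exp_zero
    have hE := Real.exp_pos (4100 * K ^ 4)
    calc (B.card : ℝ) * Real.exp (4100 * K ^ 4)
        ≤ (q : ℝ) ^ 2 * (36 * K ^ 6144 * Real.exp (-(K ^ 6 / 2))) * Fintype.card Ω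
          * Real.exp (4100 * K ^ 4) := by gcongr
      _ = ((q : ℝ) ^ 2 * (36 * K ^ 6144 * Real.exp (-(K ^ 6 / 2))) * Real.exp (4100 * K ^ 4))
          * Fintype.card Ω := by ring
      _ ≤ 1 * Fintype.card Ω := by gcongr
      _ = _ := one_mul _
  linarith

end MainEstimate

/-! ### Binary digits and dyadic intervals. -/

section Digits

variable {m : ℕ}

/-- The change of the digit number `c`. -/
def flip (m c : ℕ) : Equiv.Perm (Fin m → Bool) :=
  Function.Involutive.toPerm (fun x i => if (i : ℕ) = c then !x i else x i) fun x => by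
    funext i
    by_cases h : (i : ℕ) = c <;> simp [h]

theorem flip_apply (c : ℕ) (x : Fin m → Bool) (i : Fin m) :
    flip m c x i = if (i : ℕ) = c then !x i else x i := rfl

/-- The sign of the digit number `c`. -/
def rad (c : ℕ) (x : Fin m → Bool) : ℝ :=
  if h : c < m then (if x ⟨c, h⟩ then 1 else -1) else 0

theorem rad_flip_self (c : ℕ) (x : Fin m → Bool) : rad c (flip m c x) = -rad c x := by
  unfold rad
  split_ifs with h <;> simp_all [flip_apply]

theorem rad_flip_of_ne {c k : ℕ} (hk : c ≠ k) (x : Fin m → Bool) :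
    rad c (flip m k x) = rad c x := by
  unfold rad
  split_ifs with h <;> simp_all [flip_apply]

theorem abs_rad_le (c : ℕ) (x : Fin m → Bool) : |rad c x| ≤ 1 := by
  unfold rad
  split_ifs <;> simp

theorem rad_mul_self {c : ℕ} (hc : c < m) (x : Fin m → Bool) : rad c x * rad c x = 1 := by
  unfold rad
  rw [dif_pos hc]
  split_ifs <;> simp

/-- The lower end of the dyadic interval given by the first `r` digits. -/
noncomputable def lo (r : ℕ) (x : Fin m → Bool) : ℝ :=
  ∑ i : Fin m, if (i : ℕ) < r ∧ x i then (1 / 2 : ℝ) ^ ((i : ℕ) + 1) else 0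

/-- The upper end of the dyadic interval given by all digits. -/
noncomputable def pos (x : Fin m → Bool) : ℝ := lo m x + (1 / 2) ^ m

theorem lo_flip {r c : ℕ} (h : r ≤ c) (x : Fin m → Bool) : lo r (flip m c x) = lo r x := by
  unfold lo
  refine sum_congr rfl fun i _ => ?_
  by_cases hi : (i : ℕ) < r
  · have : (i : ℕ) ≠ c := by omega
    simp [flip_apply, this]
  · simp [hi]

theorem lo_zero (x : Fin m → Bool) : lo 0 x = 0 := by simp [lo]

theorem lo_succ {r : ℕ} (hr : r < m) (x : Fin m → Bool) :
    lo (r + 1) x = lo r x + (if x ⟨r, hr⟩ then (1 / 2 : ℝ) ^ (r + 1) else 0) := by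
  have h1 : (if x ⟨r, hr⟩ then (1 / 2 : ℝ) ^ (r + 1) else 0)
      = ∑ i : Fin m, if (i : ℕ) = r ∧ x i then (1 / 2 : ℝ) ^ ((i : ℕ) + 1) else 0 := by
    rw [sum_eq_single_of_mem ⟨r, hr⟩ (mem_univ _)]
    · simp
    · intro i _ hi
      have : (i : ℕ) ≠ r := fun h => hi (Fin.ext h)
      simp [this]
  rw [h1]
  unfold lo
  rw [← sum_add_distrib]
  refine sum_congr rfl fun i _ => ?_
  rcases lt_trichotomy (i : ℕ) r with h | h | h
  · simp [h, h.ne, h.trans (Nat.lt_succ_self r)]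
  · simp [h]
  · simp [h.ne', not_lt.2 h.le, not_lt.2 (Nat.succ_le_of_lt h)]

theorem pos_le {r : ℕ} (hr : r ≤ m) (x : Fin m → Bool) : pos x ≤ lo r x + (1 / 2) ^ r := by
  unfold pos
  induction hr using Nat.decreasingInduction with
  | self => rfl
  | of_succ r hr ih =>
    refine ih.trans ?_
    rw [lo_succ hr, pow_succ]
    have : (0 : ℝ) < (1 / 2) ^ r := by positivity
    split_ifs <;> linarith

theorem lo_le {r : ℕ} (hr : r ≤ m) (x : Fin m → Bool) : lo r x ≤ lo m x := by
  induction hr using Nat.decreasingInduction with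
  | self => rfl
  | of_succ r hr ih =>
    refine le_trans ?_ ih
    rw [lo_succ hr]
    split_ifs
    · have : (0 : ℝ) < (1 / 2) ^ (r + 1) := by positivity
      linarith
    · simp

theorem lo_lt_pos {r : ℕ} (hr : r ≤ m) (x : Fin m → Bool) : lo r x < pos x := by
  have : (0 : ℝ) < (1 / 2) ^ m := by positivity
  unfold pos
  linarith [lo_le hr x]

theorem pos_pos (x : Fin m → Bool) : 0 < pos x := by
  have := lo_lt_pos (Nat.zero_le m) x
  rwa [lo_zero] at this

theorem pos_le_one (x : Fin m → Bool) : pos x ≤ 1 := by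
  have := pos_le (Nat.zero_le m) x
  simpa [lo_zero] using this

theorem pos_sub_pos_flip {c : ℕ} (hc : c < m) (x : Fin m → Bool) :
    pos x - pos (flip m c x) = rad c x * (1 / 2) ^ (c + 1) := by
  unfold pos lo
  rw [add_sub_add_right_eq_sub, ← sum_sub_distrib, sum_eq_single_of_mem ⟨c, hc⟩ (mem_univ _)]
  · simp only [flip_apply, rad, hc, dif_pos, if_true, true_and]
    cases x ⟨c, hc⟩ <;> simp
  · intro i _ hi
    have : (i : ℕ) ≠ c := fun h => hi (Fin.ext h)
    simp [flip_apply, this]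

/-- The indicator function of `p < pos x`. -/
noncomputable def step (p : ℝ) (x : Fin m → Bool) : ℝ := if p < pos x then 1 else 0

/-- The dyadic interval given by the first `r` digits contains `p`. -/
def Hit (r : ℕ) (p : ℝ) (x : Fin m → Bool) : Prop := lo r x ≤ p ∧ p < lo r x + (1 / 2) ^ r

/-- The odd part of a function with respect to a flip. -/
noncomputable def oddPart (c : ℕ) (u : (Fin m → Bool) → ℝ) (x : Fin m → Bool) : ℝ :=
  (u x - u (flip m c x)) / 2

theorem hit_flip {r c : ℕ} (h : r ≤ c) (p : ℝ) (x : Fin m → Bool) :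
    Hit r p (flip m c x) ↔ Hit r p x := by
  unfold Hit
  rw [lo_flip h]

open Classical in
-- The step changes under the flip only if `p` separates two points of the same dyadic interval.
theorem abs_oddPart_step_le {r : ℕ} (hr : r ≤ m) (p : ℝ) (x : Fin m → Bool) :
    |oddPart r (step p) x| ≤ if Hit r p x then 1 / 2 else 0 := by
  have h1 := pos_le hr x
  have h2 := pos_le hr (flip m r x)
  have h3 := lo_lt_pos hr x
  have h4 := lo_lt_pos hr (flip m r x)
  rw [lo_flip le_rfl] at h2 h4
  unfold oddPart step
  by_cases h5 : p < pos x <;> by_cases h6 : p < pos (flip m r x)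
  · simp [h5, h6]; split_ifs <;> norm_num
  · rw [if_pos (show Hit r p x from ⟨by linarith, by linarith⟩)]
    simp [h5, h6]
  · rw [if_pos (show Hit r p x from ⟨by linarith, by linarith⟩)]
    simp [h5, h6, abs_div]
  · simp [h5, h6]; split_ifs <;> norm_num

theorem oddPart_pos {c : ℕ} (hc : c < m) (x : Fin m → Bool) :
    oddPart c pos x = rad c x * (1 / 2) ^ (c + 2) := by
  unfold oddPart
  rw [pos_sub_pos_flip hc]
  ring

open Classical in
-- The two halves of an interval cannot both contain `p`. Only an inequality holds, since `p` may
-- lie outside `[0, 1)`.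
theorem sum_hit_le {r : ℕ} (hr : r ≤ m) (p : ℝ) :
    ∑ x : Fin m → Bool, (if Hit r p x then (1 : ℝ) else 0) ≤ 2 ^ m * (1 / 2) ^ r := by
  induction r with
  | zero =>
    refine (sum_le_sum fun x _ => (show _ ≤ (1 : ℝ) by split_ifs <;> norm_num)).trans ?_
    simp
  | succ r ih =>
    have hrm : r < m := hr
    have h1 : ∀ x : Fin m → Bool, (if Hit (r + 1) p x then (1 : ℝ) else 0)
        + (if Hit (r + 1) p (flip m r x) then (1 : ℝ) else 0) ≤ if Hit r p x then 1 else 0 := by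
      intro x
      have e1 := lo_succ hrm x
      have e2 := lo_succ hrm (flip m r x)
      rw [lo_flip le_rfl] at e2
      have e3 : flip m r x ⟨r, hrm⟩ = !x ⟨r, hrm⟩ := by simp [flip_apply]
      rw [e3] at e2
      have e4 : (1 / 2 : ℝ) ^ (r + 1) = (1 / 2) ^ r / 2 := by ring
      have e5 : (0 : ℝ) < (1 / 2) ^ r := by positivity
      unfold Hit
      rw [e1, e2, e4]
      cases x ⟨r, hrm⟩ <;> simp only [Bool.not_true, Bool.not_false, if_true, Bool.false_eq_true,
        if_false, add_zero] <;> split_ifs <;> first | (exfalso; linarith [‹_ ∧ _›.1]) | grind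
    have h2 := sum_le_sum fun x (_ : x ∈ univ) => h1 x
    rw [sum_add_distrib, Equiv.sum_comp (flip m r)
      (fun x => if Hit (r + 1) p x then (1 : ℝ) else 0)] at h2
    have h3 := ih hrm.le
    rw [pow_succ]
    linarith

end Digits

/-! ### Geometric decay on the index grid. -/

section Decay

theorem sum_pow_natDist_le {θ : ℝ} (h0 : 0 ≤ θ) (h1 : θ < 1) (m x : ℕ) :
    ∑ y : Fin m, θ ^ ((x - y) + (y - x)) ≤ 2 / (1 - θ) := by
  have h2 : ∀ s : Finset ℕ, ∑ i ∈ s, θ ^ i ≤ 1 / (1 - θ) := by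
    intro s
    rw [one_div, ← tsum_geometric_of_lt_one h0 h1]
    exact (summable_geometric_of_lt_one h0 h1).sum_le_tsum s fun i _ => pow_nonneg h0 i
  rw [Fin.sum_univ_eq_sum_range (fun y => θ ^ ((x - y) + (y - x))),
    ← sum_filter_add_sum_filter_not _ (fun y => y ≤ x)]
  have h3 : ∑ y ∈ range m with y ≤ x, θ ^ ((x - y) + (y - x)) ≤ 1 / (1 - θ) := by
    have : ∑ y ∈ range m with y ≤ x, θ ^ ((x - y) + (y - x))
        = ∑ i ∈ ((range m).filter (· ≤ x)).image (fun y => x - y), θ ^ i := by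
      rw [sum_image]
      · refine sum_congr rfl fun y hy => ?_
        rw [Nat.sub_eq_zero_of_le (mem_filter.1 hy).2, add_zero]
      · intro y hy z hz hyz
        have := (mem_filter.1 hy).2
        have := (mem_filter.1 hz).2
        simp only at hyz
        omega
    rw [this]
    exact h2 _
  have h4 : ∑ y ∈ range m with ¬ y ≤ x, θ ^ ((x - y) + (y - x)) ≤ 1 / (1 - θ) := by
    have : ∑ y ∈ range m with ¬ y ≤ x, θ ^ ((x - y) + (y - x))
        = ∑ i ∈ ((range m).filter (¬ · ≤ x)).image (fun y => y - x), θ ^ i := by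
      rw [sum_image]
      · refine sum_congr rfl fun y hy => ?_
        rw [Nat.sub_eq_zero_of_le (not_le.1 (mem_filter.1 hy).2).le, zero_add]
      · intro y hy z hz hyz
        have := (mem_filter.1 hy).2
        have := (mem_filter.1 hz).2
        simp only at hyz
        omega
    rw [this]
    exact h2 _
  calc _ ≤ 1 / (1 - θ) + 1 / (1 - θ) := add_le_add h3 h4
    _ = _ := by ring

/-- Bernoulli's inequality. It permits a factor `1 / 2` to be shared among `q` factors, each keeping
some decay. -/
theorem half_le_pow_decay {q : ℕ} (hq : 0 < q) : (1 / 2 : ℝ) ≤ (1 - 1 / (4 * q)) ^ (2 * q) := by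
  have hq' : (1 : ℝ) ≤ q := by exact_mod_cast hq
  have h1 : (1 : ℝ) / (4 * q) ≤ 1 := by rw [div_le_one (by positivity)]; linarith
  have h2 := one_add_mul_le_pow (show (-2 : ℝ) ≤ -(1 / (4 * q)) by linarith) (2 * q)
  have h3 : 1 + ((2 * q : ℕ) : ℝ) * -(1 / (4 * q)) = 1 / 2 := by
    push_cast; field_simp; norm_num
  rw [h3] at h2
  simpa [sub_eq_add_neg] using h2

/-- The `ℓ¹` distance of two pairs of indices. -/
def gridDist {m : ℕ} (p p' : Fin m × Fin m) : ℕ :=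
  ((p.1 - p'.1 : ℕ) + (p'.1 - p.1 : ℕ)) + ((p.2 - p'.2 : ℕ) + (p'.2 - p.2 : ℕ))

theorem sum_pow_gridDist_le {q : ℕ} (hq : 0 < q) {m : ℕ} (p : Fin m × Fin m) :
    ∑ p', (1 - 1 / (4 * q) : ℝ) ^ gridDist p p' ≤ 64 * (q : ℝ) ^ 2 := by
  have hq' : (1 : ℝ) ≤ q := by exact_mod_cast hq
  have h1 : (1 : ℝ) / (4 * q) ≤ 1 := by rw [div_le_one (by positivity)]; linarith
  have h2 : (0 : ℝ) < 1 / (4 * q) := by positivity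
  have h3 := fun x => sum_pow_natDist_le (θ := 1 - 1 / (4 * q)) (by linarith) (by linarith) m x
  have h4 : (2 : ℝ) / (1 - (1 - 1 / (4 * q))) = 8 * q := by field_simp; norm_num
  rw [h4] at h3
  simp only [gridDist, pow_add _ ((p.1 - _ : ℕ) + _)]
  rw [Fintype.sum_prod_type]
  simp only [← mul_sum, ← sum_mul]
  calc _ ≤ (8 * (q : ℝ)) * (8 * q) := by
        refine mul_le_mul (h3 p.1) (h3 p.2) (sum_nonneg fun _ _ => ?_) (by positivity)
        exact pow_nonneg (by linarith) _
    _ = _ := by ring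

end Decay

/-! ### Summing the majorants of all choices through a given pair. -/

section Choice

variable {q m : ℕ}

/-- The choice of `p` at `t` and of nothing elsewhere. -/
def oneChoice (t : Fin q) (p : Fin m × Fin m) : Fin q → Option (Fin m × Fin m) :=
  Function.update (fun _ => none) t (some p)

/-- The majorant of a choice `x` at `t`, given the choice `p` at `t₀`. -/
noncomputable def majorant (ρ : ℝ) (t₀ : Fin q) (p : Fin m × Fin m) (t : Fin q)
    (x : Option (Fin m × Fin m)) : ℝ :=
  if t = t₀ then (if x = some p then ρ else 0) else
    x.elim 1 fun p' => ρ * (1 - 1 / (4 * q)) ^ gridDist p p'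

theorem one_sub_inv_nonneg (q : ℕ) : (0 : ℝ) ≤ 1 - 1 / (4 * q) := by
  rcases Nat.eq_zero_or_pos q with rfl | hq
  · simp
  · have hq' : (1 : ℝ) ≤ q := by exact_mod_cast hq
    rw [sub_nonneg, div_le_one (by positivity)]; linarith

theorem majorant_nonneg {ρ : ℝ} (hρ : 0 ≤ ρ) (t₀ : Fin q) (p : Fin m × Fin m) (t : Fin q)
    (x : Option (Fin m × Fin m)) : 0 ≤ majorant ρ t₀ p t x := by
  unfold majorant
  have := one_sub_inv_nonneg q
  split_ifs
  · exact hρ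
  · exact le_rfl
  · cases x <;> simp only [Option.elim] <;> positivity

theorem prod_majorant_oneChoice (ρ : ℝ) (t₀ : Fin q) (p : Fin m × Fin m) :
    ∏ t, majorant ρ t₀ p t (oneChoice t₀ p t) = ρ := by
  rw [Fintype.prod_eq_single t₀]
  · simp [majorant, oneChoice]
  · intro t ht
    simp [majorant, oneChoice, ht]

/-- The sum factors over `t`: `t₀` gives exactly `ρ`, every other `t` at most `1 + 64 ρ q²`. The
excess over `ρ` bounds all choices with further pairs. -/
theorem sum_prod_majorant_le {ρ : ℝ} (hρ : 0 ≤ ρ) (hρq : 64 * ρ * q ^ 3 ≤ 1) (t₀ : Fin q)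
    (p : Fin m × Fin m) :
    ∑ g : Fin q → Option (Fin m × Fin m), ∏ t, majorant ρ t₀ p t (g t)
      ≤ ρ * (1 + 128 * ρ * q ^ 3) := by
  have hq : 0 < q := t₀.pos
  have h := Finset.prod_univ_sum (fun _ : Fin q => (univ : Finset (Option (Fin m × Fin m))))
    (majorant ρ t₀ p)
  rw [Fintype.piFinset_univ] at h
  rw [← h]
  have h1 : ∀ t, t ≠ t₀ → ∑ x, majorant ρ t₀ p t x ≤ 1 + 64 * ρ * q ^ 2 := by
    intro t ht
    rw [Fintype.sum_option]
    simp only [majorant, ht, if_false, Option.elim]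
    rw [← mul_sum]
    have := mul_le_mul_of_nonneg_left (sum_pow_gridDist_le hq p) hρ
    linarith
  have h2 : ∑ x, majorant ρ t₀ p t₀ x = ρ := by
    simp [majorant]
  rw [← mul_prod_erase univ _ (mem_univ t₀), h2]
  refine mul_le_mul_of_nonneg_left ?_ hρ
  calc ∏ t ∈ univ.erase t₀, ∑ x, majorant ρ t₀ p t x
      ≤ ∏ _t ∈ univ.erase t₀, (1 + 64 * ρ * q ^ 2) := by
        refine prod_le_prod (fun t _ => sum_nonneg fun x _ => majorant_nonneg hρ _ _ _ _)
          fun t ht => h1 t (ne_of_mem_erase ht)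
    _ = (1 + 64 * ρ * q ^ 2) ^ (q - 1) := by simp
    _ ≤ (1 + 64 * ρ * q ^ 2) ^ q := by
        refine pow_le_pow_right₀ ?_ (Nat.sub_le _ _)
        have : 0 ≤ 64 * ρ * q ^ 2 := by positivity
        linarith
    _ ≤ Real.exp (64 * ρ * q ^ 2) ^ q := by
        gcongr
        linarith [Real.add_one_le_exp (64 * ρ * q ^ 2)]
    _ = Real.exp (64 * ρ * q ^ 3) := by rw [← Real.exp_nat_mul]; congr 1; ring
    _ ≤ 1 + 128 * ρ * q ^ 3 := by
        have h0 : 0 ≤ 64 * ρ * (q : ℝ) ^ 3 := by positivity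
        have := Real.abs_exp_sub_one_le (x := 64 * ρ * (q : ℝ) ^ 3) (by rwa [abs_of_nonneg h0])
        rw [abs_of_nonneg h0] at this
        linarith [le_abs_self (Real.exp (64 * ρ * (q : ℝ) ^ 3) - 1)]

end Choice

/-! ### Pairing the strongly distinct part with the discrepancy. -/

section Pairing

set_option linter.unusedSectionVars false

variable {Ω : Type*} [Fintype Ω] {n : ℕ} {φ₁ φ₂ φ₃ : ℕ → Equiv.Perm Ω}
  {f : ℕ → ℕ → ℕ → Ω → ℝ}

/-- A function `d` whose product with every function odd under three flips is small, and whose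
product with every member of the family `f` is large. -/
structure PairsWith (n : ℕ) (φ₁ φ₂ φ₃ : ℕ → Equiv.Perm Ω) (f : ℕ → ℕ → ℕ → Ω → ℝ)
    (E : ℝ) (d : Ω → ℝ) : Prop where
  nonneg : 0 ≤ E
  small : ∀ (F : Ω → ℝ) (C : ℝ) (s₁ s₂ s₃ : ℕ), s₁ ≤ n → s₂ ≤ n → s₃ ≤ n → (∀ ω, |F ω| ≤ C) →
    (∀ ω, F (φ₁ s₁ ω) = -F ω) → (∀ ω, F (φ₂ s₂ ω) = -F ω) → (∀ ω, F (φ₃ s₃ ω) = -F ω) →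
    |∑ ω, F ω * d ω| ≤ C * (E * (1 / 2) ^ (s₁ + s₂ + s₃))
  large : ∀ a b c, a + b + c = n → E * (1 / 2) ^ (n + 7) ≤ ∑ ω, f a b c ω * d ω

theorem prod_neg_of_one {T : Type*} [Fintype T] [DecidableEq T] {u v : T → ℝ} (t : T)
    (ht : u t = -v t) (h : ∀ s, s ≠ t → u s = v s) : ∏ s, u s = -∏ s, v s := by
  rw [← mul_prod_erase univ u (mem_univ t), ← mul_prod_erase univ v (mem_univ t), ht, neg_mul]
  congr 2
  exact prod_congr rfl fun s hs => h s (ne_of_mem_erase hs)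

/-- The pair `p` belongs to the block `t`. -/
def InBlock (n l : ℕ) {q : ℕ} (t : Fin q) (p : Fin (n + 1) × Fin (n + 1)) : Prop :=
  (p.1 : ℕ) + p.2 ≤ n ∧ (n - p.1 - p.2) / l = (t : ℕ)

/-- The product attached to a choice. -/
def choiceProd (n : ℕ) (f : ℕ → ℕ → ℕ → Ω → ℝ) (l : ℕ) (ρ : ℝ) {q : ℕ}
    (g : Fin q → Option (Fin (n + 1) × Fin (n + 1))) (ω : Ω) : ℝ :=
  ∏ t, choiceWeight (blockMatrix n f l ρ ω) t (g t)

variable {l q : ℕ} {ρ : ℝ} {g : Fin q → Option (Fin (n + 1) × Fin (n + 1))}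

/-- If the two indices exceed `n` in sum, truncated subtraction makes the first index `0`, and the
family vanishes off `a + b + c = n`. -/
theorem HaarFamily.choiceProd_eq_zero (h : HaarFamily n φ₁ φ₂ φ₃ f) {t : Fin q}
    {p : Fin (n + 1) × Fin (n + 1)} (hg : g t = some p) (hp : ¬ InBlock n l t p) (ω : Ω) :
    choiceProd n f l ρ g ω = 0 := by
  refine prod_eq_zero (mem_univ t) ?_
  rw [hg]
  simp only [choiceWeight, blockMatrix]
  unfold InBlock at hp
  split_ifs with h1
  · rw [h.supp _ _ _ (by omega), mul_zero]
  · rw [mul_zero]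

theorem HaarFamily.abs_choiceProd_le (h : HaarFamily n φ₁ φ₂ φ₃ f) (hρ : 0 ≤ ρ) (l : ℕ) (ω : Ω)
    (g : Fin q → Option (Fin (n + 1) × Fin (n + 1))) :
    |choiceProd n f l ρ g ω| ≤ ∏ t, (g t).elim 1 fun _ => ρ := by
  unfold choiceProd
  rw [abs_prod]
  refine prod_le_prod (fun _ _ => abs_nonneg _) fun t _ => ?_
  cases g t with
  | none => simp [choiceWeight]
  | some p => exact abs_blockMatrix_le h l hρ ω t p.1 p.2

theorem choiceWeight_blockMatrix (l : ℕ) (ρ : ℝ) (t : Fin q) (x : Option (Fin (n + 1) × Fin (n + 1)))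
    {ω ω' : Ω} (hx : ∀ p, x = some p → f (n - p.1 - p.2) p.1 p.2 ω' = f (n - p.1 - p.2) p.1 p.2 ω) :
    choiceWeight (blockMatrix n f l ρ ω') t x = choiceWeight (blockMatrix n f l ρ ω) t x := by
  cases x with
  | none => rfl
  | some p => simp only [choiceWeight, blockMatrix, hx p rfl]

theorem choiceWeight_blockMatrix_neg (l : ℕ) (ρ : ℝ) (t : Fin q) (p : Fin (n + 1) × Fin (n + 1))
    {ω ω' : Ω} (hx : f (n - p.1 - p.2) p.1 p.2 ω' = -f (n - p.1 - p.2) p.1 p.2 ω) :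
    choiceWeight (blockMatrix n f l ρ ω') t (some p)
      = -choiceWeight (blockMatrix n f l ρ ω) t (some p) := by
  simp only [choiceWeight, blockMatrix, hx]
  split_ifs <;> simp

/-- Some chosen pair has the strictly largest value of a coordinate, if the values at different
chosen pairs are different. -/
theorem exists_strict_max (κ : Fin (n + 1) × Fin (n + 1) → ℕ) {t₀ : Fin q} (ht₀ : g t₀ ≠ none)
    (hκ : ∀ t t' p p', t ≠ t' → g t = some p → g t' = some p' → κ p ≠ κ p') :
    ∃ t p, g t = some p ∧ ∀ t', t' ≠ t → ∀ p', g t' = some p' → κ p' < κ p := by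
  classical
  obtain ⟨t, ht, hmax⟩ := exists_max_image (univ.filter fun t => g t ≠ none)
    (fun t => (g t).elim 0 κ) ⟨t₀, by simp [ht₀]⟩
  obtain ⟨p, hp⟩ := Option.ne_none_iff_exists'.1 (mem_filter.1 ht).2
  refine ⟨t, p, hp, fun t' htt p' hp' => lt_of_le_of_ne ?_ (hκ t' t p' p htt hp' hp)⟩
  simpa [hp, hp'] using hmax t' (by simp [hp'])

/-- Distinctness makes the maximum of each index strict, so the product is odd under the three flips
at these maxima and `small` applies. The sum of the maxima exceeds `n` by some `j`, and the gain
`2^(-j)` is converted into decay in the distances from `p₀`. -/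
theorem HaarFamily.abs_sum_choiceProd_le (h : HaarFamily n φ₁ φ₂ φ₃ f) {E : ℝ} {d : Ω → ℝ}
    (hd : PairsWith n φ₁ φ₂ φ₃ f E d) (hρ : 0 ≤ ρ) (hg : StronglyDistinct g)
    (hB : ∀ t p, g t = some p → InBlock n l t p) {t₀ : Fin q} {p₀ : Fin (n + 1) × Fin (n + 1)}
    (h₀ : g t₀ = some p₀) :
    |∑ ω, choiceProd n f l ρ g ω * d ω| ≤ E * (1 / 2) ^ n * ∏ t, majorant ρ t₀ p₀ t (g t) := by
  have hq : 0 < q := t₀.pos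
  have hne : g t₀ ≠ none := by simp [h₀]
  obtain ⟨t₁, p₁, hp₁, hm₁⟩ := exists_strict_max (g := g) (fun p => n - p.1 - p.2) hne (by
    intro t t' p p' htt hp hp' heq
    apply htt
    have e1 := (hB t p hp).2
    have e2 := (hB t' p' hp').2
    rw [heq] at e1
    exact Fin.ext (e1.symm.trans e2))
  obtain ⟨t₂, p₂, hp₂, hm₂⟩ := exists_strict_max (g := g) (fun p => (p.1 : ℕ)) hne (by
    intro t t' p p' htt hp hp' heq
    refine htt (hg.1 ?_)
    simp only [hp, hp', rowKey]
    rw [Fin.ext heq])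
  obtain ⟨t₃, p₃, hp₃, hm₃⟩ := exists_strict_max (g := g) (fun p => (p.2 : ℕ)) hne (by
    intro t t' p p' htt hp hp' heq
    refine htt (hg.2 ?_)
    simp only [hp, hp', colKey]
    rw [Fin.ext heq])
  have key := hd.small (choiceProd n f l ρ g) (∏ t, (g t).elim 1 fun _ => ρ)
    (n - p₁.1 - p₁.2) p₂.1 p₃.2 (by omega) (by omega) (by omega)
    (fun ω => h.abs_choiceProd_le hρ l ω g)
    (fun ω => prod_neg_of_one t₁
      (by rw [hp₁]; exact choiceWeight_blockMatrix_neg l ρ t₁ p₁ (h.odd₁ _ _ _ _))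
      fun t ht => choiceWeight_blockMatrix l ρ t _ fun p hp =>
        h.inv₁ _ _ _ _ (hm₁ t ht p hp) _)
    (fun ω => prod_neg_of_one t₂
      (by rw [hp₂]; exact choiceWeight_blockMatrix_neg l ρ t₂ p₂ (h.odd₂ _ _ _ _))
      fun t ht => choiceWeight_blockMatrix l ρ t _ fun p hp =>
        h.inv₂ _ _ _ _ (hm₂ t ht p hp) _)
    (fun ω => prod_neg_of_one t₃
      (by rw [hp₃]; exact choiceWeight_blockMatrix_neg l ρ t₃ p₃ (h.odd₃ _ _ _ _))
      fun t ht => choiceWeight_blockMatrix l ρ t _ fun p hp =>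
        h.inv₃ _ _ _ _ (hm₃ t ht p hp) _)
  refine key.trans ?_
  have hle₁ : ∀ t p, g t = some p → n - p.1 - p.2 ≤ n - (p₁.1 : ℕ) - p₁.2 := by
    intro t p hp
    by_cases ht : t = t₁
    · subst ht; rw [hp₁] at hp; cases hp; exact le_rfl
    · exact (hm₁ t ht p hp).le
  have hle₂ : ∀ t p, g t = some p → (p.1 : ℕ) ≤ p₂.1 := by
    intro t p hp
    by_cases ht : t = t₂
    · subst ht; rw [hp₂] at hp; cases hp; exact le_rfl
    · exact (hm₂ t ht p hp).le
  have hle₃ : ∀ t p, g t = some p → (p.2 : ℕ) ≤ p₃.2 := by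
    intro t p hp
    by_cases ht : t = t₃
    · subst ht; rw [hp₃] at hp; cases hp; exact le_rfl
    · exact (hm₃ t ht p hp).le
  have hs : ∀ t p, g t = some p → (p.1 : ℕ) + p.2 ≤ n := fun t p hp => (hB t p hp).1
  obtain ⟨j, hj⟩ : ∃ j, (n - (p₁.1 : ℕ) - p₁.2) + p₂.1 + p₃.2 = n + j := by
    refine ⟨(n - (p₁.1 : ℕ) - p₁.2) + p₂.1 + p₃.2 - n, ?_⟩
    have := hle₁ t₀ p₀ h₀
    have := hle₂ t₀ p₀ h₀
    have := hle₃ t₀ p₀ h₀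
    have := hs t₀ p₀ h₀
    omega
  rw [hj, pow_add]
  set θ : ℝ := 1 - 1 / (4 * q) with hθ
  have hθ0 : 0 ≤ θ := one_sub_inv_nonneg q
  have hθ1 : θ ≤ 1 := by
    have : (0 : ℝ) ≤ 1 / (4 * q) := by positivity
    linarith
  -- Each chosen triple falls short of the three maxima by `j` in total, so two of them are at
  -- distance at most `2 j`.
  have hdist : ∀ t p, g t = some p → gridDist p₀ p ≤ 2 * j := by
    intro t p hp
    have := hle₁ t₀ p₀ h₀
    have := hle₂ t₀ p₀ h₀
    have := hle₃ t₀ p₀ h₀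
    have := hs t₀ p₀ h₀
    have := hle₁ t p hp
    have := hle₂ t p hp
    have := hle₃ t p hp
    have := hs t p hp
    unfold gridDist
    omega
  have hmaj : (∏ t, (g t).elim 1 fun _ => ρ) * ∏ _t : Fin q, θ ^ (2 * j)
      ≤ ∏ t, majorant ρ t₀ p₀ t (g t) := by
    rw [← prod_mul_distrib]
    refine prod_le_prod (fun t _ => ?_) fun t _ => ?_
    · cases g t <;> simp only [Option.elim] <;> positivity
    · have hp1 : θ ^ (2 * j) ≤ 1 := pow_le_one₀ hθ0 hθ1
      unfold majorant
      split_ifs with h1 h2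
      · rw [h2]; exact mul_le_of_le_one_right hρ hp1
      · subst h1; exact absurd h₀ h2
      · cases hgt : g t with
        | none => simpa [hgt] using hp1
        | some p =>
          simp only [Option.elim]
          exact mul_le_mul_of_nonneg_left (pow_le_pow_of_le_one hθ0 hθ1 (hdist t p hgt)) hρ
  have hhalf : (1 / 2 : ℝ) ^ j ≤ ∏ _t : Fin q, θ ^ (2 * j) := by
    rw [prod_const, card_univ, Fintype.card_fin, ← pow_mul, show 2 * j * q = 2 * q * j by ring,
      pow_mul]
    exact pow_le_pow_left₀ (by norm_num) (half_le_pow_decay hq) j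
  have hP : 0 ≤ ∏ t, (g t).elim 1 fun _ => ρ :=
    prod_nonneg fun t _ => by cases g t <;> simp only [Option.elim] <;> positivity
  have hE := hd.nonneg
  calc (∏ t, (g t).elim 1 fun _ => ρ) * (E * ((1 / 2) ^ n * (1 / 2) ^ j))
      = E * (1 / 2) ^ n * ((∏ t, (g t).elim 1 fun _ => ρ) * (1 / 2) ^ j) := by ring
    _ ≤ E * (1 / 2) ^ n * ((∏ t, (g t).elim 1 fun _ => ρ) * ∏ _t : Fin q, θ ^ (2 * j)) := by
        gcongr
    _ ≤ _ := by gcongr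

theorem stronglyDistinct_oneChoice (t : Fin q) (p : Fin (n + 1) × Fin (n + 1)) :
    StronglyDistinct (oneChoice t p) := by
  constructor
  all_goals
    intro s s' hss
    by_contra hne
    by_cases h1 : s = t <;> by_cases h2 : s' = t <;>
      simp_all [oneChoice, rowKey, colKey, Function.update]

theorem PairsWith.le_sum_choiceProd_oneChoice {E : ℝ} {d : Ω → ℝ}
    (hd : PairsWith n φ₁ φ₂ φ₃ f E d) (hρ : 0 ≤ ρ) {t : Fin q} {p : Fin (n + 1) × Fin (n + 1)}
    (hp : InBlock n l t p) :
    ρ * (E * (1 / 2) ^ (n + 7)) ≤ ∑ ω, choiceProd n f l ρ (oneChoice t p) ω * d ω := by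
  have h1 : ∀ ω, choiceProd n f l ρ (oneChoice t p) ω = ρ * f (n - p.1 - p.2) p.1 p.2 ω := by
    intro ω
    unfold choiceProd
    rw [Fintype.prod_eq_single t]
    · simp [oneChoice, choiceWeight, blockMatrix, hp.2]
    · intro s hs
      simp [oneChoice, hs, choiceWeight]
  simp_rw [h1, mul_assoc]
  rw [← mul_sum]
  exact mul_le_mul_of_nonneg_left (hd.large _ _ _ (by have := hp.1; omega)) hρ

open Classical in
-- The empty choice gives `∑ d`, and each single choice gives at least `2^(-7)` in units of `E ρ
-- 2^(-n)`. Every larger choice is charged to one of its members; through a fixed member these cost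
-- at most `128 ρ q³ ≤ 2^(-8)` in the same units.
theorem HaarFamily.le_sum_mul_distinctSum (h : HaarFamily n φ₁ φ₂ φ₃ f) {E : ℝ} {d : Ω → ℝ}
    (hd : PairsWith n φ₁ φ₂ φ₃ f E d) (hρ : 0 ≤ ρ) (hρq : 128 * ρ * q ^ 3 ≤ (1 / 2) ^ 8) :
    ∑ ω, d ω + ((univ.filter fun v : Fin q × (Fin (n + 1) × Fin (n + 1)) =>
        InBlock n l v.1 v.2).card : ℝ) * (ρ * (E * (1 / 2) ^ (n + 8)))
      ≤ ∑ ω, distinctSum (blockMatrix n f l ρ (q := q) ω) * d ω := by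
  set V := univ.filter fun v : Fin q × (Fin (n + 1) × Fin (n + 1)) => InBlock n l v.1 v.2 with hV
  have hE := hd.nonneg
  have hexp : ∑ ω, distinctSum (blockMatrix n f l ρ (q := q) ω) * d ω
      = ∑ g : Fin q → Option (Fin (n + 1) × Fin (n + 1)),
        if StronglyDistinct g then ∑ ω, choiceProd n f l ρ g ω * d ω else 0 := by
    simp_rw [distinctSum_eq_sum_choice, sum_mul]
    rw [sum_comm]
    refine sum_congr rfl fun g _ => ?_
    split_ifs
    · rfl
    · simp
  rw [hexp]
  -- For the matching `v` the added majorant cancels the subtracted one. All other summands are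
  -- nonpositive, so one well-chosen `v` suffices for each `g`.
  have hterm : ∀ g : Fin q → Option (Fin (n + 1) × Fin (n + 1)),
      (if g = (fun _ => none) then ∑ ω, d ω else 0)
        + ∑ v ∈ V, (E * (1 / 2) ^ n) * ((if g = oneChoice v.1 v.2 then
          ρ * (1 / 2) ^ 7 + ∏ t, majorant ρ v.1 v.2 t (g t) else 0)
          - ∏ t, majorant ρ v.1 v.2 t (g t))
      ≤ if StronglyDistinct g then ∑ ω, choiceProd n f l ρ g ω * d ω else 0 := by
    intro g
    have hneg : ∀ v : Fin q × (Fin (n + 1) × Fin (n + 1)), g ≠ oneChoice v.1 v.2 → (E * (1 / 2) ^ n) * ((if g = oneChoice v.1 v.2 then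
          ρ * (1 / 2) ^ 7 + ∏ t, majorant ρ v.1 v.2 t (g t) else 0)
          - ∏ t, majorant ρ v.1 v.2 t (g t)) ≤ 0 := by
      intro v hv
      rw [if_neg hv, zero_sub, mul_neg, neg_nonpos]
      exact mul_nonneg (by positivity) (prod_nonneg fun t _ => majorant_nonneg hρ _ _ _ _)
    by_cases hnone : g = fun _ => none
    · have hsd : StronglyDistinct g := by
        subst hnone
        constructor <;> intro s s' hss <;> simpa [rowKey, colKey] using hss
      have hnot : ∀ v : Fin q × (Fin (n + 1) × Fin (n + 1)), g ≠ oneChoice v.1 v.2 := by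
        intro v hv
        have := congrFun (hnone.symm.trans hv) v.1
        simp [oneChoice] at this
      rw [if_pos hnone, if_pos hsd]
      have h1 : ∀ ω, choiceProd n f l ρ g ω = 1 := by
        intro ω
        subst hnone
        simp [choiceProd, choiceWeight]
      simp only [h1, one_mul]
      have := sum_nonpos fun v (_ : v ∈ V) => hneg v (hnot v)
      linarith
    rw [if_neg hnone, zero_add]
    by_cases hone : ∃ v ∈ V, g = oneChoice v.1 v.2
    · obtain ⟨v, hv, rfl⟩ := hone
      rw [if_pos (stronglyDistinct_oneChoice _ _)]
      have hv' : InBlock n l v.1 v.2 := (mem_filter.1 hv).2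
      refine le_trans ?_ (hd.le_sum_choiceProd_oneChoice hρ hv')
      rw [← add_sum_erase V _ hv, if_pos rfl]
      have h2 : ∀ w ∈ V.erase v, oneChoice v.1 v.2 ≠ oneChoice w.1 w.2 := by
        intro w hw heq
        refine ne_of_mem_erase hw ?_
        have h3 := congrFun heq w.1
        by_cases h4 : w.1 = v.1
        · simp only [oneChoice, h4, Function.update_self, Option.some.injEq] at h3
          exact Prod.ext h4 h3.symm
        · simp [oneChoice, h4] at h3
      have := sum_nonpos fun w hw => hneg w (h2 w hw)
      have h5 : (1 / 2 : ℝ) ^ (n + 7) = (1 / 2) ^ n * (1 / 2) ^ 7 := pow_add _ _ _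
      rw [h5]
      linarith
    push Not at hone
    have hall : ∀ v ∈ V, (E * (1 / 2) ^ n) * ((if g = oneChoice v.1 v.2 then
          ρ * (1 / 2) ^ 7 + ∏ t, majorant ρ v.1 v.2 t (g t) else 0)
          - ∏ t, majorant ρ v.1 v.2 t (g t)) ≤ 0 := fun v hv => hneg v (hone v hv)
    split_ifs with hsd
    swap
    · exact sum_nonpos hall
    by_cases hB : ∀ t p, g t = some p → InBlock n l t p
    swap
    · push Not at hB
      obtain ⟨t, p, hp, hnb⟩ := hB
      simp only [h.choiceProd_eq_zero hp hnb, zero_mul, sum_const_zero]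
      exact sum_nonpos hall
    obtain ⟨t₀, p₀, h₀⟩ : ∃ t p, g t = some p := by
      by_contra hcon
      push Not at hcon
      exact hnone (funext fun t => Option.eq_none_iff_forall_ne_some.2 (hcon t))
    have hv : (t₀, p₀) ∈ V := by simp [hV, hB t₀ p₀ h₀]
    refine le_trans ?_ (neg_le_of_abs_le (h.abs_sum_choiceProd_le hd hρ hsd hB h₀))
    rw [← add_sum_erase V _ hv, if_neg (hone _ hv)]
    have := sum_nonpos fun w (hw : w ∈ V.erase (t₀, p₀)) => hall w (mem_of_mem_erase hw)
    linarith
  have hmid : ∑ ω, d ω + (V.card : ℝ) * (ρ * (E * (1 / 2) ^ (n + 8)))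
      ≤ ∑ ω, d ω + ∑ v ∈ V, (E * (1 / 2) ^ n) * (ρ * (1 / 2) ^ 7 + ρ
        - ∑ g : Fin q → Option (Fin (n + 1) × Fin (n + 1)), ∏ t, majorant ρ v.1 v.2 t (g t)) := by
    rw [← nsmul_eq_mul]
    gcongr
    refine card_nsmul_le_sum _ _ _ fun v _ => ?_
    have h1 := sum_prod_majorant_le (m := n + 1) hρ
      (by norm_num at hρq ⊢; linarith [show 0 ≤ ρ * (q : ℝ) ^ 3 by positivity]) v.1 v.2
    have h2 := mul_le_mul_of_nonneg_left hρq hρ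
    have h3 : (1 / 2 : ℝ) ^ (n + 8) = (1 / 2) ^ n * (1 / 2) ^ 8 := pow_add _ _ _
    calc ρ * (E * (1 / 2) ^ (n + 8)) = (E * (1 / 2) ^ n) * (ρ * (1 / 2) ^ 8) := by rw [h3]; ring
      _ ≤ _ := by
        refine mul_le_mul_of_nonneg_left ?_ (by positivity)
        have h4 : (1 / 2 : ℝ) ^ 7 = 2 * (1 / 2) ^ 8 := by norm_num
        rw [h4]
        linarith
  refine (hmid.trans_eq ?_).trans (sum_le_sum fun g _ => hterm g)
  rw [sum_add_distrib, sum_comm]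
  congr 1
  · simp
  · refine sum_congr rfl fun v _ => ?_
    rw [← mul_sum, sum_sub_distrib, sum_ite_eq' univ, if_pos (mem_univ _),
      prod_majorant_oneChoice]

end Pairing

/-! ### Haar functions on empty boxes and the discrepancy in digits. -/

section Cube

variable {m : ℕ}

/-- The digits of the points of the unit cube. -/
abbrev Cube (m : ℕ) : Type := (Fin m → Bool) × (Fin m → Bool) × (Fin m → Bool)

/-- The flip of a digit of the first coordinate. -/
def flip₁ (m c : ℕ) : Equiv.Perm (Cube m) := (flip m c).prodCongr (Equiv.refl _)

/-- The flip of a digit of the second coordinate. -/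
def flip₂ (m c : ℕ) : Equiv.Perm (Cube m) :=
  (Equiv.refl _).prodCongr ((flip m c).prodCongr (Equiv.refl _))

/-- The flip of a digit of the third coordinate. -/
def flip₃ (m c : ℕ) : Equiv.Perm (Cube m) :=
  (Equiv.refl _).prodCongr ((Equiv.refl _).prodCongr (flip m c))

theorem flip₁_apply (c : ℕ) (ω : Cube m) : flip₁ m c ω = (flip m c ω.1, ω.2.1, ω.2.2) := rfl

theorem flip₂_apply (c : ℕ) (ω : Cube m) : flip₂ m c ω = (ω.1, flip m c ω.2.1, ω.2.2) := rfl

theorem flip₃_apply (c : ℕ) (ω : Cube m) : flip₃ m c ω = (ω.1, ω.2.1, flip m c ω.2.2) := rfl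

/-- The dyadic box of shape `(a, b, c)` around `ω` contains `p`. -/
def HitBox (a b c : ℕ) (p : Fin 3 → ℝ) (ω : Cube m) : Prop :=
  Hit a (p 0) ω.1 ∧ Hit b (p 1) ω.2.1 ∧ Hit c (p 2) ω.2.2

open Classical in
/-- The Haar-type functions supported on the dyadic boxes of volume `2⁻ⁿ` without points of `A`. -/
noncomputable def emptyBoxFun (A : Finset (Fin 3 → ℝ)) (n a b c : ℕ) (ω : Cube m) : ℝ :=
  if a + b + c = n ∧ ∀ p ∈ A, ¬ HitBox a b c p ω then
    -(rad a ω.1 * rad b ω.2.1 * rad c ω.2.2) else 0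

theorem abs_rad_mul_le (a b c : ℕ) (ω : Cube m) :
    |rad a ω.1 * rad b ω.2.1 * rad c ω.2.2| ≤ 1 := by
  rw [abs_mul, abs_mul]
  exact mul_le_one₀ (mul_le_one₀ (abs_rad_le _ _) (abs_nonneg _) (abs_rad_le _ _))
    (abs_nonneg _) (abs_rad_le _ _)

theorem emptyBoxFun_congr (A : Finset (Fin 3 → ℝ)) {n a b c : ℕ} {ω ω' : Cube m} (ε : ℝ)
    (h : ∀ p, HitBox a b c p ω' ↔ HitBox a b c p ω)
    (hr : rad a ω'.1 * rad b ω'.2.1 * rad c ω'.2.2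
      = ε * (rad a ω.1 * rad b ω.2.1 * rad c ω.2.2)) :
    emptyBoxFun A n a b c ω' = ε * emptyBoxFun A n a b c ω := by
  have h1 : (a + b + c = n ∧ ∀ p ∈ A, ¬ HitBox a b c p ω')
      ↔ (a + b + c = n ∧ ∀ p ∈ A, ¬ HitBox a b c p ω) := by simp only [h]
  unfold emptyBoxFun
  rw [hr]
  by_cases h2 : a + b + c = n ∧ ∀ p ∈ A, ¬ HitBox a b c p ω
  · rw [if_pos h2, if_pos (h1.2 h2), mul_neg]
  · rw [if_neg h2, if_neg fun h3 => h2 (h1.1 h3), mul_zero]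

theorem haarFamily_emptyBoxFun (A : Finset (Fin 3 → ℝ)) (m n : ℕ) :
    HaarFamily n (flip₁ m) (flip₂ m) (flip₃ m) (emptyBoxFun A n) where
  supp a b c h ω := if_neg fun h' => h h'.1
  bdd a b c ω := by
    unfold emptyBoxFun
    split_ifs
    · rw [abs_neg]; exact abs_rad_mul_le a b c ω
    · simp
  odd₁ a b c ω := by
    rw [emptyBoxFun_congr A (-1) (fun p => ?_) ?_, neg_one_mul]
    · simp only [flip₁_apply, rad_flip_self]; ring
    · simp only [HitBox, flip₁_apply, hit_flip le_rfl]
  odd₂ a b c ω := by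
    rw [emptyBoxFun_congr A (-1) (fun p => ?_) ?_, neg_one_mul]
    · simp only [flip₂_apply, rad_flip_self]; ring
    · simp only [HitBox, flip₂_apply, hit_flip le_rfl]
  odd₃ a b c ω := by
    rw [emptyBoxFun_congr A (-1) (fun p => ?_) ?_, neg_one_mul]
    · simp only [flip₃_apply, rad_flip_self]; ring
    · simp only [HitBox, flip₃_apply, hit_flip le_rfl]
  inv₁ a b c k hk ω := by
    rw [emptyBoxFun_congr A 1 (fun p => ?_) ?_, one_mul]
    · simp only [flip₁_apply, rad_flip_of_ne hk.ne, one_mul]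
    · simp only [HitBox, flip₁_apply, hit_flip hk.le]
  inv₂ a b c k hk ω := by
    rw [emptyBoxFun_congr A 1 (fun p => ?_) ?_, one_mul]
    · simp only [flip₂_apply, rad_flip_of_ne hk.ne, one_mul]
    · simp only [HitBox, flip₂_apply, hit_flip hk.le]
  inv₃ a b c k hk ω := by
    rw [emptyBoxFun_congr A 1 (fun p => ?_) ?_, one_mul]
    · simp only [flip₃_apply, rad_flip_of_ne hk.ne, one_mul]
    · simp only [HitBox, flip₃_apply, hit_flip hk.le]

theorem sum_mul_eq_of_odd {Ω : Type*} [Fintype Ω] (σ : Equiv.Perm Ω) {F : Ω → ℝ}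
    (hF : ∀ ω, F (σ ω) = -F ω) (G : Ω → ℝ) :
    ∑ ω, F ω * G ω = ∑ ω, F ω * ((G ω - G (σ ω)) / 2) := by
  have h := Equiv.sum_comp σ fun ω => F ω * G ω
  simp only [hF, neg_mul, sum_neg_distrib] at h
  have h2 : ∑ ω, F ω * ((G ω - G (σ ω)) / 2)
      = (∑ ω, F ω * G ω - ∑ ω, F ω * G (σ ω)) / 2 := by
    rw [← sum_sub_distrib, sum_div]
    exact sum_congr rfl fun ω _ => by ring
  rw [h2]
  linarith

/-- Against a function odd under all three flips only the odd part of each factor survives. -/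
theorem sum_mul_prod_eq_of_odd {s₁ s₂ s₃ : ℕ} {F : Cube m → ℝ}
    (h₁ : ∀ ω, F (flip₁ m s₁ ω) = -F ω) (h₂ : ∀ ω, F (flip₂ m s₂ ω) = -F ω)
    (h₃ : ∀ ω, F (flip₃ m s₃ ω) = -F ω) (u v w : (Fin m → Bool) → ℝ) :
    ∑ ω, F ω * (u ω.1 * v ω.2.1 * w ω.2.2)
      = ∑ ω, F ω * (oddPart s₁ u ω.1 * oddPart s₂ v ω.2.1 * oddPart s₃ w ω.2.2) := by
  rw [sum_mul_eq_of_odd _ h₁, sum_mul_eq_of_odd _ h₂, sum_mul_eq_of_odd _ h₃]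
  refine sum_congr rfl fun ω _ => ?_
  simp only [flip₁_apply, flip₂_apply, flip₃_apply, oddPart]
  ring

theorem sum_cube_mul (u v w : (Fin m → Bool) → ℝ) :
    ∑ ω : Cube m, u ω.1 * v ω.2.1 * w ω.2.2 = (∑ x, u x) * (∑ x, v x) * ∑ x, w x := by
  rw [Fintype.sum_prod_type]
  simp only [Fintype.sum_prod_type, ← mul_sum, ← sum_mul]

theorem card_cube : (Fintype.card (Cube m) : ℝ) = 2 ^ m * 2 ^ m * 2 ^ m := by
  simp [mul_assoc]

open Classical in
theorem sum_hitBox_le {a b c : ℕ} (ha : a ≤ m) (hb : b ≤ m) (hc : c ≤ m) (p : Fin 3 → ℝ) :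
    ∑ ω : Cube m, (if HitBox a b c p ω then (1 : ℝ) else 0)
      ≤ Fintype.card (Cube m) * (1 / 2) ^ (a + b + c) := by
  have h1 : ∀ ω : Cube m, (if HitBox a b c p ω then (1 : ℝ) else 0)
      = (if Hit a (p 0) ω.1 then 1 else 0) * (if Hit b (p 1) ω.2.1 then 1 else 0)
        * (if Hit c (p 2) ω.2.2 then 1 else 0) := by
    intro ω
    unfold HitBox
    by_cases h1 : Hit a (p 0) ω.1 <;> by_cases h2 : Hit b (p 1) ω.2.1 <;>
      by_cases h3 : Hit c (p 2) ω.2.2 <;> simp [h1, h2, h3]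
  have h0 : ∀ r (p : ℝ), (0 : ℝ) ≤ ∑ x : Fin m → Bool, (if Hit r p x then (1 : ℝ) else 0) :=
    fun r p => sum_nonneg fun x _ => by split_ifs <;> norm_num
  simp only [h1]
  rw [sum_cube_mul (fun x => if Hit a (p 0) x then (1 : ℝ) else 0)
    (fun x => if Hit b (p 1) x then (1 : ℝ) else 0) (fun x => if Hit c (p 2) x then (1 : ℝ) else 0),
    card_cube]
  calc _ ≤ (2 ^ m * (1 / 2) ^ a) * (2 ^ m * (1 / 2) ^ b) * (2 ^ m * (1 / 2) ^ c : ℝ) := by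
        refine mul_le_mul (mul_le_mul (sum_hit_le ha _) (sum_hit_le hb _) (h0 _ _) ?_)
          (sum_hit_le hc _) (h0 _ _) ?_ <;> positivity
    _ = _ := by rw [pow_add, pow_add]; ring

/-- The discrepancy function in terms of digits. -/
noncomputable def digitDiscrepancy (A : Finset (Fin 3 → ℝ)) (ω : Cube m) : ℝ :=
  ∑ p ∈ A, step (p 0) ω.1 * step (p 1) ω.2.1 * step (p 2) ω.2.2
    - A.card * (pos ω.1 * pos ω.2.1 * pos ω.2.2)

open Classical in
theorem abs_oddPart_step_mul_le {a b c : ℕ} (ha : a ≤ m) (hb : b ≤ m) (hc : c ≤ m)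
    (p : Fin 3 → ℝ) (ω : Cube m) :
    |oddPart a (step (p 0)) ω.1 * oddPart b (step (p 1)) ω.2.1 * oddPart c (step (p 2)) ω.2.2|
      ≤ 1 / 8 * if HitBox a b c p ω then 1 else 0 := by
  rw [abs_mul, abs_mul]
  have h1 := abs_oddPart_step_le ha (p 0) ω.1
  have h2 := abs_oddPart_step_le hb (p 1) ω.2.1
  have h3 := abs_oddPart_step_le hc (p 2) ω.2.2
  have h4 : ∀ P : Prop, (0 : ℝ) ≤ if P then 1 / 2 else 0 := fun P => by split_ifs <;> norm_num
  refine (mul_le_mul (mul_le_mul h1 h2 (abs_nonneg _) (h4 _)) h3 (abs_nonneg _)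
    (mul_nonneg (h4 _) (h4 _))).trans ?_
  unfold HitBox
  by_cases h1 : Hit a (p 0) ω.1 <;> by_cases h2 : Hit b (p 1) ω.2.1 <;>
    by_cases h3 : Hit c (p 2) ω.2.2 <;> (simp [h1, h2, h3]; try norm_num)

theorem sum_mul_digitDiscrepancy (A : Finset (Fin 3 → ℝ)) {s₁ s₂ s₃ : ℕ} (hs₁ : s₁ < m)
    (hs₂ : s₂ < m) (hs₃ : s₃ < m) {F : Cube m → ℝ}
    (h₁ : ∀ ω, F (flip₁ m s₁ ω) = -F ω) (h₂ : ∀ ω, F (flip₂ m s₂ ω) = -F ω)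
    (h₃ : ∀ ω, F (flip₃ m s₃ ω) = -F ω) :
    ∑ ω, F ω * digitDiscrepancy A ω
      = ∑ p ∈ A, ∑ ω, F ω * (oddPart s₁ (step (p 0)) ω.1 * oddPart s₂ (step (p 1)) ω.2.1
          * oddPart s₃ (step (p 2)) ω.2.2)
        - A.card * ((1 / 2) ^ (s₁ + s₂ + s₃ + 6)
          * ∑ ω, F ω * (rad s₁ ω.1 * rad s₂ ω.2.1 * rad s₃ ω.2.2)) := by
  simp only [digitDiscrepancy, mul_sub, mul_sum, sum_sub_distrib]
  rw [sum_comm]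
  congr 1
  · exact sum_congr rfl fun p _ => sum_mul_prod_eq_of_odd h₁ h₂ h₃ _ _ _
  · simp only [mul_left_comm _ (A.card : ℝ)]
    rw [← mul_sum, ← mul_sum, sum_mul_prod_eq_of_odd h₁ h₂ h₃]
    congr 1
    refine sum_congr rfl fun ω _ => ?_
    rw [oddPart_pos hs₁, oddPart_pos hs₂, oddPart_pos hs₃]
    ring

theorem abs_sum_mul_le {Ω : Type*} [Fintype Ω] {F G : Ω → ℝ} {C : ℝ} (hF : ∀ ω, |F ω| ≤ C) :
    |∑ ω, F ω * G ω| ≤ C * ∑ ω, |G ω| := by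
  refine (abs_sum_le_sum_abs _ _).trans ?_
  rw [mul_sum]
  refine sum_le_sum fun ω _ => ?_
  rw [abs_mul]
  exact mul_le_mul_of_nonneg_right (hF ω) (abs_nonneg _)

theorem abs_sum_mul_digitDiscrepancy_le (A : Finset (Fin 3 → ℝ)) {s₁ s₂ s₃ : ℕ} (hs₁ : s₁ < m)
    (hs₂ : s₂ < m) (hs₃ : s₃ < m) {F : Cube m → ℝ} {C : ℝ} (hF : ∀ ω, |F ω| ≤ C)
    (h₁ : ∀ ω, F (flip₁ m s₁ ω) = -F ω) (h₂ : ∀ ω, F (flip₂ m s₂ ω) = -F ω)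
    (h₃ : ∀ ω, F (flip₃ m s₃ ω) = -F ω) :
    |∑ ω, F ω * digitDiscrepancy A ω|
      ≤ C * (A.card * Fintype.card (Cube m) * (1 / 2) ^ (s₁ + s₂ + s₃)) := by
  classical
  have hC : 0 ≤ C := (abs_nonneg _).trans (hF (fun _ => false, fun _ => false, fun _ => false))
  rw [sum_mul_digitDiscrepancy A hs₁ hs₂ hs₃ h₁ h₂ h₃]
  have hp : ∀ p ∈ A, |∑ ω, F ω * (oddPart s₁ (step (p 0)) ω.1 * oddPart s₂ (step (p 1)) ω.2.1
      * oddPart s₃ (step (p 2)) ω.2.2)|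
      ≤ C * (1 / 8 * (Fintype.card (Cube m) * (1 / 2) ^ (s₁ + s₂ + s₃))) := by
    intro p _
    refine (abs_sum_mul_le hF).trans (mul_le_mul_of_nonneg_left ?_ hC)
    refine (sum_le_sum fun ω _ => abs_oddPart_step_mul_le hs₁.le hs₂.le hs₃.le p ω).trans ?_
    rw [← mul_sum]
    exact mul_le_mul_of_nonneg_left (sum_hitBox_le hs₁.le hs₂.le hs₃.le p) (by norm_num)
  have h4 := (abs_sum_le_sum_abs _ _).trans (sum_le_sum hp)
  rw [sum_const, nsmul_eq_mul] at h4
  have h5 : |∑ ω, F ω * (rad s₁ ω.1 * rad s₂ ω.2.1 * rad s₃ ω.2.2)|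
      ≤ C * Fintype.card (Cube m) := by
    refine (abs_sum_mul_le hF).trans (mul_le_mul_of_nonneg_left ?_ hC)
    refine (sum_le_sum fun ω _ => abs_rad_mul_le s₁ s₂ s₃ ω).trans ?_
    simp
  refine (abs_sub _ _).trans ((add_le_add h4 (?_ : _ ≤
    A.card * ((1 / 2) ^ (s₁ + s₂ + s₃ + 6) * (C * Fintype.card (Cube m))))).trans ?_)
  · rw [abs_mul, abs_mul, abs_of_nonneg (show (0 : ℝ) ≤ A.card by positivity),
      abs_of_nonneg (show (0 : ℝ) ≤ (1 / 2) ^ (s₁ + s₂ + s₃ + 6) by positivity)]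
    gcongr
  · rw [pow_add _ _ 6]
    have : 0 ≤ C * (A.card * Fintype.card (Cube m) * (1 / 2 : ℝ) ^ (s₁ + s₂ + s₃)) := by positivity
    nlinarith

/-- On an empty box the counting part has no odd component. The volume part contributes `2^(-n-6)`
times the Haar sign; the minus signs of `digitDiscrepancy` and `emptyBoxFun` cancel, and at least
half of the boxes are empty. -/
theorem le_sum_emptyBoxFun_mul (A : Finset (Fin 3 → ℝ)) {n a b c : ℕ} (ha : a < m) (hb : b < m)
    (hc : c < m) (habc : a + b + c = n) (hn : 2 * A.card ≤ 2 ^ n) :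
    A.card * Fintype.card (Cube m) * (1 / 2) ^ (n + 7)
      ≤ ∑ ω : Cube m, emptyBoxFun A n a b c ω * digitDiscrepancy A ω := by
  classical
  have hf := haarFamily_emptyBoxFun A m n
  rw [sum_mul_digitDiscrepancy A ha hb hc (hf.odd₁ a b c) (hf.odd₂ a b c) (hf.odd₃ a b c)]
  have h1 : ∑ p ∈ A, ∑ ω : Cube m, emptyBoxFun A n a b c ω * (oddPart a (step (p 0)) ω.1
      * oddPart b (step (p 1)) ω.2.1 * oddPart c (step (p 2)) ω.2.2) = 0 := by
    refine sum_eq_zero fun p hp => sum_eq_zero fun ω _ => ?_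
    have h2 := abs_oddPart_step_mul_le ha.le hb.le hc.le p ω
    by_cases h3 : HitBox a b c p ω
    · rw [emptyBoxFun, if_neg fun h4 => h4.2 p hp h3, zero_mul]
    · rw [if_neg h3, mul_zero] at h2
      rw [abs_nonpos_iff.1 h2, mul_zero]
  have h2 : ∀ ω : Cube m, emptyBoxFun A n a b c ω * (rad a ω.1 * rad b ω.2.1 * rad c ω.2.2)
      ≤ ∑ p ∈ A, (if HitBox a b c p ω then (1 : ℝ) else 0) - 1 := by
    intro ω
    unfold emptyBoxFun
    have h0 : ∀ p ∈ A, (0 : ℝ) ≤ if HitBox a b c p ω then (1 : ℝ) else 0 := fun p _ => by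
      split_ifs <;> norm_num
    split_ifs with h3
    · have e1 := rad_mul_self ha ω.1
      have e2 := rad_mul_self hb ω.2.1
      have e3 := rad_mul_self hc ω.2.2
      have e4 : -(rad a ω.1 * rad b ω.2.1 * rad c ω.2.2) * (rad a ω.1 * rad b ω.2.1 * rad c ω.2.2)
          = -((rad a ω.1 * rad a ω.1) * (rad b ω.2.1 * rad b ω.2.1)
            * (rad c ω.2.2 * rad c ω.2.2)) := by ring
      rw [e4, e1, e2, e3]
      linarith [sum_nonneg h0]
    · have : ∃ p ∈ A, HitBox a b c p ω := by
        by_contra h4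
        push Not at h4
        exact h3 ⟨habc, h4⟩
      obtain ⟨p, hp, hhit⟩ := this
      have := single_le_sum h0 hp
      rw [if_pos hhit] at this
      linarith
  have h3 : ∑ ω : Cube m, emptyBoxFun A n a b c ω * (rad a ω.1 * rad b ω.2.1 * rad c ω.2.2)
      ≤ -(Fintype.card (Cube m) / 2) := by
    refine (sum_le_sum fun ω _ => h2 ω).trans ?_
    rw [sum_sub_distrib, sum_comm]
    have h4 := sum_le_sum fun p (_ : p ∈ A) => sum_hitBox_le (m := m) ha.le hb.le hc.le p
    rw [sum_const, nsmul_eq_mul, habc] at h4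
    -- The boxes that are hit fill at most half of the cube.
    have h5 : (A.card : ℝ) * (1 / 2) ^ n ≤ 1 / 2 := by
      have : (2 * A.card : ℝ) ≤ 2 ^ n := by exact_mod_cast hn
      rw [one_div_pow, mul_one_div, div_le_iff₀ (by positivity)]
      linarith
    have h6 : (A.card : ℝ) * (Fintype.card (Cube m) * (1 / 2) ^ n)
        ≤ Fintype.card (Cube m) * (1 / 2) := by
      calc _ = (Fintype.card (Cube m) : ℝ) * (A.card * (1 / 2) ^ n) := by ring
        _ ≤ _ := by gcongr
    have h7 : ∑ _ω : Cube m, (1 : ℝ) = Fintype.card (Cube m) := by simp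
    linarith
  rw [h1, habc, zero_sub]
  have h4 := mul_le_mul_of_nonneg_left h3
    (show (0 : ℝ) ≤ A.card * (1 / 2) ^ (n + 6) by positivity)
  rw [show n + 7 = n + 6 + 1 by rfl, pow_succ]
  linarith

theorem pairsWith_digitDiscrepancy (A : Finset (Fin 3 → ℝ)) {n : ℕ} (hn : 2 * A.card ≤ 2 ^ n) :
    PairsWith n (flip₁ (n + 1)) (flip₂ (n + 1)) (flip₃ (n + 1)) (emptyBoxFun A n)
      (A.card * Fintype.card (Cube (n + 1))) (digitDiscrepancy A) where
  nonneg := by positivity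
  small F C s₁ s₂ s₃ hs₁ hs₂ hs₃ hF h₁ h₂ h₃ :=
    abs_sum_mul_digitDiscrepancy_le A (Nat.lt_succ_of_le hs₁) (Nat.lt_succ_of_le hs₂)
      (Nat.lt_succ_of_le hs₃) hF h₁ h₂ h₃
  large a b c h := le_sum_emptyBoxFun_mul A (by omega) (by omega) (by omega) h hn

end Cube

/-! ### The number of index triples. -/

section Counting

open Classical in
-- Pairs with both indices at most `n / 2` suffice; their block is determined.
theorem sq_le_four_mul_card_inBlock {n l q : ℕ} (hlq : n + 1 ≤ l * q) :
    (n + 1) ^ 2 ≤ 4 * (univ.filter fun v : Fin q × (Fin (n + 1) × Fin (n + 1)) =>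
      InBlock n l v.1 v.2).card := by
  have hdiv : ∀ i j : ℕ, (n - i - j) / l < q := fun i j => Nat.div_lt_of_lt_mul (by omega)
  have h1 : (univ : Finset (Fin (n / 2 + 1) × Fin (n / 2 + 1))).card
      ≤ (univ.filter fun v : Fin q × (Fin (n + 1) × Fin (n + 1)) => InBlock n l v.1 v.2).card := by
    refine card_le_card_of_injOn (fun x => (⟨(n - x.1 - x.2) / l, hdiv _ _⟩,
      (⟨x.1, by omega⟩, ⟨x.2, by omega⟩))) (fun x _ => ?_) (fun x _ y _ hxy => ?_)
    · refine mem_coe.2 (mem_filter.2 ⟨mem_univ _, ?_, rfl⟩)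
      have h1 := x.1.isLt
      have h2 := x.2.isLt
      simp only
      omega
    · simp only [Prod.mk.injEq, Fin.mk.injEq] at hxy
      exact Prod.ext (Fin.ext hxy.2.1) (Fin.ext hxy.2.2)
  rw [card_univ, Fintype.card_prod, Fintype.card_fin] at h1
  have h2 : n + 1 ≤ 2 * (n / 2 + 1) := by omega
  nlinarith

end Counting

/-! ### Pointwise values and the essential supremum. -/

section Discrepancy

open MeasureTheory Filter Topology

theorem box_volume {d : ℕ} {x : Fin d → ℝ} (hx : ∀ j, 0 ≤ x j) :
    volume.real (box x) = ∏ j, x j := by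
  have := Real.volume_pi_Ico_toReal (a := 0) (b := x) hx
  simpa [box, Measure.real] using this

open Classical in
theorem discrepancy_eq {d : ℕ} {A : Finset (Fin d → ℝ)} (hA : (A : Set (Fin d → ℝ)) ⊆ Set.Icc 0 1)
    {x : Fin d → ℝ} (hx : ∀ j, 0 ≤ x j) :
    discrepancy A x = (A.filter fun p => ∀ j, p j < x j).card - A.card * ∏ j, x j := by
  unfold discrepancy
  rw [box_volume hx]
  congr 2
  rw [← Set.ncard_coe_finset]
  congr 1
  ext p
  simp only [box, Set.mem_inter_iff, mem_coe, Set.mem_pi, Set.mem_univ, true_implies, Set.mem_Ico,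
    coe_filter, Set.mem_ofPred_eq]
  exact and_congr_right fun hp => forall_congr' fun j => and_iff_right ((hA hp).1 j)

/-- The conditions `p j < y j` are strict, so the count is constant as `y` approaches `x` from below
in every coordinate. -/
theorem tendsto_discrepancy {d : ℕ} {A : Finset (Fin d → ℝ)}
    (hA : (A : Set (Fin d → ℝ)) ⊆ Set.Icc 0 1) {x : Fin d → ℝ} (hx : ∀ j, 0 < x j) :
    Tendsto (discrepancy A) (𝓝[Set.univ.pi fun j => Set.Ioo 0 (x j)] x)
      (𝓝 (discrepancy A x)) := by
  classical
  rw [discrepancy_eq hA fun j => (hx j).le]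
  have h1 : ∀ᶠ y in 𝓝[Set.univ.pi fun j => Set.Ioo 0 (x j)] x,
      ∀ p ∈ A, ∀ j, (p j < y j ↔ p j < x j) := by
    rw [eventually_all_finset]
    intro p _
    rw [eventually_all]
    intro j
    by_cases hp : p j < x j
    · have : ∀ᶠ y : Fin d → ℝ in 𝓝 x, p j < y j :=
        (continuous_apply j).tendsto x |>.eventually (lt_mem_nhds hp)
      filter_upwards [this.filter_mono nhdsWithin_le_nhds] with y hy
      exact iff_of_true hy hp
    · filter_upwards [self_mem_nhdsWithin] with y hy
      exact iff_of_false (fun h => hp (h.trans (hy j trivial).2)) hp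
  have h2 : ∀ᶠ y in 𝓝[Set.univ.pi fun j => Set.Ioo 0 (x j)] x,
      ((A.filter fun p => ∀ j, p j < x j).card - A.card * ∏ j, y j : ℝ) = discrepancy A y := by
    filter_upwards [h1, self_mem_nhdsWithin] with y hy hy'
    rw [discrepancy_eq hA fun j => (hy' j trivial).1.le]
    congr 3
    exact filter_congr fun p hp => forall_congr' fun j => (hy p hp j).symm
  refine Tendsto.congr' h2 (tendsto_nhdsWithin_of_tendsto_nhds ?_)
  exact (continuous_const.sub (continuous_const.mul
    (continuous_finsetProd _ fun j _ => continuous_apply j))).tendsto x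

/-- Points just below `x` in every coordinate form nonempty open sets, of positive measure, so an
almost everywhere bound passes to the limit at `x`. -/
theorem abs_discrepancy_le_supNorm {d : ℕ} {A : Finset (Fin d → ℝ)}
    (hA : (A : Set (Fin d → ℝ)) ⊆ Set.Icc 0 1) {x : Fin d → ℝ} (hx : ∀ j, 0 < x j ∧ x j ≤ 1) :
    ENNReal.ofReal |discrepancy A x| ≤ supNorm (discrepancy A) := by
  have hlim := tendsto_discrepancy hA fun j => (hx j).1
  have hsub : (Set.univ.pi fun j => Set.Ioo 0 (x j)) ⊆ Set.Icc (0 : Fin d → ℝ) 1 := fun y hy =>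
    ⟨fun j => (hy j trivial).1.le, fun j => (hy j trivial).2.le.trans (hx j).2⟩
  have hae : ∀ᵐ y, y ∈ Set.Icc (0 : Fin d → ℝ) 1 →
      ‖discrepancy A y‖ₑ ≤ supNorm (discrepancy A) := by
    have := ae_le_eLpNormEssSup (f := discrepancy A)
      (μ := volume.restrict (Set.Icc (0 : Fin d → ℝ) 1))
    rw [ae_restrict_iff' measurableSet_Icc] at this
    simpa [supNorm] using this
  have hfreq : ∃ᶠ y in 𝓝[Set.univ.pi fun j => Set.Ioo 0 (x j)] x,
      discrepancy A y ∈ {z : ℝ | ENNReal.ofReal |z| ≤ supNorm (discrepancy A)} := by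
    intro hev
    obtain ⟨V, hVo, hxV, hV⟩ := mem_nhdsWithin.1 hev
    have hopen : IsOpen (Set.univ.pi fun j => Set.Ioo 0 (x j)) :=
      isOpen_set_pi Set.finite_univ fun j _ => isOpen_Ioo
    have hcl : x ∈ closure (Set.univ.pi fun j => Set.Ioo 0 (x j)) := by
      rw [closure_pi_set]
      intro j _
      simp only [closure_Ioo (hx j).1.ne]
      exact ⟨(hx j).1.le, le_rfl⟩
    have hne := mem_closure_iff.1 hcl V hVo hxV
    have hpos := (hVo.inter hopen).measure_pos volume hne
    refine hpos.ne' (measure_mono_null (fun y hy => ?_) hae)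
    have h1 := hV hy
    simp only [Set.mem_ofPred_eq, Set.mem_compl_iff, not_le] at h1 ⊢
    intro h2
    refine h1.not_ge ?_
    rw [← Real.norm_eq_abs, ofReal_norm]
    exact h2 (hsub hy.2)
  have hclosed : IsClosed {z : ℝ | ENNReal.ofReal |z| ≤ supNorm (discrepancy A)} :=
    isClosed_le (ENNReal.continuous_ofReal.comp continuous_abs) continuous_const
  exact hclosed.mem_of_frequently_of_tendsto hfreq hlim

theorem discrepancy_pos_eq {m : ℕ} {A : Finset (Fin 3 → ℝ)}
    (hA : (A : Set (Fin 3 → ℝ)) ⊆ Set.Icc 0 1) (ω : Cube m) :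
    discrepancy A ![pos ω.1, pos ω.2.1, pos ω.2.2] = digitDiscrepancy A ω := by
  classical
  rw [discrepancy_eq hA]
  · unfold digitDiscrepancy
    rw [Fin.prod_univ_three, card_filter]
    push_cast
    congr 1
    refine sum_congr rfl fun p _ => ?_
    simp only [Fin.forall_fin_succ, step]
    by_cases h1 : p 0 < pos ω.1 <;> by_cases h2 : p 1 < pos ω.2.1 <;>
      by_cases h3 : p 2 < pos ω.2.2 <;> simp [h1, h2, h3]
  · simp [Fin.forall_fin_succ, (pos_pos _).le]

/-- A box of volume `1 / (2 N)` has expected count `1 / 2`, at distance at least `1 / 2` from any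
integer. -/
theorem half_le_of_abs_discrepancy_le {A : Finset (Fin 3 → ℝ)}
    (hA : (A : Set (Fin 3 → ℝ)) ⊆ Set.Icc 0 1) (hN : 1 ≤ A.card) {B : ℝ}
    (hB : ∀ x : Fin 3 → ℝ, (∀ j, 0 < x j ∧ x j ≤ 1) → |discrepancy A x| ≤ B) : 1 / 2 ≤ B := by
  classical
  have hN' : (1 : ℝ) ≤ A.card := by exact_mod_cast hN
  have h0 : (0 : ℝ) < 1 / (2 * A.card) := by positivity
  have h1 : (1 : ℝ) / (2 * A.card) ≤ 1 := by rw [div_le_one (by positivity)]; linarith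
  refine le_trans ?_ (hB ![1, 1, 1 / (2 * A.card)] ?_)
  · rw [discrepancy_eq hA]
    · rw [Fin.prod_univ_three]
      have h2 : (A.card : ℝ) * (1 * 1 * (1 / (2 * A.card))) = 1 / 2 := by field_simp
      simp only [Matrix.cons_val]
      rw [h2]
      set c := (A.filter fun p => ∀ j, p j < ![(1 : ℝ), 1, 1 / (2 * A.card)] j).card
      rcases Nat.eq_zero_or_pos c with hc | hc
      · rw [hc]; norm_num
      · have : (1 : ℝ) ≤ c := by exact_mod_cast hc
        rw [abs_of_nonneg (by linarith)]
        linarith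
    · simp [Fin.forall_fin_succ]
  · simpa [Fin.forall_fin_succ] using ⟨card_pos.1 hN, by simpa using h1⟩

end Discrepancy

/-! ### Choice of parameters and conclusion. -/

section Bound

theorem le_of_abs_discrepancy_le {A : Finset (Fin 3 → ℝ)}
    (hA : (A : Set (Fin 3 → ℝ)) ⊆ Set.Icc 0 1) {B : ℝ}
    (hB : ∀ x : Fin 3 → ℝ, (∀ j, 0 < x j ∧ x j ≤ 1) → |discrepancy A x| ≤ B) {n : ℕ}
    (hn : 2 * A.card ≤ 2 ^ n) (hn' : 2 ^ n ≤ 4 * A.card) {K : ℝ} (hK : 10 ^ 5 ≤ K)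
    (hm : ((n + 1 : ℕ) : ℝ) = K ^ 2048) : (n + 1 : ℕ) * K ≤ 10 ^ 6 * B := by
  classical
  have hK0 : 0 < K := by linarith
  have hK1 : 1 ≤ K := by linarith
  set k : ℝ := K⁻¹ with hk
  have hk0 : 0 < k := inv_pos.2 hK0
  have hKk : K * k = 1 := mul_inv_cancel₀ hK0.ne'
  set q : ℕ := ⌈K ^ 3⌉₊ with hq
  have hq1 : K ^ 3 ≤ q := Nat.le_ceil _
  have hq2 : (q : ℝ) ≤ 2 * K ^ 3 := by
    have h1 := Nat.ceil_lt_add_one (show 0 ≤ K ^ 3 by positivity)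
    have h2 : 1 ≤ K ^ 3 := one_le_pow₀ hK1
    linarith
  have hq0 : 0 < q := Nat.ceil_pos.2 (by positivity)
  -- The `+ 1` ensures that `q` blocks of length `l` cover all first indices.
  set l : ℕ := (n + 1) / q + 1 with hl
  have hlq : n + 1 ≤ l * q := by
    have := Nat.lt_mul_div_succ (n + 1) hq0
    rw [mul_comm]
    exact this.le
  have hl2 : (l : ℝ) ≤ 2 * K ^ 2045 := by
    have h1 : (((n + 1) / q : ℕ) : ℝ) ≤ K ^ 2045 := by
      refine Nat.cast_div_le.trans ?_
      rw [hm, div_le_iff₀ (by positivity)]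
      calc K ^ 2048 = K ^ 2045 * K ^ 3 := by ring
        _ ≤ _ := by gcongr
    have h2 : 1 ≤ K ^ 2045 := one_le_pow₀ hK1
    rw [hl]
    push_cast at h1 ⊢
    linarith
  have hk1 : k ≤ 1 / 10 ^ 5 := by
    rw [hk, ← one_div]
    exact one_div_le_one_div_of_le (by norm_num) hK
  have hρq : 128 * k ^ 2047 * (q : ℝ) ^ 3 ≤ (1 / 2) ^ 8 := by
    calc 128 * k ^ 2047 * (q : ℝ) ^ 3 ≤ 128 * k ^ 2047 * (2 * K ^ 3) ^ 3 := by gcongr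
      _ = 1024 * k ^ 2038 * (K * k) ^ 9 := by ring
      _ = 1024 * (k ^ 2 * k ^ 2036) := by rw [hKk]; ring
      _ ≤ 1024 * ((1 / 10 ^ 5) ^ 2 * 1) := by
          have h1 : k ^ 2036 ≤ 1 := pow_le_one₀ hk0.le (hk1.trans (by norm_num))
          gcongr
      _ ≤ _ := by norm_num
  have hf := haarFamily_emptyBoxFun A (n + 1) n
  have h1 := hf.sum_abs_distinctSum_le hK hKk hm (Nat.succ_pos _) hl2 hq0 hq2
  have h2 := hf.le_sum_mul_distinctSum (l := l) (q := q) (pairsWith_digitDiscrepancy A hn)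
    (pow_nonneg hk0.le 2047) hρq
  set V := (univ.filter fun v : Fin q × (Fin (n + 1) × Fin (n + 1)) => InBlock n l v.1 v.2).card
  have hV : ((n + 1 : ℕ) : ℝ) ^ 2 ≤ 4 * V := by
    exact_mod_cast sq_le_four_mul_card_inBlock hlq
  have hd : ∀ ω : Cube (n + 1), |digitDiscrepancy A ω| ≤ B := by
    intro ω
    rw [← discrepancy_pos_eq hA]
    refine hB _ ?_
    simp [Fin.forall_fin_succ, pos_pos, pos_le_one]
  have hB0 : 0 ≤ B := (abs_nonneg _).trans (hd (fun _ => false, fun _ => false, fun _ => false))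
  set M : ℝ := (Fintype.card (Cube (n + 1)) : ℝ) with hM
  have hM0 : 0 < M := by rw [hM, card_cube]; positivity
  have h3 : -(B * M) ≤ ∑ ω : Cube (n + 1), digitDiscrepancy A ω := by
    have := sum_le_sum fun ω (_ : ω ∈ (univ : Finset (Cube (n + 1)))) =>
      neg_le_of_abs_le (hd ω)
    rw [sum_const, card_univ, nsmul_eq_mul] at this
    linarith
  have h4 : ∑ ω : Cube (n + 1), distinctSum (blockMatrix n (emptyBoxFun A n) l (k ^ 2047) (q := q) ω)
      * digitDiscrepancy A ω ≤ B * (28 * M) := by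
    refine le_trans (sum_le_sum fun ω _ => ?_)
      ((mul_sum _ _ _).symm.le.trans (mul_le_mul_of_nonneg_left h1 hB0))
    refine (le_abs_self _).trans ?_
    rw [abs_mul, mul_comm]
    exact mul_le_mul_of_nonneg_right (hd ω) (abs_nonneg _)
  have h5 : (1 : ℝ) / 4 ≤ A.card * (1 / 2) ^ n := by
    have : (2 : ℝ) ^ n ≤ 4 * A.card := by exact_mod_cast hn'
    rw [one_div_pow, mul_one_div, div_le_div_iff₀ (by norm_num) (by positivity)]
    linarith
  -- At least `(n + 1)² / 4` pairs, the factor `N 2^(-n) ≥ 1 / 4` and `2^(-8)` make up `1 / 4096`;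
  -- moreover `(n + 1) ρ = K`.
  have h6 : (n + 1 : ℕ) * K * (1 / 4096) * M
      ≤ V * (k ^ 2047 * (A.card * M * (1 / 2) ^ (n + 8))) := by
    calc (n + 1 : ℕ) * K * (1 / 4096) * M
        = ((n + 1 : ℕ) : ℝ) ^ 2 / 4 * (k ^ 2047 * (1 / 4 * M * (1 / 2) ^ 8)) := by
          have : ((n + 1 : ℕ) : ℝ) * k ^ 2047 = K := by
            rw [hm]
            calc K ^ 2048 * k ^ 2047 = K * (K * k) ^ 2047 := by ring
              _ = K := by rw [hKk]; ring
          calc _ = (n + 1 : ℕ) * (((n + 1 : ℕ) : ℝ) * k ^ 2047) * (1 / 4096) * M := by rw [this]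
            _ = _ := by ring
      _ ≤ V * (k ^ 2047 * (A.card * (1 / 2) ^ n * M * (1 / 2) ^ 8)) := by
          gcongr
          linarith
      _ = _ := by rw [pow_add]; ring
  -- `28` comes from the L¹ bound and `1` from the mean of the discrepancy.
  have h7 : (n + 1 : ℕ) * K * (1 / 4096) * M ≤ 29 * B * M := by linarith
  have h8 := le_of_mul_le_mul_right h7 hM0
  linarith

theorem exists_lower_bound : ∃ c : ℝ, 0 < c ∧ ∀ (A : Finset (Fin 3 → ℝ)) (B : ℝ), 1 ≤ A.card →
    (A : Set (Fin 3 → ℝ)) ⊆ Set.Icc 0 1 →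
    (∀ x : Fin 3 → ℝ, (∀ j, 0 < x j ∧ x j ≤ 1) → |discrepancy A x| ≤ B) →
    c * Real.log A.card ^ (1 + 1 / 2048 : ℝ) ≤ B := by
  obtain ⟨C, hC, hC1⟩ : ∃ C : ℝ, C = (10 ^ 5 : ℝ) ^ 2049 ∧ 1 ≤ C :=
    ⟨_, rfl, one_le_pow₀ (by norm_num)⟩
  refine ⟨1 / (10 ^ 6 * C), by positivity, fun A B hN hA hB => ?_⟩
  set n := Nat.log 2 A.card + 2 with hn
  have hn1 : 2 * A.card ≤ 2 ^ n := by
    have := Nat.lt_pow_succ_log_self (b := 2) (by norm_num) A.card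
    rw [hn, pow_succ]
    rw [Nat.succ_eq_add_one] at this
    omega
  have hn2 : 2 ^ n ≤ 4 * A.card := by
    have := Nat.pow_log_le_self 2 (x := A.card) (by omega)
    rw [hn, pow_add]
    omega
  have hN' : (1 : ℝ) ≤ A.card := by exact_mod_cast hN
  set K : ℝ := ((n + 1 : ℕ) : ℝ) ^ (1 / 2048 : ℝ) with hK
  have hm0 : (0 : ℝ) < (n + 1 : ℕ) := by positivity
  have hK0 : 0 < K := Real.rpow_pos_of_pos hm0 _
  have hm : ((n + 1 : ℕ) : ℝ) = K ^ 2048 := by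
    rw [hK, ← Real.rpow_natCast, ← Real.rpow_mul hm0.le]
    norm_num
  have hlog0 : 0 ≤ Real.log A.card := Real.log_nonneg hN'
  have hlog : Real.log A.card ≤ (n + 1 : ℕ) := by
    have h1 : (A.card : ℝ) ≤ 2 ^ n := by
      have : A.card ≤ 2 ^ n := by omega
      exact_mod_cast this
    have h2 := Real.log_le_log (by linarith) h1
    rw [Real.log_pow] at h2
    have h3 : Real.log 2 ≤ 1 := by linarith [Real.log_two_lt_d9]
    have h4 : (n : ℝ) * Real.log 2 ≤ n * 1 := by gcongr
    push_cast
    linarith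
  have hpow : Real.log A.card ^ (1 + 1 / 2048 : ℝ) ≤ (n + 1 : ℕ) * K := by
    refine (Real.rpow_le_rpow hlog0 hlog (by norm_num)).trans_eq ?_
    rw [Real.rpow_add hm0, Real.rpow_one]
  have hhalf := half_le_of_abs_discrepancy_le hA hN hB
  rw [one_div_mul_eq_div, div_le_iff₀ (by positivity)]
  refine hpow.trans ?_
  -- For `K ≤ 10 ^ 5` the product `(n + 1) K = K ^ 2049` is bounded, and the trivial bound `1 / 2`
  -- is enough.
  rcases le_total (10 ^ 5) K with h | h
  · refine (le_of_abs_discrepancy_le hA hB hn1 hn2 h hm).trans ?_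
    have : B * 1 ≤ B * C := by gcongr
    linarith
  · have h1 : (n + 1 : ℕ) * K ≤ C := by
      rw [hm, hC, ← pow_succ]
      gcongr
    have h2 : 1 / 2 * C ≤ B * C := by gcongr
    refine h1.trans ?_
    clear hC
    linarith

end Bound

end Discrepancy

theorem theorem2 :
    ∃ η : ℝ, 0 < η ∧ η < 1 / 2 ∧ ∃ c : ℝ, 0 < c ∧
      ∀ (N : ℕ) (A : Finset (Fin 3 → ℝ)), 1 ≤ N → A.card = N →
        (A : Set (Fin 3 → ℝ)) ⊆ Set.Icc 0 1 →
        ENNReal.ofReal (c * Real.log (N : ℝ) ^ (1 + η)) ≤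
          Discrepancy.supNorm (Discrepancy.discrepancy A) := by
  obtain ⟨c, hc, h⟩ := Discrepancy.exists_lower_bound
  refine ⟨1 / 2048, by norm_num, by norm_num, c, hc, fun N A hN hcard hA => ?_⟩
  subst hcard
  -- The infinite value is set apart because its `toReal` would be `0`.
  by_cases htop : Discrepancy.supNorm (Discrepancy.discrepancy A) = ⊤
  · rw [htop]; exact le_top
  refine ENNReal.ofReal_le_of_le_toReal (h A _ hN hA fun x hx => ?_)
  have := ENNReal.toReal_mono htop (Discrepancy.abs_discrepancy_le_supNorm hA hx)
  rwa [ENNReal.toReal_ofReal (abs_nonneg _)] at this
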